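/- **Model.** $n$ asynchronous deterministic processes communicate through an array $REG[1..m]$ of atomic multi-writer/multi-reader (MWMR) registers. At each instant one process is activated by an arbitrary scheduler. If it is not executing an operation, it invokes $\mathsf{propose}(s,v)$ for its next instance $s=1,2,\dots$ with an arbitrary value $v$ of a totally ordered set $V$; otherwise it performs one access to the shared memory; either is followed by local computation, possibly including the return of the current operation with a decided value. Any process may crash (be activated only finitely often); the others are correct. Processes are *anonymous* if they have the same code and the same initial local state, and the code does not depend on the index of the process. A protocol *solves repeated obstruction-free $(n,k)$-set agreement* if in every run: (Validity) a value decided in instance $s$ has been proposed to instance $s$; (Agreement) at most $k$ different values are decided in each instance; (OB-termination) if there is a time after which a process executes solo, it decides in every instance that it has started. **Algorithm.** A register holds a sixuplet $\langle sn,rd,lvl,cfl,val,dcd\rangle$ (sequence number, round, level $\mathrm{down}<\mathrm{up}$, conflict flag $\mathrm{false}<\mathrm{true}$, value in $V\cup\{\bot\}$ with $\bot$ smallest, list of past decisions), initially $\langle 0,0,\mathrm{down},\mathrm{false},\bot,[\,]\rangle$. Sixuplets are compared lexicographically on their first five fields. $\sup(T)$ is a maximal element of $T$ (ties resolved by any fixed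 rule) whose conflict flag is set to true iff, among the elements of $T$ with the same $sn$ and $rd$, one has $cfl=\mathrm{true}$ or two have different values. Each process keeps a list $dcd_i$, initially empty. In $\mathsf{propose}(s,v)$ it repeats: take a snapshot $view$ of $REG[1..m]$; then * if all entries agree on their first five fields, with $sn=s$ and $rd=r>0$, and have level, conflict flag and value $\ell,c,w$: if $\ell=\mathrm{up}$ and $c=\mathrm{false}$, set $dcd_i[s]\leftarrow w$ and return $w$; if $\ell=\mathrm{down}$ and $c=\mathrm{false}$, write $\langle s,r+1,\mathrm{up},\mathrm{false},w,dcd_i\rangle$ into $REG[1]$; if $c=\mathrm{true}$, write $\langle s,r+1,\mathrm{down},\mathrm{false},w,dcd_i\rangle$ into $REG[1]$; * otherwise let $X=\sup(view[1],\dots,view[m],\langle s,1,\mathrm{down},\mathrm{false},v,dcd_i\rangle)$; if $X.sn>s$, set $dcd_i[s]\leftarrow X.dcd[s]$ and return it; else write $X$ into $REG[x]$, where $x$ is the smallest index of a minimal entry of $view$. The *register version* of the algorithm replaces the snapshot object by the following implementation, which uses only reads and writes of the same $m$ registers. A register holds a pair (timestamp, value), with initially an undefined timestamp and the initial sixuplet.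 Each process has a counter, initially $0$; a write tags the value with the counter and increments the counter; a snapshot reads the whole array, register by register, again and again until $m(n-1)+2$ consecutive readings are identical, and returns their values. **Theorem.** Let $1\le k\le n$ and $m=n-k+1$, let $V$ be a totally ordered set, and let all processes be anonymous. 1. With an atomic snapshot object of $m=n-k+1$ entries, the algorithm solves repeated obstruction-free $(n,k)$-set agreement. Moreover (SV-termination), for every $s$, if to each instance $j\le s$ at most one value is proposed, then every correct process that proposes to instance $s$ decides in it. 2. The register version accesses the shared memory only through reads and writes of its $n-k+1$ MWMR registers, and it solves repeated obstruction-free $(n,k)$-set agreement. 3. This number of registers is optimal: if $k<n$ and $V$ has more than $k$ elements, every protocol (anonymous or not, with registers of any size, even if it may take atomic snapshots of the registers) that solves repeated obstruction-free $(n,k)$-set agreement for $n$ processes and the value set $V$ uses at least $n-k+1$ registers. -/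

import Mathlib

universe u v w

/-! ## Asynchronous shared memory: programs, protocols, runs -/

/-- Result of the local computation that follows an event of a process: either the running
operation `propose` returns a value (and the process keeps the local state `s` for its next
invocation), or the process goes on executing `propose` in local state `b`. -/
inductive Outcome (V : Type u) (Idle Busy : Type w) where
  | ret (val : V) (s : Idle)
  | stay (b : Busy)

/-- One atomic access to an array of `m` multi-writer/multi-reader registers with content in `R`,
together with the local computation that follows it. A `snapshot` returns the whole array;
a read/write program does not use it. -/
inductive Access (m : ℕ) (R : Type v) (O : Type*) where
  | read (x : Fin m) (next : R → O)
  | snapshot (next : (Fin m → R) → O)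
  | write (x : Fin m) (r : R) (next : O)

/-- The deterministic code of one process. `start` is the local state before the first invocation,
`propose sn val s` starts the invocation `propose(sn, val)` from the local state `s`, and
`access b` is the next access to the shared memory of a process that is executing `propose`. -/
structure Program (V : Type u) (R : Type v) (m : ℕ) where
  Idle : Type w
  Busy : Type w
  start : Idle
  propose : ℕ → V → Idle → Outcome V Idle Busy
  access : Busy → Access m R (Outcome V Idle Busy)

/-- A protocol for `n` processes and `m` registers: the initial content of the registers and the
code of every process. The processes need not be anonymous. -/
structure Protocol (V : Type u) (n m : ℕ) where
  Reg : Type v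
  memStart : Fin m → Reg
  code : Fin n → Program.{u, v, w} V Reg m

/-- The protocol in which all processes are anonymous: they have the same code and the same
initial local state, and the code does not receive the index of the process. -/
def Protocol.anonymous {V : Type u} (n : ℕ) {m : ℕ} {R : Type v} (memStart : Fin m → R)
    (A : Program.{u, v, w} V R m) : Protocol.{u, v, w} V n m where
  Reg := R
  memStart := memStart
  code := fun _ => A

namespace Protocol

variable {V : Type u} {n m : ℕ}

/-- Every access to the shared memory is a read or a write of a single register. -/
def ReadWrite (P : Protocol.{u, v, w} V n m) : Prop :=
  ∀ i b next, (P.code i).access b ≠ Access.snapshot next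

/-- A global state. `sn i` is the number of invocations of `propose` by process `i` so far.
`prop` and `dec` are the history seen by an external observer: `prop i s` is the value that
process `i` has proposed to instance `s`, and `dec i s` the value that it has decided in
instance `s` (`none` as long as it has not done so). -/
structure Config (P : Protocol.{u, v, w} V n m) where
  mem : Fin m → P.Reg
  loc : ∀ i : Fin n, (P.code i).Idle ⊕ (P.code i).Busy
  sn : Fin n → ℕ
  prop : Fin n → ℕ → Option V
  dec : Fin n → ℕ → Option V

variable (P : Protocol.{u, v, w} V n m)

/-- The initial global state. -/
def first : P.Config where
  mem := P.memStart
  loc := fun i => Sum.inl (P.code i).start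
  sn := fun _ => 0
  prop := fun _ _ => none
  dec := fun _ _ => none

variable {P}

/-- Process `i` performs the outcome `o` of its local computation. -/
def Config.settle (C : P.Config) (i : Fin n)
    (o : Outcome V (P.code i).Idle (P.code i).Busy) : P.Config :=
  match o with
  | .ret val s =>
      { C with
        loc := Function.update C.loc i (Sum.inl s)
        dec := Function.update C.dec i (Function.update (C.dec i) (C.sn i) (some val)) }
  | .stay b => { C with loc := Function.update C.loc i (Sum.inr b) }

/-- Event `(i, val)`: process `i` is activated. If it is not executing `propose`, it invokes
`propose` on its next instance with the value `val`; otherwise it performs its next access to the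
shared memory (and `val` is not used). -/
def Config.step (C : P.Config) (e : Fin n × V) : P.Config :=
  match C.loc e.1 with
  | Sum.inl s =>
      let j := C.sn e.1 + 1
      Config.settle
        { C with
          sn := Function.update C.sn e.1 j
          prop := Function.update C.prop e.1 (Function.update (C.prop e.1) j (some e.2)) }
        e.1 ((P.code e.1).propose j e.2 s)
  | Sum.inr b =>
      match (P.code e.1).access b with
      | .read x next => C.settle e.1 (next (C.mem x))
      | .snapshot next => C.settle e.1 (next C.mem)
      | .write x r next => Config.settle { C with mem := Function.update C.mem x r } e.1 next

variable (P)

/-- The global state after the first `t` events of the schedule `σ`. A schedule is arbitrary: any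
interleaving, any proposals, and any process may crash, i.e. be activated only finitely often. -/
def run (σ : ℕ → Fin n × V) : ℕ → P.Config
  | 0 => P.first
  | t + 1 => (run σ t).step (σ t)

/-- A value decided in an instance has been proposed to this instance by some process. -/
def Validity : Prop :=
  ∀ (σ : ℕ → Fin n × V) (t : ℕ) (i : Fin n) (s : ℕ) (val : V),
    (P.run σ t).dec i s = some val → ∃ j, (P.run σ t).prop j s = some val

/-- At most `k` different values are decided in each instance. -/
def Agreement (k : ℕ) : Prop :=
  ∀ (σ : ℕ → Fin n × V) (s : ℕ),
    {val : V | ∃ t i, (P.run σ t).dec i s = some val}.encard ≤ k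

/-- If there is a time after which a process executes solo, it decides in all the instances in
which it has proposed a value. -/
def OBTermination : Prop :=
  ∀ (σ : ℕ → Fin n × V) (i : Fin n) (T : ℕ), (∀ t, T ≤ t → (σ t).1 = i) →
    ∀ t s, (P.run σ t).prop i s ≠ none → ∃ t', (P.run σ t').dec i s ≠ none

/-- At most one value is proposed to instance `s`. -/
def SingleValued (σ : ℕ → Fin n × V) (s : ℕ) : Prop :=
  ∀ t i j a b, (P.run σ t).prop i s = some a → (P.run σ t).prop j s = some b → a = b

/-- If a single value is proposed to each instance up to `s`, then all correct processes that
propose to instance `s` decide in it. -/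
def SVTermination : Prop :=
  ∀ (σ : ℕ → Fin n × V) (s : ℕ), (∀ j, j ≤ s → P.SingleValued σ j) →
    ∀ i : Fin n, (∀ T, ∃ t, T ≤ t ∧ (σ t).1 = i) →
      ∀ t, (P.run σ t).prop i s ≠ none → ∃ t', (P.run σ t').dec i s ≠ none

/-- The protocol solves repeated obstruction-free `(n, k)`-set agreement. -/
def SolvesRepeatedSetAgreement (k : ℕ) : Prop :=
  P.Validity ∧ P.Agreement k ∧ P.OBTermination

end Protocol

/-! ## The algorithm for repeated set agreement, on a snapshot object -/

/-- Content of a register: sequence number, round number, level (`up = true` for "up"),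
conflict flag, value, and list of the values decided in the past instances. -/
structure Sixuplet (V : Type u) where
  sn : ℕ
  rd : ℕ
  up : Bool
  cfl : Bool
  val : WithBot V
  dcd : List V
  deriving DecidableEq

namespace Sixuplet

variable {V : Type u}

/-- The first five fields, with the lexicographical order. -/
def key (X : Sixuplet V) : ℕ ×ₗ ℕ ×ₗ Bool ×ₗ Bool ×ₗ WithBot V :=
  toLex (X.sn, toLex (X.rd, toLex (X.up, toLex (X.cfl, X.val))))

/-- The initial content of the registers. -/
def bottom : Sixuplet V := ⟨0, 0, false, false, ⊥, []⟩

variable [LinearOrder V]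

/-- `mx` selects a maximal element of every nonempty list. Only the first five fields are compared,
so that there may be several maximal elements, with different lists of past decisions; which one
is selected is left open. -/
def IsMaxRule (mx : List (Sixuplet V) → Sixuplet V) : Prop :=
  ∀ T, T ≠ [] → mx T ∈ T ∧ ∀ X ∈ T, X.key ≤ (mx T).key

/-- The function `sup`: the maximal element of `T`, whose conflict flag is set if, among the
sixuplets of `T` with the same sequence number and round, there is one with its flag set
(inherited conflict) or there are two with different values (discovered conflict). -/
def sup (mx : List (Sixuplet V) → Sixuplet V) (T : List (Sixuplet V)) : Sixuplet V :=
  { mx T with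
    cfl := decide (
      (∃ X ∈ T, X.sn = (mx T).sn ∧ X.rd = (mx T).rd ∧ X.cfl = true) ∨
      (∃ X ∈ T, ∃ Y ∈ T, (X.sn = (mx T).sn ∧ X.rd = (mx T).rd) ∧
        (Y.sn = (mx T).sn ∧ Y.rd = (mx T).rd) ∧ X.val ≠ Y.val)) }

theorem exists_minimal {d : ℕ} (view : Fin (d + 1) → Sixuplet V) :
    (Finset.univ.filter fun x => ∀ y, (view x).key ≤ (view y).key).Nonempty := by
  obtain ⟨x, hx⟩ := Finite.exists_min fun x => (view x).key
  exact ⟨x, by simpa using hx⟩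

/-- The smallest index of a minimal entry of `view`. -/
def minIndex {d : ℕ} (view : Fin (d + 1) → Sixuplet V) : Fin (d + 1) :=
  (Finset.univ.filter fun x => ∀ y, (view x).key ≤ (view y).key).min' (exists_minimal view)

end Sixuplet

/-- Local state of a process that is executing `propose(sn, val)`, where `dcd` is its list of past
decisions: it is about to take a snapshot if `pending = none`, and to write `X` into register `x`
if `pending = some (x, X)`. -/
structure Proposing (V : Type u) (d : ℕ) where
  sn : ℕ
  val : V
  dcd : List V
  pending : Option (Fin (d + 1) × Sixuplet V)

namespace Proposing

variable {V : Type u} {d : ℕ}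

/-- The process records the decided value in its list and returns it. During `propose(sn, _)` the
list has length `sn - 1`, so that appending sets its entry number `sn`. If the value does not
exist (which cannot happen in a run) the process merely repeats its loop. -/
def finish (b : Proposing V d) : Option V → Outcome V (List V) (Proposing V d)
  | some a => .ret a (b.dcd ++ [a])
  | none => .stay { b with pending := none }

/-- The process decides to write `X` into register `x`. -/
def goWrite (b : Proposing V d) (x : Fin (d + 1)) (X : Sixuplet V) :
    Outcome V (List V) (Proposing V d) :=
  .stay { b with pending := some (x, X) }

variable [LinearOrder V]

/-- The local computation after a snapshot has returned `view`. The first test says that all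
entries have the same first five fields, with sequence number `b.sn` and a positive round. -/
def afterSnapshot (mx : List (Sixuplet V) → Sixuplet V) (b : Proposing V d)
    (view : Fin (d + 1) → Sixuplet V) : Outcome V (List V) (Proposing V d) :=
  let X := view 0
  if (∀ x, (view x).key = X.key) ∧ X.sn = b.sn ∧ 0 < X.rd then
    match X.up, X.cfl with
    | true, false => b.finish X.val
    | false, false => b.goWrite 0 ⟨b.sn, X.rd + 1, true, false, X.val, b.dcd⟩
    | _, true => b.goWrite 0 ⟨b.sn, X.rd + 1, false, false, X.val, b.dcd⟩
  else
    let S := Sixuplet.sup mx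
      (List.ofFn view ++ [⟨b.sn, 1, false, false, (b.val : WithBot V), b.dcd⟩])
    if b.sn < S.sn then b.finish S.dcd[b.sn - 1]?
    else b.goWrite (Sixuplet.minIndex view) S

end Proposing

/-- The code of the repeated set agreement algorithm, for `d + 1` registers that can be accessed
with the operations `snapshot` and `write`. Between two invocations of `propose`, a process
remembers its list of past decisions only (and its sequence number). -/
def repeatedProgram {V : Type u} [LinearOrder V] (d : ℕ)
    (mx : List (Sixuplet V) → Sixuplet V) : Program.{u, u, u} V (Sixuplet V) (d + 1) where
  Idle := List V
  Busy := Proposing V d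
  start := []
  propose := fun sn val dcd => .stay ⟨sn, val, dcd, none⟩
  access := fun b =>
    match b.pending with
    | none => .snapshot fun view => b.afterSnapshot mx view
    | some (x, X) => .write x X (.stay { b with pending := none })

/-- The algorithm for `n` anonymous processes on a snapshot object with `n - k + 1` entries. -/
def snapshotProtocol {V : Type u} [LinearOrder V] (n k : ℕ)
    (mx : List (Sixuplet V) → Sixuplet V) : Protocol.{u, u, u} V n (n - k + 1) :=
  Protocol.anonymous n (fun _ => Sixuplet.bottom) (repeatedProgram (n - k) mx)

/-! ## The snapshot object implemented from the same number of read/write registers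

A register holds a pair of a timestamp (initially `none`) and a value. A write tags the value with
the local counter `ts` of the process and increments it. A snapshot reads the whole array again and
again until it has obtained the same array `m * (n - 1) + 2` times in a row. -/

/-- Local variables of a process that is executing a snapshot: `y` is the next register to read,
`sm2` the array being read, `sm1` the array read before it (meaningless while `initial`, i.e. during
the first reading of the array), and `count` the number of consecutive identical arrays so far. -/
structure Scan (m : ℕ) (R : Type v) where
  y : Fin m
  sm1 : Fin m → Option ℕ × R
  sm2 : Fin m → Option ℕ × R
  initial : Bool
  count : ℕ

namespace Scan

variable {m : ℕ} {R : Type v}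

/-- The beginning of a snapshot (the content of the local arrays is irrelevant). -/
def begin [NeZero m] (mem : Fin m → R) : Scan m R :=
  ⟨0, fun x => (none, mem x), fun x => (none, mem x), true, 0⟩

/-- The read of register `y` has returned `r`: the snapshot continues, or returns an array. -/
def next [NeZero m] [DecidableEq R] (n : ℕ) (S : Scan m R) (r : Option ℕ × R) :
    Scan m R ⊕ (Fin m → R) :=
  let sm2 := Function.update S.sm2 S.y r
  if h : S.y.val + 1 < m then .inl { S with y := ⟨S.y.val + 1, h⟩, sm2 := sm2 }
  else
    if S.initial = false ∧ S.sm1 = sm2 then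
      if S.count + 1 = m * (n - 1) + 2 then .inr fun x => (S.sm1 x).2
      else .inl ⟨0, sm2, sm2, false, S.count + 1⟩
    else .inl ⟨0, sm2, sm2, false, 1⟩

end Scan

/-- Local state of a process that executes the program `A` on read/write registers. -/
structure Layered {V : Type u} {R : Type v} {m : ℕ} (A : Program.{u, v, max v w} V R m) where
  inner : A.Busy
  ts : ℕ
  scan : Scan m R

/-- A process with counter `ts` performs the outcome of a local computation of `A`. -/
def Layered.lift {V : Type u} {R : Type v} {m : ℕ} [NeZero m] {A : Program.{u, v, max v w} V R m}
    (mem : Fin m → R) (ts : ℕ) :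
    Outcome V A.Idle A.Busy → Outcome V (A.Idle × ℕ) (Layered.{u, v, w} A)
  | .ret val s => .ret val (s, ts)
  | .stay b => .stay ⟨b, ts, Scan.begin mem⟩

/-- The program `A` executed by one of `n` processes on read/write registers, where snapshots and
writes are replaced by their implementation. `mem` is the initial content of the array. -/
def Program.onRegisters {V : Type u} {R : Type v} {m : ℕ} [NeZero m] [DecidableEq R]
    (n : ℕ) (mem : Fin m → R) (A : Program.{u, v, max v w} V R m) :
    Program.{u, v, max v w} V (Option ℕ × R) m where
  Idle := A.Idle × ℕ
  Busy := Layered.{u, v, w} A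
  start := (A.start, 0)
  propose := fun sn val s => Layered.lift mem s.2 (A.propose sn val s.1)
  access := fun b =>
    match A.access b.inner with
    | .read x next => .read x fun r => Layered.lift mem b.ts (next r.2)
    | .snapshot next => .read b.scan.y fun r =>
        match b.scan.next n r with
        | .inl S => .stay { b with scan := S }
        | .inr view => Layered.lift mem b.ts (next view)
    | .write x r next => .write x (some b.ts, r) (Layered.lift mem (b.ts + 1) next)

/-- The algorithm for `n` anonymous processes on `n - k + 1` read/write registers. -/
def registerProtocol {V : Type u} [LinearOrder V] (n k : ℕ)
    (mx : List (Sixuplet V) → Sixuplet V) : Protocol.{u, u, u} V n (n - k + 1) :=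
  Protocol.anonymous n (fun _ => (none, Sixuplet.bottom))
    (Program.onRegisters.{u, u, u} n (fun _ => Sixuplet.bottom) (repeatedProgram (n - k) mx))

/-!
Lower bound, by covering. Suppose that there are at most `n - k` registers. The processes can be
brought to a state in which some of them are about to write into registers that include all those
into which some other process writes in its solo runs. This process decides its own value in a new
instance, the covering processes then overwrite all traces of its run, and the argument is repeated
without it. In this way `k + 1` values are decided in the same instance.

Safety, with `n - k + 1` registers. Call a sixuplet good if it has some property that passes from a
single entry of a snapshot to whatever is written after it. As long as at most `n - k` registers and
pending writes are bad, every snapshot sees a good entry, so that no further bad sixuplet is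
announced. When `k` values are decided or have entered level "up" of a round that no register has
reached yet, each of them is carried by a process of its own; this leaves at most `n - k` processes
that are about to write something bad, and no further value can follow.

Termination. A process running solo fills the registers with one sixuplet and then decides after at
most two more rounds. If a single value is proposed there are no conflicts, and every write replaces
a minimal entry, so that the minimum of the registers rises.

Reads and writes. The counters prevent a process from writing the same pair twice into a register,
so that the `n - 1` other processes write entries of a given array to their places at most
`m * (n - 1)` times. One of `m * (n - 1) + 2` identical readings is therefore free of such writes.
When it began, the memory was equal to the array read, and the snapshot is linearized at this time.
-/

namespace Protocol

variable {V : Type u} {n m : ℕ} {P : Protocol.{u, v, w} V n m}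

namespace Config

/-- The invocation of `propose` with the value `a` by process `i`, before the local computation
that follows it. -/
def invoke (C : P.Config) (i : Fin n) (a : V) : P.Config :=
  { C with
    sn := Function.update C.sn i (C.sn i + 1)
    prop := Function.update C.prop i (Function.update (C.prop i) (C.sn i + 1) (some a)) }

section Settle

variable (C : P.Config) (i : Fin n) (o : Outcome V (P.code i).Idle (P.code i).Busy)

@[simp] theorem mem_settle : (C.settle i o).mem = C.mem := by cases o <;> rfl

@[simp] theorem sn_settle : (C.settle i o).sn = C.sn := by cases o <;> rfl

@[simp] theorem prop_settle : (C.settle i o).prop = C.prop := by cases o <;> rfl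

theorem dec_settle_of_ne {j : Fin n} {s : ℕ} (h : s ≠ C.sn j) :
    (C.settle i o).dec j s = C.dec j s := by
  cases o with
  | ret val t =>
    by_cases hj : j = i
    · subst hj
      simp [settle, h]
    · simp [settle, hj]
  | stay b => rfl

end Settle

section Step

variable {C : P.Config} {e : Fin n × V}

theorem step_of_idle {s : (P.code e.1).Idle} (h : C.loc e.1 = Sum.inl s) :
    C.step e = (C.invoke e.1 e.2).settle e.1 ((P.code e.1).propose (C.sn e.1 + 1) e.2 s) := by
  simp only [step, h, invoke]

theorem step_of_read {b : (P.code e.1).Busy} {x next} (h : C.loc e.1 = Sum.inr b)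
    (ha : (P.code e.1).access b = .read x next) :
    C.step e = C.settle e.1 (next (C.mem x)) := by
  simp only [step, h, ha]

theorem step_of_snapshot {b : (P.code e.1).Busy} {next} (h : C.loc e.1 = Sum.inr b)
    (ha : (P.code e.1).access b = .snapshot next) :
    C.step e = C.settle e.1 (next C.mem) := by
  simp only [step, h, ha]

theorem step_of_write {b : (P.code e.1).Busy} {x r next} (h : C.loc e.1 = Sum.inr b)
    (ha : (P.code e.1).access b = .write x r next) :
    C.step e = Config.settle { C with mem := Function.update C.mem x r } e.1 next := by
  simp only [step, h, ha]

theorem step_eq_settle (C : P.Config) (e : Fin n × V) :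
    (∃ s o, C.loc e.1 = Sum.inl s ∧ C.step e = (C.invoke e.1 e.2).settle e.1 o) ∨
      ∃ b mem o, C.loc e.1 = Sum.inr b ∧
        C.step e = Config.settle { C with mem := mem } e.1 o := by
  cases h : C.loc e.1 with
  | inl s => exact .inl ⟨s, _, rfl, step_of_idle h⟩
  | inr b =>
    cases ha : (P.code e.1).access b with
    | read x next => exact .inr ⟨b, _, _, rfl, step_of_read h ha⟩
    | snapshot next => exact .inr ⟨b, _, _, rfl, step_of_snapshot h ha⟩
    | write x r next => exact .inr ⟨b, _, _, rfl, step_of_write h ha⟩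

theorem step_congr_of_isRight {i : Fin n} (h : (C.loc i).isRight) (a b : V) :
    C.step (i, a) = C.step (i, b) := by
  obtain ⟨s, hs⟩ := Sum.isRight_iff.1 h
  cases ha : (P.code i).access s with
  | read => rw [step_of_read (e := (i, a)) hs ha, step_of_read (e := (i, b)) hs ha]
  | snapshot => rw [step_of_snapshot (e := (i, a)) hs ha, step_of_snapshot (e := (i, b)) hs ha]
  | write => rw [step_of_write (e := (i, a)) hs ha, step_of_write (e := (i, b)) hs ha]

theorem sn_step_of_isLeft (h : (C.loc e.1).isLeft) : (C.step e).sn e.1 = C.sn e.1 + 1 := by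
  obtain ⟨s, hs⟩ := Sum.isLeft_iff.1 h
  simp [step_of_idle hs, invoke]

theorem sn_step_of_isRight (h : (C.loc e.1).isRight) : (C.step e).sn = C.sn := by
  rcases step_eq_settle C e with ⟨s, o, hs, -⟩ | ⟨b, mem, o, -, heq⟩
  · simp [hs] at h
  · rw [heq, sn_settle]

end Step

/-- The global state after a finite sequence of events. -/
def exec (C : P.Config) (L : List (Fin n × V)) : P.Config := L.foldl step C

@[simp] theorem exec_nil (C : P.Config) : C.exec [] = C := rfl

@[simp] theorem exec_cons (C : P.Config) (e : Fin n × V) (L : List (Fin n × V)) :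
    C.exec (e :: L) = (C.step e).exec L := rfl

theorem exec_append (C : P.Config) (L M : List (Fin n × V)) :
    C.exec (L ++ M) = (C.exec L).exec M := List.foldl_append

end Config

open Config

/-- The sequence of events in which process `i` is activated `t` times. -/
def solo (i : Fin n) (a : V) (t : ℕ) : List (Fin n × V) := List.replicate t (i, a)

theorem eq_of_mem_solo {i : Fin n} {a : V} {t : ℕ} {e : Fin n × V} (h : e ∈ solo i a t) :
    e = (i, a) :=
  List.eq_of_mem_replicate h

theorem exec_solo_add (C : P.Config) (i : Fin n) (a : V) (s t : ℕ) :
    C.exec (solo i a (s + t)) = (C.exec (solo i a s)).exec (solo i a t) := by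
  rw [solo, List.replicate_add, exec_append]
  rfl

theorem exec_solo_succ (C : P.Config) (i : Fin n) (a : V) (t : ℕ) :
    C.exec (solo i a (t + 1)) = (C.exec (solo i a t)).step (i, a) :=
  exec_solo_add C i a t 1

/-- A global state is reachable if a finite sequence of events leads to it. -/
def Reachable (C : P.Config) : Prop := ∃ L, P.first.exec L = C

theorem reachable_first : Reachable P.first := ⟨[], rfl⟩

theorem Reachable.exec {C : P.Config} (h : Reachable C) (L : List (Fin n × V)) :
    Reachable (C.exec L) := by
  obtain ⟨M, rfl⟩ := h
  exact ⟨M ++ L, exec_append _ _ _⟩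

theorem Reachable.step {C : P.Config} (h : Reachable C) (e : Fin n × V) :
    Reachable (C.step e) := h.exec [e]

theorem Reachable.induction {p : P.Config → Prop} (first : p P.first)
    (step : ∀ C e, Reachable C → p C → p (C.step e)) {C : P.Config} (h : Reachable C) : p C := by
  obtain ⟨L, rfl⟩ := h
  induction L using List.reverseRecOn with
  | nil => exact first
  | append_singleton L e ih => exact exec_append P.first L [e] ▸ step _ e ⟨L, rfl⟩ ih

theorem run_add (σ : ℕ → Fin n × V) (s t : ℕ) :
    P.run σ (s + t) = (P.run σ s).exec ((List.range t).map fun j => σ (s + j)) := by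
  induction t with
  | zero => rfl
  | succ t ih =>
    rw [List.range_succ, List.map_append, exec_append, ← ih]
    rfl

theorem run_eq_exec (σ : ℕ → Fin n × V) (t : ℕ) :
    P.run σ t = P.first.exec ((List.range t).map σ) := by
  have h := run_add (P := P) σ 0 t
  simp only [zero_add] at h
  exact h

theorem reachable_run (σ : ℕ → Fin n × V) (t : ℕ) : Reachable (P.run σ t) :=
  ⟨_, (run_eq_exec σ t).symm⟩

/-- The schedule that starts with the events of a list and continues with a constant event. -/
def listSchedule (L : List (Fin n × V)) (e : Fin n × V) : ℕ → Fin n × V := fun t => L.getD t e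

theorem run_listSchedule (L : List (Fin n × V)) (i : Fin n) (a : V) (t : ℕ) :
    P.run (listSchedule L (i, a)) (L.length + t) = (P.first.exec L).exec (solo i a t) := by
  rw [run_add, run_eq_exec]
  congr
  · refine List.ext_getElem (by simp) fun j _ hj => ?_
    simp [listSchedule, List.getElem?_eq_getElem hj]
  · refine List.ext_getElem (by simp [solo]) fun j _ _ => ?_
    simp [listSchedule, solo]

theorem Reachable.exists_run {C : P.Config} (h : Reachable C) (i : Fin n) (a : V) :
    ∃ σ t, P.run σ t = C := by
  obtain ⟨L, rfl⟩ := h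
  exact ⟨listSchedule L (i, a), L.length, run_listSchedule L i a 0⟩

/-- The parts of two global states that concern process `i` are equal. -/
structure SameAt (i : Fin n) (C D : P.Config) : Prop where
  loc : C.loc i = D.loc i
  sn : C.sn i = D.sn i
  prop : C.prop i = D.prop i
  dec : C.dec i = D.dec i

theorem SameAt.refl (i : Fin n) (C : P.Config) : SameAt i C C := ⟨rfl, rfl, rfl, rfl⟩

theorem SameAt.symm {i : Fin n} {C D : P.Config} (h : SameAt i C D) : SameAt i D C :=
  ⟨h.loc.symm, h.sn.symm, h.prop.symm, h.dec.symm⟩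

theorem SameAt.trans {i : Fin n} {C D E : P.Config} (h : SameAt i C D) (h' : SameAt i D E) :
    SameAt i C E :=
  ⟨h.loc.trans h'.loc, h.sn.trans h'.sn, h.prop.trans h'.prop, h.dec.trans h'.dec⟩

theorem Config.ext_of_sameAt {C D : P.Config} (hm : C.mem = D.mem) (h : ∀ i, SameAt i C D) :
    C = D := by
  cases C
  cases D
  congr
  exacts [funext fun i => (h i).loc, funext fun i => (h i).sn, funext fun i => (h i).prop,
    funext fun i => (h i).dec]

theorem SameAt.settle {C D : P.Config} {i : Fin n} (h : SameAt i C D)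
    (o : Outcome V (P.code i).Idle (P.code i).Busy) :
    SameAt i (C.settle i o) (D.settle i o) := by
  cases o <;> constructor <;> simp [Config.settle, h.sn, h.prop, h.dec]

theorem sameAt_settle (C : P.Config) {i j : Fin n} (h : j ≠ i)
    (o : Outcome V (P.code i).Idle (P.code i).Busy) : SameAt j (C.settle i o) C := by
  cases o <;> constructor <;> simp [Config.settle, h]

theorem sameAt_step (C : P.Config) (e : Fin n × V) {j : Fin n} (h : j ≠ e.1) :
    SameAt j (C.step e) C := by
  rcases step_eq_settle C e with ⟨s, o, -, heq⟩ | ⟨b, mem, o, -, heq⟩ <;> rw [heq] <;>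
    refine (sameAt_settle _ h o).trans ?_
  · constructor <;> simp [invoke, h]
  · exact ⟨rfl, rfl, rfl, rfl⟩

theorem sameAt_exec (C : P.Config) (L : List (Fin n × V)) {j : Fin n} (h : ∀ e ∈ L, e.1 ≠ j) :
    SameAt j (C.exec L) C := by
  induction L generalizing C with
  | nil => exact SameAt.refl j C
  | cons e L ih =>
    rw [List.forall_mem_cons] at h
    exact (ih _ h.2).trans (sameAt_step _ _ h.1.symm)

theorem sameAt_exec_solo (C : P.Config) {i j : Fin n} (h : j ≠ i) (a : V) (t : ℕ) :
    SameAt j (C.exec (solo i a t)) C :=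
  sameAt_exec C _ fun _ he => by rw [eq_of_mem_solo he]; exact h.symm

theorem sameAt_run {σ : ℕ → Fin n × V} {i : Fin n} {T t : ℕ} (hT : T ≤ t)
    (h : ∀ u, T ≤ u → u < t → (σ u).1 ≠ i) : SameAt i (P.run σ t) (P.run σ T) := by
  induction t, hT using Nat.le_induction with
  | base => exact SameAt.refl _ _
  | succ t ht ih =>
    exact (sameAt_step _ _ (h t ht t.lt_succ_self).symm).trans
      (ih fun u hu hlt => h u hu (hlt.trans t.lt_succ_self))

theorem sn_le_step (C : P.Config) (e : Fin n × V) (i : Fin n) : C.sn i ≤ (C.step e).sn i := by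
  by_cases hi : i = e.1
  · subst hi
    rcases h : C.loc e.1 with s | b
    · simp [sn_step_of_isLeft (e := e) (C := C) (by simp [h])]
    · simp [sn_step_of_isRight (e := e) (C := C) (by simp [h])]
  · exact (sameAt_step C e hi).sn.ge

theorem sn_le_exec (C : P.Config) (L : List (Fin n × V)) (i : Fin n) :
    C.sn i ≤ (C.exec L).sn i := by
  induction L generalizing C with
  | nil => exact le_rfl
  | cons e L ih => exact (sn_le_step C e i).trans (ih _)

/-- The processes of `S` cannot tell the global states `C` and `D` apart. -/
structure Indistinguishable (S : Set (Fin n)) (C D : P.Config) : Prop where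
  mem : C.mem = D.mem
  sameAt : ∀ i ∈ S, SameAt i C D

theorem Indistinguishable.step {S : Set (Fin n)} {C D : P.Config} (h : Indistinguishable S C D)
    {e : Fin n × V} (he : e.1 ∈ S) : Indistinguishable S (C.step e) (D.step e) := by
  have hs := h.sameAt e.1 he
  suffices H : (C.step e).mem = (D.step e).mem ∧ SameAt e.1 (C.step e) (D.step e) by
    refine ⟨H.1, fun i hi => ?_⟩
    by_cases hie : i = e.1
    · exact hie ▸ H.2
    · exact (sameAt_step C e hie).trans ((h.sameAt i hi).trans (sameAt_step D e hie).symm)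
  have hmem := h.mem
  obtain ⟨hloc, hsn, hprop, hdec⟩ := id hs
  cases hD : D.loc e.1 with
  | inl s =>
    rw [step_of_idle (hloc.trans hD), step_of_idle hD, ← hsn]
    refine ⟨by simpa [invoke], SameAt.settle ?_ _⟩
    constructor <;> simp [invoke, hloc, hsn, hprop, hdec]
  | inr b =>
    cases ha : (P.code e.1).access b with
    | read x next =>
      rw [step_of_read (hloc.trans hD) ha, step_of_read hD ha, hmem]
      exact ⟨by simpa, hs.settle _⟩
    | snapshot next =>
      rw [step_of_snapshot (hloc.trans hD) ha, step_of_snapshot hD ha, hmem]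
      exact ⟨by simpa, hs.settle _⟩
    | write x r next =>
      rw [step_of_write (hloc.trans hD) ha, step_of_write hD ha, hmem]
      refine ⟨by simp, SameAt.settle ?_ _⟩
      exact ⟨hloc, hsn, hprop, hdec⟩

theorem Indistinguishable.exec {S : Set (Fin n)} {C D : P.Config} (h : Indistinguishable S C D)
    {L : List (Fin n × V)} (hL : ∀ e ∈ L, e.1 ∈ S) :
    Indistinguishable S (C.exec L) (D.exec L) := by
  induction L generalizing C D with
  | nil => exact h
  | cons e L ih =>
    rw [List.forall_mem_cons] at hL
    exact ih (h.step hL.1) hL.2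

theorem exec_settle_comm (C : P.Config) (i : Fin n)
    (o : Outcome V (P.code i).Idle (P.code i).Busy) {L : List (Fin n × V)}
    (hL : ∀ e ∈ L, e.1 ≠ i) : (C.settle i o).exec L = (C.exec L).settle i o := by
  have hother : Indistinguishable {j | j ≠ i} ((C.settle i o).exec L) (C.exec L) :=
    Indistinguishable.exec ⟨mem_settle C i o, fun _ hj => sameAt_settle C hj o⟩ hL
  refine Config.ext_of_sameAt (by rw [hother.mem, mem_settle]) fun j => ?_
  by_cases hj : j = i
  · subst hj
    exact (sameAt_exec _ L hL).trans ((sameAt_exec C L hL).symm.settle o)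
  · exact (hother.sameAt j hj).trans (sameAt_settle _ hj o).symm

/-- The instances that process `i` has started and finished are determined by its number of
invocations and by whether it is executing an operation. -/
structure History (C : P.Config) (i : Fin n) : Prop where
  prop_iff : ∀ s, C.prop i s ≠ none ↔ 1 ≤ s ∧ s ≤ C.sn i
  dec_iff : ∀ s, C.dec i s ≠ none ↔ 1 ≤ s ∧ (s < C.sn i ∨ s = C.sn i ∧ (C.loc i).isLeft)
  pos : (C.loc i).isRight → 1 ≤ C.sn i

theorem History.of_sameAt {C D : P.Config} {i : Fin n} (hD : History D i) (h : SameAt i C D) :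
    History C i := by
  constructor
  · rw [h.sn, h.prop]; exact hD.prop_iff
  · rw [h.loc, h.sn, h.dec]; exact hD.dec_iff
  · rw [h.loc, h.sn]; exact hD.pos

theorem History.settle {C : P.Config} {i : Fin n}
    (hprop : ∀ s, C.prop i s ≠ none ↔ 1 ≤ s ∧ s ≤ C.sn i)
    (hdec : ∀ s, C.dec i s ≠ none ↔ 1 ≤ s ∧ s < C.sn i) (hpos : 1 ≤ C.sn i)
    (o : Outcome V (P.code i).Idle (P.code i).Busy) : History (C.settle i o) i := by
  refine ⟨by simpa using hprop, fun s => ?_, by simpa using fun _ => hpos⟩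
  by_cases hs : s = C.sn i
  · subst hs
    cases o <;> simp [Config.settle, hpos, hdec]
  · rw [dec_settle_of_ne C i o hs, hdec, sn_settle]
    simp [hs]

theorem History.step {C : P.Config} {i : Fin n} (h : History C i) (e : Fin n × V) :
    History (C.step e) i := by
  by_cases hi : i = e.1
  swap
  · exact h.of_sameAt (sameAt_step C e hi)
  subst hi
  rcases step_eq_settle C e with ⟨l, o, hl, heq⟩ | ⟨b, mem, o, hb, heq⟩ <;> rw [heq]
  · refine History.settle (fun s => ?_) (fun s => ?_) (by simp [invoke]) o
    · by_cases hs : s = C.sn e.1 + 1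
      · simp [invoke, hs]
      · simp only [invoke, Function.update_self, Function.update_of_ne hs, h.prop_iff]
        omega
    · simp only [invoke, Function.update_self, h.dec_iff, hl, Sum.isLeft_inl, and_true]
      omega
  · exact History.settle (C := { C with mem := mem }) h.prop_iff (by simp [h.dec_iff, hb])
      (h.pos (by simp [hb])) o

theorem Reachable.history {C : P.Config} (h : Reachable C) (i : Fin n) : History C i := by
  refine Reachable.induction (p := (History · i)) ⟨fun s => ?_, fun s => ?_, fun h => ?_⟩
    (fun _ e _ hC => hC.step e) h
  · simp only [first, ne_eq, not_true_eq_false, false_iff]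
    omega
  · simp only [first, ne_eq, not_true_eq_false, false_iff]
    omega
  · simp [first] at h

theorem step_prop_of_some {C : P.Config} (hC : Reachable C) (e : Fin n × V) {i : Fin n} {s : ℕ}
    {a : V} (h : C.prop i s = some a) : (C.step e).prop i s = some a := by
  by_cases hi : i = e.1
  swap
  · rw [(sameAt_step C e hi).prop, h]
  subst hi
  have hs := ((hC.history e.1).prop_iff s).1 (by simp [h])
  rcases step_eq_settle C e with ⟨l, o, -, heq⟩ | ⟨b, mem, o, -, heq⟩ <;> rw [heq, prop_settle]
  · simp [invoke, show s ≠ C.sn e.1 + 1 by omega, h]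
  · exact h

theorem step_dec_of_some {C : P.Config} (hC : Reachable C) (e : Fin n × V) {i : Fin n} {s : ℕ}
    {a : V} (h : C.dec i s = some a) : (C.step e).dec i s = some a := by
  by_cases hi : i = e.1
  swap
  · rw [(sameAt_step C e hi).dec, h]
  subst hi
  have hs := ((hC.history e.1).dec_iff s).1 (by simp [h])
  rcases step_eq_settle C e with ⟨l, o, -, heq⟩ | ⟨b, mem, o, hb, heq⟩ <;> rw [heq]
  · rw [dec_settle_of_ne _ _ _ (by simp only [invoke, Function.update_self]; omega)]
    exact h
  · simp only [hb, Sum.isLeft_inr, Bool.false_eq_true, and_false, or_false] at hs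
    rw [dec_settle_of_ne _ _ _ (by dsimp only; omega)]
    exact h

theorem exec_dec_of_some {C : P.Config} (hC : Reachable C) (L : List (Fin n × V)) {i : Fin n}
    {s : ℕ} {a : V} (h : C.dec i s = some a) : (C.exec L).dec i s = some a := by
  induction L generalizing C with
  | nil => exact h
  | cons e _ ih => exact ih (hC.step e) (step_dec_of_some hC e h)

theorem run_prop_of_some {σ : ℕ → Fin n × V} {t t' : ℕ} (htt : t ≤ t') {i : Fin n} {s : ℕ} {a : V}
    (h : (P.run σ t).prop i s = some a) : (P.run σ t').prop i s = some a := by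
  induction t', htt using Nat.le_induction with
  | base => exact h
  | succ t _ ih => exact step_prop_of_some (reachable_run σ t) _ ih

theorem run_dec_of_some {σ : ℕ → Fin n × V} {t t' : ℕ} (htt : t ≤ t') {i : Fin n} {s : ℕ} {a : V}
    (h : (P.run σ t).dec i s = some a) : (P.run σ t').dec i s = some a := by
  obtain ⟨d, rfl⟩ := Nat.exists_eq_add_of_le htt
  rw [run_add]
  exact exec_dec_of_some (reachable_run σ t) _ h

theorem stuck_of_forall_dec_eq_none {σ : ℕ → Fin n × V} {i : Fin n} {s t : ℕ}
    (hs : (P.run σ t).prop i s ≠ none) (hd : ∀ t, (P.run σ t).dec i s = none) {t' : ℕ}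
    (ht : t ≤ t') : (P.run σ t').sn i = s ∧ ((P.run σ t').loc i).isRight := by
  obtain ⟨a, ha⟩ := Option.ne_none_iff_exists'.1 hs
  have history := (reachable_run (P := P) σ t').history i
  have started := (history.prop_iff s).1 (by simp [run_prop_of_some ht ha])
  have undecided := mt (history.dec_iff s).2 (not_not.2 (hd t'))
  rw [← Sum.not_isLeft]
  grind

theorem sn_exec_solo_of_isRight {C : P.Config} {i : Fin n} {a : V}
    (h : ∀ t, ((C.exec (solo i a t)).loc i).isRight) (t : ℕ) :
    (C.exec (solo i a t)).sn i = C.sn i := by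
  induction t with
  | zero => rfl
  | succ t ih => rw [exec_solo_succ, sn_step_of_isRight (h t), ih]

theorem run_add_eq_exec_solo {σ : ℕ → Fin n × V} {i : Fin n} {T : ℕ}
    (hσ : ∀ t, T ≤ t → (σ t).1 = i) (hbusy : ∀ t, T ≤ t → ((P.run σ t).loc i).isRight) (a : V)
    (t : ℕ) : P.run σ (T + t) = (P.run σ T).exec (solo i a t) := by
  induction t with
  | zero => rfl
  | succ t ih =>
    have hT : T ≤ T + t := T.le_add_right t
    rw [exec_solo_succ, ← ih]
    change (P.run σ (T + t)).step (σ (T + t)) = _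
    rw [← Prod.mk.eta (p := σ (T + t)), hσ _ hT]
    exact step_congr_of_isRight (hbusy _ hT) _ _

theorem obTermination_iff_exists_idle : P.OBTermination ↔
    ∀ C : P.Config, Reachable C → ∀ i a, ∃ t, ((C.exec (solo i a t)).loc i).isLeft := by
  constructor
  · intro hP C hC i a
    by_contra! hbusy
    simp only [ne_eq, Sum.not_isLeft] at hbusy
    have sn_eq := sn_exec_solo_of_isRight hbusy
    have hpos : 1 ≤ C.sn i := (hC.history i).pos (hbusy 0)
    obtain ⟨L, rfl⟩ := id hC
    obtain ⟨t, ht⟩ := hP (listSchedule L (i, a)) i L.length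
      (fun j hj => by simp [listSchedule, hj]) (L.length + 0) ((P.first.exec L).sn i)
      (by rw [run_listSchedule]; exact ((hC.history i).prop_iff _).2 ⟨hpos, le_rfl⟩)
    obtain ⟨b, hb⟩ := Option.ne_none_iff_exists'.1 ht
    have decided := run_dec_of_some (Nat.le_add_left t L.length) hb
    rw [run_listSchedule] at decided
    have hidle := (((hC.exec (solo i a t)).history i).dec_iff ((P.first.exec L).sn i)).1
      (by simp [decided])
    simp [sn_eq, ← Sum.not_isRight, hbusy t] at hidle
  · intro h σ i T hσ t s hs
    by_contra! hnone
    have hbusy : ∀ t', max T t ≤ t' → ((P.run σ t').loc i).isRight := fun t' ht' =>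
      (stuck_of_forall_dec_eq_none hs hnone ((le_max_right T t).trans ht')).2
    obtain ⟨d, hd⟩ := h _ (reachable_run σ (max T t)) i (σ 0).2
    rw [← run_add_eq_exec_solo (fun t' ht' => hσ t' ((le_max_left T t).trans ht')) hbusy,
      ← Sum.not_isRight] at hd
    exact hd (hbusy _ (Nat.le_add_right _ _))

theorem exists_decided_by_time {σ : ℕ → Fin n × V} {s : ℕ} {T : Set V} (hfin : T.Finite)
    (hT : ∀ a ∈ T, ∃ t i, (P.run σ t).dec i s = some a) :
    ∃ t, ∀ a ∈ T, ∃ i, (P.run σ t).dec i s = some a := by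
  choose! time hdec using hT
  obtain ⟨t, ht⟩ := (hfin.image time).bddAbove
  exact ⟨t, fun a ha => (hdec a ha).imp fun _ =>
    run_dec_of_some (ht (Set.mem_image_of_mem time ha))⟩

theorem agreement_of_reachable {k : ℕ}
    (h : ∀ C : P.Config, Reachable C → ∀ s, {a | ∃ i, C.dec i s = some a}.encard ≤ k) :
    P.Agreement k := by
  intro σ s
  by_contra hlt
  obtain ⟨T, hT, hcard⟩ := Set.exists_subset_encard_eq (Order.add_one_le_of_lt (not_le.1 hlt))
  obtain ⟨t, ht⟩ := exists_decided_by_time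
    (Set.finite_of_encard_eq_coe (k := k + 1) (by exact_mod_cast hcard)) hT
  have hle : (k : ℕ∞) + 1 ≤ k :=
    hcard ▸ (Set.encard_le_encard ht).trans (h _ (reachable_run σ t) s)
  exact absurd (by exact_mod_cast hle) (Nat.not_succ_le_self k)

end Protocol

/-! ### The lower bound -/

namespace Protocol

variable {V : Type u} {n m : ℕ} {P : Protocol.{u, v, w} V n m}

open Config

/-- Process `i` is about to write into register `x`. -/
def Poised (C : P.Config) (i : Fin n) (x : Fin m) : Prop :=
  ∃ b r next, C.loc i = Sum.inr b ∧ (P.code i).access b = .write x r next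

theorem Poised.unique {C : P.Config} {i : Fin n} {x y : Fin m} (hx : Poised C i x)
    (hy : Poised C i y) : x = y := by
  obtain ⟨b, r, next, hb, ha⟩ := hx
  obtain ⟨b', r', next', hb', ha'⟩ := hy
  obtain rfl := Sum.inr_injective (hb.symm.trans hb')
  rw [ha] at ha'
  injection ha'

theorem Poised.of_sameAt {C D : P.Config} {i : Fin n} {x : Fin m} (hD : Poised D i x)
    (h : SameAt i C D) : Poised C i x := by
  obtain ⟨b, r, next, hb, ha⟩ := hD
  exact ⟨b, r, next, h.loc.trans hb, ha⟩

theorem Poised.exec_solo {C : P.Config} {i q : Fin n} {x : Fin m} (h : Poised C i x)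
    (hi : i ≠ q) (a : V) (t : ℕ) : Poised (C.exec (solo q a t)) i x :=
  h.of_sameAt (sameAt_exec_solo C hi a t)

theorem mem_step_of_not_poised {C : P.Config} {e : Fin n × V} {x : Fin m}
    (h : ¬ Poised C e.1 x) : (C.step e).mem x = C.mem x := by
  cases hloc : C.loc e.1 with
  | inl s => rw [step_of_idle hloc, mem_settle]; rfl
  | inr b =>
    cases ha : (P.code e.1).access b with
    | read y next => rw [step_of_read hloc ha, mem_settle]
    | snapshot next => rw [step_of_snapshot hloc ha, mem_settle]
    | write y r next =>
      have hxy : x ≠ y := fun hxy => h ⟨b, r, next, hloc, hxy ▸ ha⟩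
      rw [step_of_write hloc ha, mem_settle]
      exact Function.update_of_ne hxy _ _

theorem mem_exec_solo {C : P.Config} {q : Fin n} {a : V} {A : Finset (Fin m)}
    (hA : ∀ t x, Poised (C.exec (solo q a t)) q x → x ∈ A) (t : ℕ) {x : Fin m} (hx : x ∉ A) :
    (C.exec (solo q a t)).mem x = C.mem x := by
  induction t with
  | zero => rfl
  | succ t ih => rw [exec_solo_succ, mem_step_of_not_poised fun h => hx (hA t x h), ih]

theorem Poised.step {C D : P.Config} {e : Fin n × V} {x : Fin m} (h : Poised C e.1 x)
    (hs : SameAt e.1 C D) : SameAt e.1 (C.step e) (D.step e) ∧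
      ∀ y, C.mem y = D.mem y ∨ y = x → (C.step e).mem y = (D.step e).mem y := by
  obtain ⟨b, r, next, hb, ha⟩ := h
  rw [step_of_write hb ha, step_of_write (hs.loc.symm.trans hb) ha]
  refine ⟨SameAt.settle ?_ next, fun y hy => ?_⟩
  · exact ⟨hs.loc, hs.sn, hs.prop, hs.dec⟩
  · rw [mem_settle, mem_settle]
    by_cases hyx : y = x
    · simp [hyx]
    · simpa [hyx] using hy

/-- The processes of `Q` are activated one after another. This is a block write if all of them
are poised. -/
def blockWrite (Q : List (Fin n)) (a : V) : List (Fin n × V) := Q.map (·, a)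

theorem indistinguishable_blockWrite {S : Set (Fin n)} (a : V) {Q : List (Fin n)} (hQ : Q.Nodup)
    (hQS : ∀ i ∈ Q, i ∈ S) {C D : P.Config} (hs : ∀ i ∈ S, SameAt i C D)
    (hp : ∀ i ∈ Q, ∃ x, Poised C i x) (hm : ∀ x, C.mem x = D.mem x ∨ ∃ i ∈ Q, Poised C i x) :
    Indistinguishable S (C.exec (blockWrite Q a)) (D.exec (blockWrite Q a)) := by
  induction Q generalizing C D with
  | nil => exact ⟨funext fun x => by simpa [blockWrite] using hm x, hs⟩
  | cons q Q ih =>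
    rw [List.nodup_cons] at hQ
    rw [List.forall_mem_cons] at hQS hp
    obtain ⟨x, hx⟩ := hp.1
    obtain ⟨same_q, same_mem⟩ := Poised.step (e := (q, a)) hx (hs q hQS.1)
    have same_step : ∀ E : P.Config, ∀ i, i ≠ q → SameAt i (E.step (q, a)) E :=
      fun E _ hi => sameAt_step E (q, a) hi
    refine ih hQ.2 hQS.2 (fun i hi => ?_) (fun i hi => ?_) fun y => ?_
    · by_cases hiq : i = q
      · exact hiq ▸ same_q
      · exact (same_step C i hiq).trans ((hs i hi).trans (same_step D i hiq).symm)
    · obtain ⟨z, hz⟩ := hp.2 i hi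
      exact ⟨z, hz.of_sameAt (same_step C i fun hiq => hQ.1 (hiq ▸ hi))⟩
    · rcases hm y with hy | ⟨i, hi, hy⟩
      · exact .inl (same_mem y (.inl hy))
      · by_cases hiq : i = q
        · subst hiq
          exact .inl (same_mem y (.inr (hy.unique hx)))
        · exact .inr ⟨i, (List.mem_cons.1 hi).resolve_left hiq, hy.of_sameAt (same_step C i hiq)⟩

/-- Each process of `Q` is about to write into a register, and each register of `A` is about to be
written by a process of `Q`. -/
structure Covers (C : P.Config) (Q : Finset (Fin n)) (A : Finset (Fin m)) : Prop where
  poised : ∀ i ∈ Q, ∃ x, Poised C i x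
  covered : ∀ x ∈ A, ∃ i ∈ Q, Poised C i x

theorem Covers.insert_exec_solo {C : P.Config} {Q : Finset (Fin n)} {A : Finset (Fin m)}
    (h : Covers C Q A) {q : Fin n} (hq : q ∉ Q) {a : V} {t : ℕ} {x : Fin m}
    (hx : Poised (C.exec (solo q a t)) q x) :
    Covers (C.exec (solo q a t)) (insert q Q) (insert x A) := by
  have hne : ∀ i ∈ Q, i ≠ q := fun i hi hiq => hq (hiq ▸ hi)
  constructor
  · rw [Finset.forall_mem_insert]
    exact ⟨⟨x, hx⟩, fun i hi => (h.poised i hi).imp fun _ hy => hy.exec_solo (hne i hi) a t⟩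
  · rw [Finset.forall_mem_insert]
    refine ⟨⟨q, Finset.mem_insert_self q Q, hx⟩, fun y hy => ?_⟩
    obtain ⟨i, hi, hiy⟩ := h.covered y hy
    exact ⟨i, Finset.mem_insert_of_mem hi, hiy.exec_solo (hne i hi) a t⟩

/-- As long as some process outside of `Q` can be made to cover a further register by running it
solo, the covered set can be enlarged. -/
theorem exists_covers (a : V) {S Q : Finset (Fin n)} {A : Finset (Fin m)} (hS : m < S.card)
    (C : P.Config) (hQS : Q ⊆ S) (hcard : Q.card ≤ A.card) (hC : Covers C Q A) :
    ∃ (L : List (Fin n × V)) (Q : Finset (Fin n)) (A : Finset (Fin m)) (q : Fin n),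
      (∀ e ∈ L, e.1 ∈ S) ∧ Q ⊆ S ∧ Covers (C.exec L) Q A ∧ q ∈ S ∧ q ∉ Q ∧
        ∀ t x, Poised ((C.exec L).exec (solo q a t)) q x → x ∈ A := by
  induction hd : m - A.card using Nat.strong_induction_on generalizing C Q A with
  | _ d ih =>
    have hA : A.card ≤ m := by simpa using A.card_le_univ
    obtain ⟨q, hqS, hqQ⟩ : ∃ q ∈ S, q ∉ Q := Finset.exists_mem_notMem_of_card_lt_card (by omega)
    by_cases hout : ∀ t x, Poised (C.exec (solo q a t)) q x → x ∈ A
    · exact ⟨[], Q, A, q, by simp, hQS, hC, hqS, hqQ, hout⟩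
    push Not at hout
    obtain ⟨t, x, hx, hxA⟩ := hout
    have card_A := Finset.card_insert_of_notMem hxA
    have card_Q := Finset.card_insert_of_notMem hqQ
    have card_le : (insert x A).card ≤ m := by simpa using (insert x A).card_le_univ
    obtain ⟨L, Q', A', q', hL, hrest⟩ := ih _ (by omega) (C.exec (solo q a t))
      (Finset.insert_subset hqS hQS) (by omega) (hC.insert_exec_solo hqQ hx) rfl
    refine ⟨solo q a t ++ L, Q', A', q', fun e he => ?_, by rwa [exec_append]⟩
    rcases List.mem_append.1 he with he | he
    · exact eq_of_mem_solo he ▸ hqS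
    · exact hL e he

/-- The block write erases all traces of the solo run. -/
theorem Covers.indistinguishable {C : P.Config} {Q : Finset (Fin n)} {A : Finset (Fin m)}
    (hC : Covers C Q A) {q : Fin n} (hq : q ∉ Q) {a : V}
    (hA : ∀ t x, Poised (C.exec (solo q a t)) q x → x ∈ A) (t : ℕ) :
    Indistinguishable {i | i ≠ q} (C.exec (blockWrite Q.toList a))
      ((C.exec (solo q a t)).exec (blockWrite Q.toList a)) := by
  refine indistinguishable_blockWrite a Q.nodup_toList
    (fun i hi (hiq : i = q) => hq (hiq ▸ Finset.mem_toList.1 hi))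
    (fun i (hi : i ≠ q) => (sameAt_exec_solo C hi a t).symm)
    (fun i hi => hC.poised i (Finset.mem_toList.1 hi)) fun x => ?_
  by_cases hx : x ∈ A
  · exact .inr (by simpa using hC.covered x hx)
  · exact .inl (mem_exec_solo hA t hx).symm

theorem prop_exec_solo {C : P.Config} {q : Fin n} {a : V} {s : ℕ} (hs : C.prop q s = none)
    (t : ℕ) {b : V} (hb : (C.exec (solo q a t)).prop q s = some b) : b = a := by
  induction t with
  | zero => simp [solo, hs] at hb
  | succ t ih =>
    rw [exec_solo_succ] at hb
    rcases step_eq_settle (C.exec (solo q a t)) (q, a) with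
      ⟨l, o, -, heq⟩ | ⟨b, mem, o, -, heq⟩ <;> rw [heq, prop_settle] at hb
    · by_cases h : s = (C.exec (solo q a t)).sn q + 1
      · simpa [invoke, h, eq_comm] using hb
      · exact ih (by simpa [invoke, h] using hb)
    · exact ih hb

theorem exists_le_sn_exec_solo (hP : P.OBTermination) {C : P.Config} (hC : Reachable C)
    (q : Fin n) (a : V) (s : ℕ) : ∃ t, s ≤ (C.exec (solo q a t)).sn q := by
  induction s with
  | zero => exact ⟨0, Nat.zero_le _⟩
  | succ s ih =>
    obtain ⟨t, ht⟩ := ih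
    obtain ⟨d, hd⟩ := obTermination_iff_exists_idle.1 hP _ (hC.exec (solo q a t)) q a
    have hsn := sn_step_of_isLeft (e := (q, a)) hd
    have hle := sn_le_exec (C.exec (solo q a t)) (solo q a d) q
    refine ⟨t + d + 1, ?_⟩
    rw [exec_solo_succ, exec_solo_add]
    dsimp only at hsn
    omega

theorem exists_decides_own_value (hval : P.Validity) (hob : P.OBTermination) {C : P.Config}
    (hC : Reachable C) {s : ℕ} (hs : ∀ i, C.sn i < s) (q : Fin n) (a : V) :
    ∃ t, (C.exec (solo q a t)).dec q s = some a := by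
  obtain ⟨t, ht⟩ := exists_le_sn_exec_solo hob hC q a (s + 1)
  have reachable := hC.exec (solo q a t)
  obtain ⟨b, hb⟩ := Option.ne_none_iff_exists'.1
    (((reachable.history q).dec_iff s).2 ⟨by have := hs q; omega, by omega⟩)
  have not_proposed : ∀ i, C.prop i s = none := fun i => by
    by_contra h
    exact absurd (((hC.history i).prop_iff s).1 h).2 (not_le.2 (hs i))
  obtain ⟨σ, T, hσ⟩ := reachable.exists_run q a
  obtain ⟨j, hj⟩ := hval σ T q s b (by rw [hσ, hb])
  rw [hσ] at hj
  by_cases hjq : j = q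
  · subst hjq
    exact ⟨t, by rw [hb, prop_exec_solo (not_proposed j) t hj]⟩
  · simp [(sameAt_exec_solo C hjq a t).prop, not_proposed] at hj

/-- A process decides its own value in a solo run that the others cannot notice, because it writes
only into registers which are overwritten before anyone else reads them; the remaining values are
then decided by the other processes. -/
theorem exists_all_decided (hval : P.Validity) (hob : P.OBTermination) {T : Finset V}
    (hT : T.Nonempty) (S : Finset (Fin n)) (hmS : m + T.card ≤ S.card + 1)
    (hTS : T.card ≤ S.card) {C : P.Config} (hC : Reachable C) :
    ∃ N, ∀ s, N ≤ s → ∃ L : List (Fin n × V),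
      (∀ e ∈ L, e.1 ∈ S) ∧ ∀ a ∈ T, ∃ i ∈ S, (C.exec L).dec i s = some a := by
  induction hT using Finset.Nonempty.cons_induction generalizing S C with
  | singleton a =>
    obtain ⟨q, hq⟩ : S.Nonempty := Finset.card_pos.1 (by simpa using hTS)
    refine ⟨Finset.univ.sup C.sn + 1, fun s hs => ?_⟩
    obtain ⟨t, ht⟩ := exists_decides_own_value hval hob hC
      (fun i => (Finset.le_sup (Finset.mem_univ i)).trans_lt hs) q a
    exact ⟨solo q a t, fun e he => eq_of_mem_solo he ▸ hq, by simpa using ⟨q, hq, ht⟩⟩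
  | cons a T _ hT ih =>
    rw [Finset.card_cons] at hmS hTS
    have := hT.card_pos
    obtain ⟨L₁, Q, A, q, hL₁, hQS, hcov, hqS, hqQ, hA⟩ :=
      exists_covers a (S := S) (Q := ∅) (A := ∅) (by omega) C (by simp) (by simp)
        ⟨by simp, by simp⟩
    have hC₁ := hC.exec L₁
    have card_erase := Finset.card_erase_of_mem hqS
    obtain ⟨N, hN⟩ := ih (S.erase q) (by omega) (by omega) (hC₁.exec (blockWrite Q.toList a))
    refine ⟨max N (Finset.univ.sup (C.exec L₁).sn + 1), fun s hs => ?_⟩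
    rw [max_le_iff] at hs
    obtain ⟨t, ht⟩ := exists_decides_own_value hval hob hC₁
      (fun i => (Finset.le_sup (Finset.mem_univ i)).trans_lt hs.2) q a
    obtain ⟨L₂, hL₂, hdec⟩ := hN s hs.1
    have hsame := (hcov.indistinguishable hqQ hA t).exec fun e he =>
      (Finset.mem_erase.1 (hL₂ e he)).1
    refine ⟨L₁ ++ (solo q a t ++ (blockWrite Q.toList a ++ L₂)), ?_, ?_⟩
    · simp only [List.forall_mem_append]
      refine ⟨hL₁, fun e he => eq_of_mem_solo he ▸ hqS, fun e he => ?_,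
        fun e he => Finset.mem_of_mem_erase (hL₂ e he)⟩
      obtain ⟨i, hi, rfl⟩ := List.mem_map.1 he
      exact hQS (Finset.mem_toList.1 hi)
    · simp only [exec_append, Finset.forall_mem_cons]
      refine ⟨⟨q, hqS, exec_dec_of_some ((hC₁.exec _).exec _) _
        (exec_dec_of_some (hC₁.exec _) _ ht)⟩, fun b hb => ?_⟩
      obtain ⟨i, hi, hib⟩ := hdec b hb
      rw [Finset.mem_erase] at hi
      exact ⟨i, hi.2, by rw [← (hsame.sameAt i hi.1).dec, hib]⟩

theorem SolvesRepeatedSetAgreement.register_lower_bound {k : ℕ} (hkn : k < n)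
    (hV : (k : ℕ∞) < ENat.card V) (hP : P.SolvesRepeatedSetAgreement k) : n - k + 1 ≤ m := by
  by_contra hm
  obtain ⟨hval, hagr, hob⟩ := hP
  obtain ⟨T, -, hT⟩ := Set.exists_subset_encard_eq (s := (Set.univ : Set V)) (k := (k + 1 : ℕ))
    (by rw [Set.encard_univ]; exact_mod_cast Order.add_one_le_of_lt hV)
  lift T to Finset V using Set.finite_of_encard_eq_coe hT
  have card_T : T.card = k + 1 := by simpa [← Nat.cast_inj (R := ℕ∞)] using hT
  obtain ⟨a, ha⟩ : T.Nonempty := Finset.card_pos.1 (by omega)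
  obtain ⟨N, hN⟩ := exists_all_decided hval hob ⟨a, ha⟩ Finset.univ (by simp; omega)
    (by simp; omega) reachable_first
  obtain ⟨L, -, hL⟩ := hN N le_rfl
  obtain ⟨σ, t, hσ⟩ := (reachable_first.exec L).exists_run ⟨0, by omega⟩ a
  have hsub : (T : Set V) ⊆ {b | ∃ t i, (P.run σ t).dec i N = some b} := fun b hb => by
    obtain ⟨i, -, hi⟩ := hL b hb
    exact ⟨t, i, by rw [hσ, hi]⟩
  have hle : ((k + 1 : ℕ) : ℕ∞) ≤ k := hT ▸ (Set.encard_le_encard hsub).trans (hagr σ N)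
  exact Nat.not_succ_le_self k (by exact_mod_cast hle)

end Protocol

/-! ### Safety of a single instance -/

/-- What matters for the decisions in one instance: the registers, the sixuplets that the processes
are about to write, and the decisions in this instance. -/
structure Situation (V : Type u) (n d : ℕ) where
  mem : Fin (d + 1) → Sixuplet V
  pend : Fin n → Option (Sixuplet V)
  dec : Fin n → Option V

namespace Situation

variable {V : Type u} {n d : ℕ} {s r ρ : ℕ} {y : WithBot V} {up cfl : Bool}
  {mem : Fin (d + 1) → Sixuplet V} {C C' : Situation V n d}
  {X Z : Sixuplet V} {Q G : Sixuplet V → Prop} {i : Fin n} {x : Fin (d + 1)} {a : V}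

/-- Process `i` decides `a`. -/
@[simps]
def decide (C : Situation V n d) (i : Fin n) (a : V) : Situation V n d :=
  { C with dec := Function.update C.dec i (some a) }

/-- Process `i` gets ready to write `X`. -/
@[simps]
def announce (C : Situation V n d) (i : Fin n) (X : Sixuplet V) : Situation V n d :=
  { C with pend := Function.update C.pend i (some X) }

/-- Process `i` writes `X` into register `x`. -/
@[simps]
def write (C : Situation V n d) (i : Fin n) (x : Fin (d + 1)) (X : Sixuplet V) :
    Situation V n d :=
  { C with mem := Function.update C.mem x X, pend := Function.update C.pend i none }

/-- All registers agree on their first five fields, which are those listed. -/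
def Unanimous (mem : Fin (d + 1) → Sixuplet V) (s r : ℕ) (up cfl : Bool) (y : WithBot V) : Prop :=
  ∀ x, (mem x).sn = s ∧ (mem x).rd = r ∧ (mem x).up = up ∧ (mem x).cfl = cfl ∧ (mem x).val = y

/-- How `sup` treats an entry `Z` from the same round as its result `X`: level and conflict flag are
not lost, and a different value raises the conflict flag. -/
def Absorbs (X Z : Sixuplet V) : Prop :=
  (Z.up = true → X.up = true) ∧ (Z.cfl = true → X.cfl = true) ∧ (Z.val ≠ X.val → X.cfl = true)

/-- What instance `s` can see of a sixuplet `X` that a process, in whatever instance, decides to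
write after a snapshot that has returned `mem`. -/
inductive Fresh (s : ℕ) (mem : Fin (d + 1) → Sixuplet V) (X : Sixuplet V) : Prop
  | later (lt_sn : s < X.sn)
  | earlier (sn_lt : X.sn < s) (mem_sn_lt : ∀ x, (mem x).sn < s)
  | raise (r : ℕ) (up cfl : Bool) (y : WithBot V) (one_le : 1 ≤ r)
      (unanimous : Unanimous mem s r up cfl y) (not_up : cfl = false → up = false)
      (sn_eq : X.sn = s) (rd_eq : X.rd = r + 1) (up_eq : X.up = !cfl) (val_eq : X.val = y)
  | adopt (sn_eq : X.sn = s)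
      (bound : ∀ x, (mem x).sn < s ∨
        (mem x).sn = s ∧ ((mem x).rd < X.rd ∨ (mem x).rd = X.rd ∧ Absorbs X (mem x)))
      (source : X.rd = 1 ∧ X.up = false ∨ ∃ x, (mem x).sn = s ∧ (mem x).rd = X.rd ∧
        (mem x).up = X.up ∧ (mem x).val = X.val)

/-- One event, from the point of view of instance `s`. -/
inductive Move (s : ℕ) (C : Situation V n d) : Situation V n d → Prop
  | idle : Move s C C
  | decide (i : Fin n) (a : V) (r : ℕ) (one_le : 1 ≤ r) (pend : C.pend i = none)
      (unanimous : Unanimous C.mem s r true false a) : Move s C (C.decide i a)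
  | copy (i j : Fin n) (a : V) (pend : C.pend i = none) (dec : C.dec j = some a) :
      Move s C (C.decide i a)
  | announce (i : Fin n) (X : Sixuplet V) (fresh : Fresh s C.mem X)
      (left : C.dec i ≠ none → s < X.sn) : Move s C (C.announce i X)
  | write (i : Fin n) (x : Fin (d + 1)) (X : Sixuplet V) (pend : C.pend i = some X) :
      Move s C (C.write i x X)

/-- The sixuplet is past round `r` of instance `s`, or it is in this round and satisfies `Q`. -/
def Reaches (s r : ℕ) (Q : Sixuplet V → Prop) (Z : Sixuplet V) : Prop :=
  s < Z.sn ∨ Z.sn = s ∧ (r < Z.rd ∨ Z.rd = r ∧ Q Z)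

/-- The sixuplet has reached round `r` of instance `s`. -/
def AtLeast (s r : ℕ) : Sixuplet V → Prop :=
  Reaches s r fun _ => True

/-- The sixuplet has reached level "up" of round `r` of instance `s`. -/
def Ahead (s r : ℕ) : Sixuplet V → Prop :=
  Reaches s r fun Z => Z.up = true

/-- The sixuplet is past round `r` of instance `s`, or in this round it does not allow the
promotion of a value other than `y`. -/
def Tied (s r : ℕ) (y : WithBot V) : Sixuplet V → Prop :=
  Reaches s r fun Z => Z.cfl = true ∨ Z.val = y

/-- The sixuplet is past round `r` of instance `s`, or in this round it does not allow a decision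
for `y`. -/
def Against (s r : ℕ) (y : WithBot V) : Sixuplet V → Prop :=
  Reaches s r fun Z => Z.cfl = true ∨ Z.val ≠ y

theorem Unanimous.reaches_iff (h : Unanimous mem s ρ up cfl y) :
    Reaches s r Q (mem x) ↔ r < ρ ∨ ρ = r ∧ Q (mem x) := by
  obtain ⟨sn_eq, rd_eq, -⟩ := h x
  simp [Reaches, sn_eq, rd_eq]

theorem Unanimous.atLeast_iff (h : Unanimous mem s ρ up cfl y) : AtLeast s r (mem x) ↔ r ≤ ρ := by
  rw [AtLeast, h.reaches_iff]
  simp only [and_true]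
  omega

theorem Unanimous.ahead_iff (h : Unanimous mem s ρ up cfl y) :
    Ahead s r (mem x) ↔ r < ρ ∨ ρ = r ∧ up = true := by
  rw [Ahead, h.reaches_iff, (h x).2.2.1]

theorem Unanimous.tied_iff (h : Unanimous mem s ρ up cfl y) {z : WithBot V} :
    Tied s r z (mem x) ↔ r < ρ ∨ ρ = r ∧ (cfl = true ∨ y = z) := by
  rw [Tied, h.reaches_iff, (h x).2.2.2.1, (h x).2.2.2.2]

theorem Unanimous.against_iff (h : Unanimous mem s ρ up cfl y) {z : WithBot V} :
    Against s r z (mem x) ↔ r < ρ ∨ ρ = r ∧ (cfl = true ∨ y ≠ z) := by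
  rw [Against, h.reaches_iff, (h x).2.2.2.1, (h x).2.2.2.2]

/-- `G` passes from a single register to whatever is written after a snapshot. -/
def Inherited (s d : ℕ) (G : Sixuplet V → Prop) : Prop :=
  ∀ (mem : Fin (d + 1) → Sixuplet V) X, Fresh s mem X → (∃ x, G (mem x)) → G X

theorem inherited_reaches (hQ : ∀ X Z, Absorbs X Z → Q Z → Q X) :
    Inherited s d (Reaches s r Q) := by
  rintro mem X hX ⟨x, hx⟩
  cases hX with
  | later lt_sn => exact Or.inl lt_sn
  | earlier sn_lt mem_sn_lt =>
    have := mem_sn_lt x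
    unfold Reaches at hx
    omega
  | raise ρ up cfl y one_le unanimous not_up sn_eq rd_eq up_eq val_eq =>
    have := unanimous.reaches_iff.1 hx
    exact Or.inr ⟨sn_eq, Or.inl (by omega)⟩
  | adopt sn_eq bound source =>
    have := bound x
    have := hQ X (mem x)
    unfold Reaches at hx ⊢
    grind

theorem inherited_atLeast (s r : ℕ) : Inherited s d (AtLeast (V := V) s r) :=
  inherited_reaches fun _ _ _ h => h

theorem inherited_ahead (s r : ℕ) : Inherited s d (Ahead (V := V) s r) :=
  inherited_reaches fun _ _ h => h.1

theorem inherited_tied (s r : ℕ) (y : WithBot V) : Inherited s d (Tied s r y) :=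
  inherited_reaches fun X Z ⟨_, cfl_imp, ne_imp⟩ h => by
    by_cases hval : Z.val = X.val
    · exact h.imp cfl_imp hval.symm.trans
    · exact Or.inl (ne_imp hval)

theorem inherited_against (s r : ℕ) (y : WithBot V) : Inherited s d (Against s r y) :=
  inherited_reaches fun X Z ⟨_, cfl_imp, ne_imp⟩ h => by
    by_cases hval : Z.val = X.val
    · exact h.imp cfl_imp (hval ▸ ·)
    · exact Or.inl (ne_imp hval)

/-- The registers that do not satisfy `G`. -/
def badRegisters (G : Sixuplet V → Prop) (C : Situation V n d) : Set (Fin (d + 1)) :=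
  {x | ¬ G (C.mem x)}

/-- The processes that are about to write a sixuplet that does not satisfy `G`. -/
def badProcesses (G : Sixuplet V → Prop) (C : Situation V n d) : Set (Fin n) :=
  {i | ∃ X, C.pend i = some X ∧ ¬ G X}

/-- The number of registers and pending writes that do not satisfy `G`. -/
noncomputable def badCount (G : Sixuplet V → Prop) (C : Situation V n d) : ℕ :=
  (badRegisters G C).ncard + (badProcesses G C).ncard

theorem exists_good (h : badCount G C ≤ d) : ∃ x, G (C.mem x) := by
  by_contra! all_bad
  have : badRegisters G C = Set.univ := Set.eq_univ_of_forall all_bad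
  rw [badCount, this, Set.ncard_univ, Nat.card_fin] at h
  omega

theorem badProcesses_announce_subset (hX : G X) :
    badProcesses G (C.announce i X) ⊆ badProcesses G C := by
  rintro j ⟨Y, hj, hY⟩
  obtain rfl | hji := eq_or_ne j i
  · simp only [announce_pend, Function.update_self, Option.some.injEq] at hj
    exact absurd (hj ▸ hX) hY
  · exact ⟨Y, by simpa [hji] using hj, hY⟩

theorem badProcesses_write_subset :
    badProcesses G (C.write i x X) ⊆ badProcesses G C \ {i} := by
  rintro j ⟨Y, hj, hY⟩
  obtain rfl | hji := eq_or_ne j i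
  · simp at hj
  · exact ⟨⟨Y, by simpa [hji] using hj, hY⟩, hji⟩

theorem badRegisters_write_subset_insert :
    badRegisters G (C.write i x X) ⊆ insert x (badRegisters G C) := by
  intro z hz
  obtain rfl | hzx := eq_or_ne z x
  · exact Set.mem_insert _ _
  · exact Or.inr (by simpa [badRegisters, hzx] using hz)

theorem badRegisters_write_subset (hX : G X) :
    badRegisters G (C.write i x X) ⊆ badRegisters G C := by
  intro z hz
  refine (badRegisters_write_subset_insert hz).resolve_left ?_
  rintro rfl
  simp [badRegisters, hX] at hz

theorem badCount_write_le (hp : C.pend i = some X) : badCount G (C.write i x X) ≤ badCount G C := by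
  by_cases hX : G X
  · exact Nat.add_le_add (Set.ncard_le_ncard (badRegisters_write_subset hX))
      (Set.ncard_le_ncard (badProcesses_write_subset.trans Set.sdiff_subset))
  · have registers := (Set.ncard_le_ncard (badRegisters_write_subset_insert (C := C) (G := G)
      (i := i) (x := x) (X := X))).trans (Set.ncard_insert_le _ _)
    have processes := Set.ncard_le_ncard (badProcesses_write_subset (C := C) (G := G)
      (i := i) (x := x) (X := X))
    have := Set.ncard_sdiff_singleton_add_one (show i ∈ badProcesses G C from ⟨X, hp, hX⟩)
    unfold badCount
    omega

/-- With at most `d` bad places, one of the `d + 1` registers is good, so every later snapshot sees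
a good sixuplet and no new bad one is announced. -/
theorem Move.badCount_le (hG : Inherited s d G) (hC : Move s C C') (h : badCount G C ≤ d) :
    badCount G C' ≤ d := by
  cases hC with
  | idle | decide | copy => exact h
  | announce i X fresh left =>
    have hX := hG _ _ fresh (exists_good h)
    exact (Nat.add_le_add_left (Set.ncard_le_ncard (badProcesses_announce_subset hX)) _).trans h
  | write i x X pend => exact (badCount_write_le pend).trans h

end Situation

namespace Situation

variable {V : Type u} {n d k s r ρ : ℕ} {y : WithBot V} {up cfl : Bool}
  {mem : Fin (d + 1) → Sixuplet V} {C C' : Situation V n d}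
  {X Z : Sixuplet V} {Q : Sixuplet V → Prop} {i : Fin n} {x : Fin (d + 1)} {a : V}

/-- The sixuplet is in a register or about to be written. -/
def InPlay (C : Situation V n d) (Z : Sixuplet V) : Prop :=
  (∃ x, C.mem x = Z) ∨ ∃ i, C.pend i = some Z

theorem InPlay.of_announce (h : InPlay (C.announce i X) Z) : InPlay C Z ∨ Z = X := by
  obtain h | ⟨j, hj⟩ := h
  · exact Or.inl (Or.inl h)
  · obtain rfl | hji := eq_or_ne j i
    · exact Or.inr (by simpa using hj.symm)
    · exact Or.inl (Or.inr ⟨j, by simpa [hji] using hj⟩)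

theorem InPlay.of_write (hp : C.pend i = some X) (h : InPlay (C.write i x X) Z) : InPlay C Z := by
  obtain ⟨z, hz⟩ | ⟨j, hj⟩ := h
  · obtain rfl | hzx := eq_or_ne z x
    · exact Or.inr ⟨i, by simpa [hp] using hz⟩
    · exact Or.inl ⟨z, by simpa [hzx] using hz⟩
  · obtain rfl | hji := eq_or_ne j i
    · simp at hj
    · exact Or.inr ⟨j, by simpa [hji] using hj⟩

/-- The values that have been decided. -/
def decided (C : Situation V n d) : Set V :=
  {a | ∃ i, C.dec i = some a}

theorem decided_decide_subset : decided (C.decide i a) ⊆ insert a (decided C) := by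
  rintro b ⟨j, hj⟩
  obtain rfl | hji := eq_or_ne j i
  · exact Or.inl (by simpa using hj.symm)
  · exact Or.inr ⟨j, by simpa [hji] using hj⟩

/-- The values that are decided in instance `s` or occur in a sixuplet in play that has reached
level "up" of round `r`. -/
def live (s r : ℕ) (C : Situation V n d) : Set (WithBot V) :=
  (WithBot.some '' decided C) ∪ Sixuplet.val '' {Z | InPlay C Z ∧ Z.sn = s ∧ Ahead s r Z}

/-- The values of the sixuplets in play at level "up" of round `r`. -/
def liveUp (s r : ℕ) (C : Situation V n d) : Set (WithBot V) :=
  Sixuplet.val '' {Z | InPlay C Z ∧ Z.sn = s ∧ Z.rd = r ∧ Z.up = true}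

theorem liveUp_subset_live (s r : ℕ) (C : Situation V n d) : liveUp s r C ⊆ live s r C := by
  rintro _ ⟨Z, ⟨inPlay, sn_eq, rd_eq, up_eq⟩, rfl⟩
  exact Or.inr ⟨Z, ⟨inPlay, sn_eq, Or.inr ⟨sn_eq, Or.inr ⟨rd_eq, up_eq⟩⟩⟩, rfl⟩

theorem Ahead.anti (h : ρ ≤ r) (hZ : Ahead s r Z) : Ahead s ρ Z := by
  obtain rfl | hlt := h.eq_or_lt
  · exact hZ
  · unfold Ahead Reaches at *
    omega

theorem live_anti (h : ρ ≤ r) (C : Situation V n d) : live s r C ⊆ live s ρ C :=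
  Set.union_subset_union_right _
    (Set.image_mono fun _ ⟨inPlay, sn_eq, ahead⟩ => ⟨inPlay, sn_eq, ahead.anti h⟩)

theorem mem_live_of_mem (sn_eq : (C.mem x).sn = s) (ahead : Ahead s r (C.mem x)) :
    (C.mem x).val ∈ live s r C :=
  Or.inr ⟨_, ⟨Or.inl ⟨x, rfl⟩, sn_eq, ahead⟩, rfl⟩

theorem Unanimous.mem_live (h : Unanimous C.mem s ρ up cfl y) (hr : r < ρ ∨ ρ = r ∧ up = true) :
    y ∈ live s r C :=
  (h 0).2.2.2.2 ▸ mem_live_of_mem (h 0).1 (h.ahead_iff.2 hr)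

theorem live_decide_subset : live s r (C.decide i a) ⊆ insert (a : WithBot V) (live s r C) := by
  rintro y (⟨b, hb, rfl⟩ | in_play)
  · exact (decided_decide_subset hb).imp (congrArg _) fun hb => Or.inl ⟨b, hb, rfl⟩
  · exact Or.inr (Or.inr in_play)

theorem live_write_subset (hp : C.pend i = some X) : live s r (C.write i x X) ⊆ live s r C :=
  Set.union_subset_union_right _ (Set.image_mono fun _ h => ⟨h.1.of_write hp, h.2⟩)

theorem mem_live_of_mem_live_announce (h : y ∈ live s r (C.announce i X)) :
    y ∈ live s r C ∨ X.sn = s ∧ Ahead s r X ∧ X.val = y := by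
  obtain dec | ⟨Z, ⟨inPlay, sn_eq, ahead⟩, rfl⟩ := h
  · exact Or.inl (Or.inl dec)
  · obtain inPlay | rfl := inPlay.of_announce
    · exact Or.inl (Or.inr ⟨Z, ⟨inPlay, sn_eq, ahead⟩, rfl⟩)
    · exact Or.inr ⟨sn_eq, ahead, rfl⟩

/-- The states of the memory in which an event may turn `y` into a live value of round `r`: a
decision in a lower round, the promotion of `y` to level "up" of round `r`, and the first write to
round `r + 1`. -/
inductive Opens (mem : Fin (d + 1) → Sixuplet V) (s r : ℕ) (y : WithBot V) : Prop
  | decided (ρ : ℕ) (one_le : 1 ≤ ρ) (lt : ρ < r) (unanimous : Unanimous mem s ρ true false y)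
  | promoted (ρ : ℕ) (succ_eq : ρ + 1 = r) (unanimous : Unanimous mem s ρ false false y)
  | advanced (cfl : Bool) (unanimous : Unanimous mem s r false cfl y)

theorem Opens.not_ahead (h : Opens mem s r y) (x : Fin (d + 1)) : ¬ Ahead s r (mem x) := by
  cases h with
  | decided ρ one_le lt unanimous => rw [unanimous.ahead_iff]; omega
  | promoted ρ succ_eq unanimous => rw [unanimous.ahead_iff]; omega
  | advanced cfl unanimous => simp [unanimous.ahead_iff]

theorem live_announce_of_raise (hm : Unanimous C.mem s ρ up cfl y)
    (not_up : cfl = false → up = false) (sn_eq : X.sn = s) (rd_eq : X.rd = ρ + 1)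
    (up_eq : X.up = !cfl) (val_eq : X.val = y) :
    live s r (C.announce i X) ⊆ live s r C ∨
      y ∈ live s r (C.announce i X) ∧ live s r (C.announce i X) ⊆ insert y (live s r C) ∧
        Opens C.mem s r y := by
  have subset_insert : live s r (C.announce i X) ⊆ insert y (live s r C) := fun z hz =>
    (mem_live_of_mem_live_announce hz).symm.imp (fun h => h.2.2.symm.trans val_eq) id
  by_cases hy : y ∈ live s r C
  · exact Or.inl (subset_insert.trans (Set.insert_subset hy le_rfl))
  by_cases ahead : Ahead s r X
  · have hX : InPlay (C.announce i X) X := Or.inr ⟨i, by simp⟩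
    refine Or.inr ⟨Or.inr ⟨X, ⟨hX, sn_eq, ahead⟩, val_eq⟩, subset_insert, ?_⟩
    have not_above : ¬ (r < ρ ∨ ρ = r ∧ up = true) := fun h => hy (hm.mem_live h)
    have reaches : r < ρ + 1 ∨ ρ + 1 = r ∧ cfl = false := by
      simpa [Ahead, Reaches, sn_eq, rd_eq, up_eq] using ahead
    obtain rfl | succ_eq : ρ = r ∨ ρ + 1 = r := by omega
    · obtain rfl : up = false := by simpa using not_above
      exact .advanced cfl hm
    · obtain rfl : cfl = false := (reaches.resolve_left (by omega)).2
      obtain rfl := not_up rfl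
      exact .promoted ρ succ_eq hm
  · exact Or.inl fun z hz =>
      (mem_live_of_mem_live_announce hz).resolve_right fun h => ahead h.2.1

theorem live_announce (hr : 1 ≤ r) (hX : Fresh s C.mem X) :
    live s r (C.announce i X) ⊆ live s r C ∨
      ∃ y ∈ live s r (C.announce i X), live s r (C.announce i X) ⊆ insert y (live s r C) ∧
        Opens C.mem s r y := by
  cases hX with
  | later lt_sn =>
    exact Or.inl fun y hy => (mem_live_of_mem_live_announce hy).resolve_right (by omega)
  | earlier sn_lt mem_sn_lt =>
    exact Or.inl fun y hy => (mem_live_of_mem_live_announce hy).resolve_right (by omega)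
  | raise ρ up cfl y one_le unanimous not_up sn_eq rd_eq up_eq val_eq =>
    exact (live_announce_of_raise unanimous not_up sn_eq rd_eq up_eq val_eq).imp_right
      fun h => ⟨y, h⟩
  | adopt sn_eq bound source =>
    refine Or.inl fun y hy => (mem_live_of_mem_live_announce hy).elim id ?_
    rintro ⟨-, ahead, rfl⟩
    obtain ⟨rd_eq, up_eq⟩ | ⟨x, sn_eq', rd_eq, up_eq, val_eq⟩ := source
    · simp only [Ahead, Reaches, sn_eq, rd_eq, up_eq, Bool.false_eq_true, and_false,
        or_false] at ahead
      omega
    · refine val_eq ▸ mem_live_of_mem sn_eq' ?_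
      simpa only [Ahead, Reaches, sn_eq, sn_eq', rd_eq, up_eq] using ahead

theorem Move.live_subset (hr : 1 ≤ r) (h : Move s C C') :
    live s r C' ⊆ live s r C ∨ C'.mem = C.mem ∧
      ∃ y ∈ live s r C', live s r C' ⊆ insert y (live s r C) ∧ Opens C.mem s r y := by
  cases h with
  | idle => exact Or.inl le_rfl
  | write i x X pend => exact Or.inl (live_write_subset pend)
  | announce i X fresh left => exact (live_announce hr fresh).imp_right fun h => ⟨rfl, h⟩
  | copy i j a pend dec =>
    exact Or.inl (live_decide_subset.trans
      (Set.insert_subset (Or.inl ⟨a, ⟨j, dec⟩, rfl⟩) le_rfl))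
  | decide i a ρ one_le pend unanimous =>
    by_cases hρ : r ≤ ρ
    · have ha : (a : WithBot V) ∈ live s r C :=
        unanimous.mem_live (hρ.lt_or_eq.imp_right fun h => ⟨h.symm, rfl⟩)
      exact Or.inl (live_decide_subset.trans (Set.insert_subset ha le_rfl))
    · exact Or.inr ⟨rfl, a, Or.inl ⟨a, ⟨i, by simp⟩, rfl⟩, live_decide_subset,
        .decided ρ one_le (by omega) unanimous⟩

theorem Move.live_subset_of_ahead (hr : 1 ≤ r) (h : Move s C C')
    (hA : ∃ x, Ahead s r (C.mem x)) : live s r C' ⊆ live s r C :=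
  (h.live_subset hr).resolve_right fun ⟨_, _, _, _, opens⟩ =>
    hA.elim fun x hx => opens.not_ahead x hx

theorem liveUp_announce_subset (hX : Fresh s C.mem X) (hA : ∃ x, AtLeast s r (C.mem x)) :
    liveUp s r (C.announce i X) ⊆ liveUp s r C := by
  obtain ⟨x, hx⟩ := hA
  rintro _ ⟨Z, ⟨inPlay, sn_eq, rd_eq, up_eq⟩, rfl⟩
  obtain inPlay | rfl := inPlay.of_announce
  · exact ⟨Z, ⟨inPlay, sn_eq, rd_eq, up_eq⟩, rfl⟩
  cases hX with
  | later lt_sn => omega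
  | earlier sn_lt mem_sn_lt => omega
  | raise ρ up cfl y one_le unanimous not_up sn_eq' rd_eq' up_eq' val_eq =>
    have := unanimous.atLeast_iff.1 hx
    omega
  | adopt sn_eq' bound source =>
    obtain ⟨-, up_eq'⟩ | ⟨x, sn_x, rd_x, up_x, val_x⟩ := source
    · simp [up_eq'] at up_eq
    · exact ⟨C.mem x, ⟨Or.inl ⟨x, rfl⟩, sn_x, rd_x.trans rd_eq, up_x.trans up_eq⟩, val_x⟩

theorem Move.liveUp_subset (h : Move s C C') (hA : ∃ x, AtLeast s r (C.mem x)) :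
    liveUp s r C' ⊆ liveUp s r C := by
  cases h with
  | idle | decide | copy => exact le_rfl
  | write i x X pend => exact Set.image_mono fun _ h => ⟨h.1.of_write pend, h.2⟩
  | announce i X fresh left => exact liveUp_announce_subset fresh hA

/-- The decisions of instance `s` are those of processes that have left it. -/
def Left (s : ℕ) (C : Situation V n d) : Prop :=
  ∀ i X, C.dec i ≠ none → C.pend i = some X → s < X.sn

theorem Move.left (h : Move s C C') (hC : Left s C) : Left s C' := by
  intro j Y hj hY
  cases h with
  | idle => exact hC j Y hj hY
  | decide i a _ _ pend | copy i _ a pend =>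
    obtain rfl | hji := eq_or_ne j i
    · simp [pend] at hY
    · exact hC j Y (by simpa [hji] using hj) hY
  | announce i X fresh left =>
    obtain rfl | hji := eq_or_ne j i
    · obtain rfl : X = Y := by simpa using hY
      exact left hj
    · exact hC j Y hj (by simpa [hji] using hY)
  | write i x X pend =>
    obtain rfl | hji := eq_or_ne j i
    · simp at hY
    · exact hC j Y hj (by simpa [hji] using hY)

/-- The value that process `i` has decided, or else the one that it is about to write. -/
def carriedValue (C : Situation V n d) (i : Fin n) : WithBot V :=
  (C.dec i).elim ((C.pend i).elim ⊥ Sixuplet.val) WithBot.some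

theorem live_inter_subset_carriedValue (hleft : Left s C) (hm : ∀ x, ¬ Ahead s r (C.mem x))
    {Y : Set (WithBot V)}
    (hY : ∀ Z, Z.sn = s → Ahead s r Z → Z.val ∈ Y → Reaches s ρ Q Z) :
    live s r C ∩ Y ⊆ carriedValue C '' (badProcesses (Reaches s ρ Q) C)ᶜ := by
  rintro _ ⟨⟨a, ⟨i, hi⟩, rfl⟩ | ⟨Z, ⟨⟨x, rfl⟩ | ⟨i, hi⟩, sn_eq, ahead⟩, rfl⟩, mem_Y⟩
  · refine ⟨i, ?_, by simp [carriedValue, hi]⟩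
    rintro ⟨X, hX, hG⟩
    exact hG (Or.inl (hleft i X (by simp [hi]) hX))
  · exact absurd ahead (hm x)
  · have dec_eq : C.dec i = none := by
      by_contra h
      have := hleft i Z h hi
      omega
    refine ⟨i, ?_, by simp [carriedValue, dec_eq, hi]⟩
    rintro ⟨X, hX, hG⟩
    obtain rfl : Z = X := Option.some.inj (hi.symm.trans hX)
    exact hG (hY Z sn_eq ahead mem_Y)

/-- While no register is ahead, each live value needs a process of its own, which leaves at most
`n - k ≤ d` processes that are bad. -/
theorem badCount_le_of_live (hn : n ≤ k + d) (hleft : Left s C)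
    (hm : ∀ x, ¬ Ahead s r (C.mem x)) (good : ∀ x, Reaches s ρ Q (C.mem x)) (Y : Set (WithBot V))
    (hY : ∀ Z, Z.sn = s → Ahead s r Z → Z.val ∈ Y → Reaches s ρ Q Z)
    (hk : (k : ℕ∞) ≤ (live s r C ∩ Y).encard) : badCount (Reaches s ρ Q) C ≤ d := by
  have no_bad_register : badRegisters (Reaches s ρ Q) C = ∅ :=
    Set.eq_empty_of_forall_notMem fun x hx => hx (good x)
  have hle : (k : ℕ∞) ≤ (badProcesses (Reaches s ρ Q) C)ᶜ.encard :=
    hk.trans ((Set.encard_le_encard (live_inter_subset_carriedValue hleft hm hY)).trans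
      (Set.encard_image_le _ _))
  rw [← Set.Finite.cast_ncard_eq (Set.toFinite _), Nat.cast_le] at hle
  have := Set.ncard_add_ncard_compl (badProcesses (Reaches s ρ Q) C)
  rw [Nat.card_fin] at this
  rw [badCount, no_bad_register, Set.ncard_empty]
  omega

/-- No process can decide `y` in round `r` any more. -/
def Excluded (s r : ℕ) (y : WithBot V) (C : Situation V n d) : Prop :=
  badCount (Against s r y) C ≤ d ∨ badCount (AtLeast s r) C ≤ d ∧ y ∉ liveUp s r C

/-- No value can enter level "up" of round `r` any more, except for values that are live. -/
def Sealed (s k r : ℕ) (C : Situation V n d) : Prop :=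
  (∃ ρ, 1 ≤ ρ ∧ ρ < r ∧ badCount (Ahead s ρ) C ≤ d ∧ (live s ρ C).encard ≤ k) ∨
  (∃ y ∈ live s r C, ∃ ρ, ρ + 1 = r ∧ badCount (Tied s ρ y) C ≤ d) ∨
  badCount (AtLeast s r) C ≤ d

/-- Either no decision can be made in round `r`, or at most `k` values are live, and once there are
`k` of them no further one can become live. -/
def Controlled (s k r : ℕ) (C : Situation V n d) : Prop :=
  (∀ y, Excluded s r y C) ∨
    (live s r C).encard ≤ k ∧ ((live s r C).encard = k → Sealed s k r C)

theorem Move.excluded (h : Move s C C') (hE : Excluded s r y C) : Excluded s r y C' := by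
  obtain against | ⟨atLeast, notMem⟩ := hE
  · exact Or.inl (h.badCount_le (inherited_against s r y) against)
  · exact Or.inr ⟨h.badCount_le (inherited_atLeast s r) atLeast,
      fun hy => notMem (h.liveUp_subset (exists_good atLeast) hy)⟩

theorem Unanimous.not_excluded (hm : Unanimous C.mem s r true false y) : ¬ Excluded s r y C := by
  rintro (against | ⟨-, notMem⟩)
  · obtain ⟨x, hx⟩ := exists_good against
    simp [hm.against_iff] at hx
  · obtain ⟨sn_eq, rd_eq, up_eq, -, val_eq⟩ := hm 0
    exact notMem ⟨C.mem 0, ⟨Or.inl ⟨0, rfl⟩, sn_eq, rd_eq, up_eq⟩, val_eq⟩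

theorem eq_of_subset_of_encard {S T : Set (WithBot V)} (hST : S ⊆ T) (hT : T.encard ≤ k)
    (hS : S.encard = k) : S = T :=
  ((Set.finite_of_encard_le_coe hT).subset hST).eq_of_subset_of_encard_le hST (hT.trans hS.ge)

theorem Sealed.of_move (h : Move s C C') (hC : Sealed s k r C) (heq : live s r C' = live s r C) :
    Sealed s k r C' := by
  obtain ⟨ρ, one_le, lt, ahead, card_le⟩ | ⟨y, hy, ρ, succ_eq, tied⟩ | atLeast := hC
  · exact Or.inl ⟨ρ, one_le, lt, h.badCount_le (inherited_ahead s ρ) ahead,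
      (Set.encard_le_encard (h.live_subset_of_ahead one_le (exists_good ahead))).trans card_le⟩
  · exact Or.inr (Or.inl ⟨y, heq ▸ hy, ρ, succ_eq, h.badCount_le (inherited_tied s ρ y) tied⟩)
  · exact Or.inr (Or.inr (h.badCount_le (inherited_atLeast s r) atLeast))

theorem Controlled.of_live_subset (h : Move s C C') (hC : Controlled s k r C)
    (hsub : live s r C' ⊆ live s r C) : Controlled s k r C' := by
  obtain excluded | ⟨card_le, sealed⟩ := hC
  · exact Or.inl fun y => h.excluded (excluded y)
  · refine Or.inr ⟨(Set.encard_le_encard hsub).trans card_le, fun card_eq => ?_⟩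
    have heq := eq_of_subset_of_encard hsub card_le card_eq
    exact (sealed (heq ▸ card_eq)).of_move h heq

theorem controlled_of_decided (hn : n ≤ k + d) (hleft : Left s C) (one_le : 1 ≤ ρ) (hρr : ρ < r)
    (hm : Unanimous C.mem s ρ true false y) (hle : (live s ρ C).encard ≤ k) :
    Controlled s k r C := by
  refine Or.inr ⟨(Set.encard_le_encard (live_anti hρr.le C)).trans hle, fun card_eq =>
    Or.inl ⟨ρ, one_le, hρr, ?_, hle⟩⟩
  refine badCount_le_of_live hn hleft (r := r) (fun x => ?_) (fun x => hm.ahead_iff.2 (by simp))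
    Set.univ (fun Z _ ahead _ => ahead.anti hρr.le) (by rw [Set.inter_univ, card_eq])
  rw [hm.ahead_iff]
  omega

theorem controlled_of_promoted (hn : n ≤ k + d) (hleft : Left s C) (succ_eq : ρ + 1 = r)
    (hm : Unanimous C.mem s ρ false false y) (hy : y ∈ live s r C)
    (hle : (live s r C).encard ≤ k) : Controlled s k r C := by
  refine Or.inr ⟨hle, fun card_eq => Or.inr (Or.inl ⟨y, hy, ρ, succ_eq, ?_⟩)⟩
  refine badCount_le_of_live hn hleft (r := r) (fun x => ?_) (fun x => hm.tied_iff.2 (by simp))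
    Set.univ (fun Z sn_eq ahead _ => ?_) (by rw [Set.inter_univ, card_eq])
  · rw [hm.ahead_iff]
    omega
  · unfold Ahead Reaches at ahead
    exact Or.inr ⟨sn_eq, Or.inl (by omega)⟩

theorem le_encard_inter_ne {S : Set (WithBot V)} (h : ((k + 1 : ℕ) : ℕ∞) ≤ S.encard)
    (y : WithBot V) : (k : ℕ∞) ≤ (S ∩ {z | z ≠ y}).encard := by
  have := h.trans (Set.encard_le_encard_sdiff_add_encard S {y})
  rw [Set.encard_singleton, Nat.cast_add, Nat.cast_one] at this
  exact (ENat.add_le_add_iff_right ENat.one_ne_top).1 this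

theorem controlled_of_advanced (hn : n ≤ k + d) (hleft : Left s C)
    (hm : Unanimous C.mem s r false cfl y) (hy : y ∉ liveUp s r C) : Controlled s k r C := by
  have not_ahead (x) : ¬ Ahead s r (C.mem x) := by simp [hm.ahead_iff]
  have atLeast (hk : (k : ℕ∞) ≤ (live s r C).encard) : badCount (AtLeast s r) C ≤ d := by
    refine badCount_le_of_live hn hleft not_ahead (fun x => hm.atLeast_iff.2 le_rfl) Set.univ
      (fun Z _ ahead _ => ?_) (by rwa [Set.inter_univ])
    exact ahead.imp id (And.imp id (Or.imp id (And.imp id fun _ => trivial)))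
  have against (hk : ((k + 1 : ℕ) : ℕ∞) ≤ (live s r C).encard) {z : WithBot V}
      (hz : cfl = true ∨ y ≠ z) : badCount (Against s r z) C ≤ d :=
    badCount_le_of_live hn hleft not_ahead (fun x => hm.against_iff.2 (Or.inr ⟨rfl, hz⟩))
      {z' | z' ≠ z} (fun Z _ ahead hne => ahead.imp id (And.imp id
        (Or.imp id (And.imp id fun _ => Or.inr hne)))) (le_encard_inter_ne hk z)
  by_cases hk : ((k + 1 : ℕ) : ℕ∞) ≤ (live s r C).encard
  · refine Or.inl fun z => ?_
    by_cases hz : cfl = true ∨ y ≠ z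
    · exact Or.inl (against hk hz)
    · obtain rfl : y = z := not_not.1 (not_or.1 hz).2
      exact Or.inr ⟨atLeast (le_trans (by exact_mod_cast Nat.le_succ k) hk), hy⟩
  · rw [not_le, Nat.cast_add, Nat.cast_one] at hk
    exact Or.inr ⟨Order.le_of_lt_add_one hk, fun card_eq => Or.inr (Or.inr (atLeast card_eq.ge))⟩

theorem Move.not_sealed (h : Move s C C') (succ_eq : ρ + 1 = r)
    (hm : Unanimous C.mem s ρ false false y) (hsub : ¬ live s r C' ⊆ live s r C)
    (hy : y ∉ live s r C) (card_eq : (live s r C).encard = k) : ¬ Sealed s k r C := by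
  rintro (⟨ρ', one_le, lt, ahead, card_le⟩ | ⟨z, hz, ρ', succ_eq', tied⟩ | atLeast)
  · have heq := eq_of_subset_of_encard (live_anti lt.le C) card_le card_eq
    exact hsub (((live_anti lt.le C').trans
      (h.live_subset_of_ahead one_le (exists_good ahead))).trans heq.symm.subset)
  · obtain ⟨x, hx⟩ := exists_good tied
    rw [hm.tied_iff] at hx
    obtain rfl : y = z := by simpa using hx.resolve_left (by omega) |>.2
    exact hy hz
  · obtain ⟨x, hx⟩ := exists_good atLeast
    rw [hm.atLeast_iff] at hx
    omega

theorem Move.controlled (hn : n ≤ k + d) (h : Move s C C') (hleft : Left s C)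
    (hC : ∀ r, 1 ≤ r → Controlled s k r C) (hr : 1 ≤ r) : Controlled s k r C' := by
  by_cases hsub : live s r C' ⊆ live s r C
  · exact (hC r hr).of_live_subset h hsub
  obtain excluded | ⟨card_le, sealed⟩ := hC r hr
  · exact Or.inl fun y => h.excluded (excluded y)
  obtain ⟨mem_eq, y, hy', hins, opens⟩ := (h.live_subset hr).resolve_left hsub
  have hy : y ∉ live s r C := fun hy => hsub (hins.trans (Set.insert_subset hy le_rfl))
  have hleft' := h.left hleft
  cases opens with
  | decided ρ one_le lt unanimous =>
    refine controlled_of_decided hn hleft' one_le lt (mem_eq ▸ unanimous) ?_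
    have ahead : Ahead s ρ (C.mem 0) := unanimous.ahead_iff.2 (by simp)
    exact (Set.encard_le_encard (h.live_subset_of_ahead one_le ⟨0, ahead⟩)).trans
      ((hC ρ one_le).resolve_left fun excluded => unanimous.not_excluded (excluded y)).1
  | promoted ρ succ_eq unanimous =>
    have card_lt : (live s r C).encard < k := lt_of_le_of_ne card_le fun card_eq =>
      h.not_sealed succ_eq unanimous hsub hy card_eq (sealed card_eq)
    exact controlled_of_promoted hn hleft' succ_eq (mem_eq ▸ unanimous) hy'
      ((Set.encard_le_encard hins).trans ((Set.encard_insert_le _ _).trans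
        (Order.add_one_le_of_lt card_lt)))
  | advanced cfl unanimous =>
    have atLeast : AtLeast s r (C.mem 0) := unanimous.atLeast_iff.2 le_rfl
    exact controlled_of_advanced hn hleft' (mem_eq ▸ unanimous) fun hU =>
      hy (liveUp_subset_live s r C (h.liveUp_subset ⟨0, atLeast⟩ hU))

/-- The invariant of an instance. -/
structure Safe (s k : ℕ) (C : Situation V n d) : Prop where
  left : Left s C
  controlled : ∀ r, 1 ≤ r → Controlled s k r C
  agreement : (decided C).encard ≤ k

theorem Move.agreement (h : Move s C C') (hC : Safe s k C) : (decided C').encard ≤ k := by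
  cases h with
  | idle | announce | write => exact hC.agreement
  | copy i j a pend dec =>
    exact (Set.encard_le_encard (decided_decide_subset.trans
      (Set.insert_subset (show a ∈ decided C from ⟨j, dec⟩) le_rfl))).trans hC.agreement
  | decide i a r one_le pend unanimous =>
    have card_le := ((hC.controlled r one_le).resolve_left
      fun excluded => unanimous.not_excluded (excluded a)).1
    have ha : (a : WithBot V) ∈ live s r C := unanimous.mem_live (by simp)
    rw [← WithBot.coe_injective.encard_image]
    exact (Set.encard_le_encard (Set.subset_union_left.trans
      (live_decide_subset.trans (Set.insert_subset ha le_rfl)))).trans card_le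

theorem Move.safe (hn : n ≤ k + d) (h : Move s C C') (hC : Safe s k C) : Safe s k C' :=
  ⟨h.left hC.left, fun _ => h.controlled hn hC.left hC.controlled, h.agreement hC⟩

theorem safe_of_quiescent (hs : 1 ≤ s) (hk : 1 ≤ k) (hm : ∀ x, (C.mem x).sn = 0)
    (hp : ∀ i, C.pend i = none) (hd : ∀ i, C.dec i = none) : Safe s k C := by
  have decided_eq : decided C = ∅ := by simp [decided, hd]
  have live_eq (r) : live s r C = ∅ := by
    rw [live, decided_eq, Set.image_empty, Set.empty_union, Set.image_eq_empty]
    refine Set.eq_empty_of_forall_notMem ?_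
    rintro Z ⟨⟨x, rfl⟩ | ⟨i, hi⟩, sn_eq, -⟩
    · have := hm x
      omega
    · simp [hp] at hi
  refine ⟨fun i _ h => absurd (hd i) h, fun r _ => Or.inr ⟨by simp [live_eq], fun card_eq => ?_⟩,
    by simp [decided_eq]⟩
  have : 0 = k := by exact_mod_cast (show (0 : ℕ∞) = k by simpa [live_eq] using card_eq)
  omega

end Situation

/-! ### The algorithm -/

namespace Sixuplet

variable {V : Type u}

theorem key_eq_iff {X Y : Sixuplet V} : X.key = Y.key ↔
    X.sn = Y.sn ∧ X.rd = Y.rd ∧ X.up = Y.up ∧ X.cfl = Y.cfl ∧ X.val = Y.val := by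
  simp [key]

variable [LinearOrder V] {mx : List (Sixuplet V) → Sixuplet V} {T : List (Sixuplet V)}
  {X Y : Sixuplet V}

theorem key_le_iff : X.key ≤ Y.key ↔
    X.sn < Y.sn ∨ X.sn = Y.sn ∧ (X.rd < Y.rd ∨ X.rd = Y.rd ∧ (X.up < Y.up ∨ X.up = Y.up ∧
      (X.cfl < Y.cfl ∨ X.cfl = Y.cfl ∧ X.val ≤ Y.val))) := by
  simp [key, Prod.Lex.toLex_le_toLex]

theorem exists_eq_sup (hmx : IsMaxRule mx) (hT : T ≠ []) :
    ∃ Z ∈ T, (∀ X ∈ T, X.key ≤ Z.key) ∧ Z.sn = (sup mx T).sn ∧ Z.rd = (sup mx T).rd ∧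
      Z.up = (sup mx T).up ∧ Z.val = (sup mx T).val ∧ Z.dcd = (sup mx T).dcd :=
  ⟨mx T, (hmx T hT).1, (hmx T hT).2, rfl, rfl, rfl, rfl, rfl⟩

theorem sup_cfl_iff (hmx : IsMaxRule mx) (hT : T ≠ []) : (sup mx T).cfl = true ↔
    ∃ X ∈ T, X.sn = (sup mx T).sn ∧ X.rd = (sup mx T).rd ∧
      (X.cfl = true ∨ X.val ≠ (sup mx T).val) := by
  simp only [sup, decide_eq_true_eq]
  constructor
  · rintro (⟨X, hX, sn_eq, rd_eq, cfl_eq⟩ | ⟨X, hX, Y, hY, X_eq, Y_eq, val_ne⟩)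
    · exact ⟨X, hX, sn_eq, rd_eq, Or.inl cfl_eq⟩
    · by_cases h : X.val = (mx T).val
      · exact ⟨Y, hY, Y_eq.1, Y_eq.2, Or.inr fun h' => val_ne (h.trans h'.symm)⟩
      · exact ⟨X, hX, X_eq.1, X_eq.2, Or.inr h⟩
  · rintro ⟨X, hX, sn_eq, rd_eq, cfl_eq | val_ne⟩
    · exact Or.inl ⟨X, hX, sn_eq, rd_eq, cfl_eq⟩
    · exact Or.inr ⟨X, hX, mx T, (hmx T hT).1, ⟨sn_eq, rd_eq⟩, ⟨rfl, rfl⟩, val_ne⟩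

theorem key_le_sup (hmx : IsMaxRule mx) (hX : X ∈ T) : X.key ≤ (sup mx T).key := by
  obtain ⟨mx_mem, le_mx⟩ := hmx T (List.ne_nil_of_mem hX)
  have cfl_imp : (mx T).cfl = true → (sup mx T).cfl = true := fun h => by
    rw [sup_cfl_iff hmx (List.ne_nil_of_mem hX)]
    exact ⟨mx T, mx_mem, rfl, rfl, Or.inl h⟩
  refine (le_mx X hX).trans (key_le_iff.2 (Or.inr ⟨rfl, Or.inr ⟨rfl, Or.inr ⟨rfl, ?_⟩⟩⟩))
  exact (Bool.le_iff_imp.2 cfl_imp).lt_or_eq.imp_right fun h => ⟨h, le_rfl⟩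

theorem lt_or_absorbs_sup (hmx : IsMaxRule mx) (hX : X ∈ T) :
    X.sn < (sup mx T).sn ∨ X.sn = (sup mx T).sn ∧
      (X.rd < (sup mx T).rd ∨ X.rd = (sup mx T).rd ∧ Situation.Absorbs (sup mx T) X) := by
  have cfl_iff := sup_cfl_iff hmx (List.ne_nil_of_mem hX)
  rcases key_le_iff.1 (key_le_sup hmx hX) with h | ⟨sn_eq, h | ⟨rd_eq, h⟩⟩
  · exact Or.inl h
  · exact Or.inr ⟨sn_eq, Or.inl h⟩
  · have up_le : X.up ≤ (sup mx T).up := h.elim le_of_lt fun h => h.1.le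
    exact Or.inr ⟨sn_eq, Or.inr ⟨rd_eq, Bool.le_iff_imp.1 up_le,
      fun h => cfl_iff.2 ⟨X, hX, sn_eq, rd_eq, Or.inl h⟩,
      fun h => cfl_iff.2 ⟨X, hX, sn_eq, rd_eq, Or.inr h⟩⟩⟩

theorem key_minIndex_le {d : ℕ} (view : Fin (d + 1) → Sixuplet V) (y : Fin (d + 1)) :
    (view (minIndex view)).key ≤ (view y).key :=
  (Finset.mem_filter.1 (Finset.min'_mem _ (exists_minimal view))).2 y

end Sixuplet

namespace Proposing

open Sixuplet

variable {V : Type u} {d s : ℕ} {view : Fin (d + 1) → Sixuplet V} {b : Proposing V d}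
  {X : Sixuplet V}

/-- The first test after a snapshot: all registers agree on their first five fields, with sequence
number `s` and a positive round. -/
def Homogeneous (s : ℕ) (view : Fin (d + 1) → Sixuplet V) : Prop :=
  (∀ x, (view x).key = (view 0).key) ∧ (view 0).sn = s ∧ 0 < (view 0).rd

theorem Homogeneous.unanimous (h : Homogeneous s view) :
    Situation.Unanimous view s (view 0).rd (view 0).up (view 0).cfl (view 0).val := fun x =>
  let ⟨sn_eq, fields⟩ := key_eq_iff.1 (h.1 x)
  ⟨sn_eq.trans h.2.1, fields⟩

/-- The sixuplet with which a process enters its current instance. -/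
def entry (b : Proposing V d) : Sixuplet V := ⟨b.sn, 1, false, false, b.val, b.dcd⟩

/-- The arguments of the function `sup` after a snapshot. -/
def candidates (b : Proposing V d) (view : Fin (d + 1) → Sixuplet V) : List (Sixuplet V) :=
  List.ofFn view ++ [b.entry]

theorem mem_candidates : X ∈ b.candidates view ↔ (∃ x, view x = X) ∨ X = b.entry := by
  simp only [candidates, List.mem_append, List.mem_ofFn, List.mem_singleton]

theorem view_mem_candidates (b : Proposing V d) (view : Fin (d + 1) → Sixuplet V)
    (x : Fin (d + 1)) : view x ∈ b.candidates view :=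
  mem_candidates.2 (Or.inl ⟨x, rfl⟩)

theorem entry_mem_candidates (b : Proposing V d) (view : Fin (d + 1) → Sixuplet V) :
    b.entry ∈ b.candidates view :=
  mem_candidates.2 (Or.inr rfl)

theorem candidates_ne_nil (b : Proposing V d) (view : Fin (d + 1) → Sixuplet V) :
    b.candidates view ≠ [] :=
  List.ne_nil_of_mem (entry_mem_candidates b view)

/-- What a process writes when all registers agree and it does not decide: the agreed sixuplet
enters the next round, at level "up" unless it has a conflict. -/
def raised (b : Proposing V d) (X : Sixuplet V) : Sixuplet V :=
  ⟨b.sn, X.rd + 1, !X.cfl, false, X.val, b.dcd⟩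

variable [LinearOrder V] {mx : List (Sixuplet V) → Sixuplet V}

/-- What a process writes when the registers do not agree. -/
def adopted (mx : List (Sixuplet V) → Sixuplet V) (b : Proposing V d)
    (view : Fin (d + 1) → Sixuplet V) : Sixuplet V :=
  sup mx (b.candidates view)

theorem sn_le_sn_adopted (hmx : IsMaxRule mx) (b : Proposing V d)
    (view : Fin (d + 1) → Sixuplet V) : b.sn ≤ (b.adopted mx view).sn :=
  (key_le_iff.1 (key_le_sup hmx (entry_mem_candidates b view))).elim le_of_lt fun h => h.1.le

/-- A snapshot that has returned `view` makes the process write `X` into register `x`. -/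
inductive Plans (mx : List (Sixuplet V) → Sixuplet V) (b : Proposing V d)
    (view : Fin (d + 1) → Sixuplet V) : Fin (d + 1) → Sixuplet V → Prop
  | raise (homogeneous : Homogeneous b.sn view)
      (not_up : (view 0).cfl = false → (view 0).up = false) :
      Plans mx b view 0 (b.raised (view 0))
  | adopt (not_homogeneous : ¬ Homogeneous b.sn view) (sn_eq : (b.adopted mx view).sn = b.sn) :
      Plans mx b view (minIndex view) (b.adopted mx view)

theorem Plans.sn_eq {x : Fin (d + 1)} (h : b.Plans mx view x X) : X.sn = b.sn := by
  cases h with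
  | raise => rfl
  | adopt _ sn_eq => exact sn_eq

theorem afterSnapshot_cases (hmx : IsMaxRule mx) (b : Proposing V d)
    (view : Fin (d + 1) → Sixuplet V) :
    (Homogeneous b.sn view ∧ (view 0).up = true ∧ (view 0).cfl = false ∧
      b.afterSnapshot mx view = b.finish (view 0).val) ∨
    (b.sn < (b.adopted mx view).sn ∧
      b.afterSnapshot mx view = b.finish (b.adopted mx view).dcd[b.sn - 1]?) ∨
    ∃ x X, b.Plans mx view x X ∧ b.afterSnapshot mx view = b.goWrite x X := by
  by_cases homogeneous : Homogeneous b.sn view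
  · have after_eq : b.afterSnapshot mx view = match (view 0).up, (view 0).cfl with
        | true, false => b.finish (view 0).val
        | false, false => b.goWrite 0 ⟨b.sn, (view 0).rd + 1, true, false, (view 0).val, b.dcd⟩
        | _, true => b.goWrite 0 ⟨b.sn, (view 0).rd + 1, false, false, (view 0).val, b.dcd⟩ :=
      if_pos homogeneous
    by_cases decides : (view 0).up = true ∧ (view 0).cfl = false
    · left
      rw [after_eq, decides.1, decides.2]
      exact ⟨homogeneous, rfl, rfl, rfl⟩
    · right; right
      refine ⟨0, _, .raise homogeneous fun cfl => by simpa [cfl] using decides, ?_⟩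
      rw [after_eq, raised]
      cases up : (view 0).up <;> cases cfl : (view 0).cfl <;> simp [up, cfl] at decides ⊢
  · have after_eq : b.afterSnapshot mx view =
        if b.sn < (b.adopted mx view).sn then b.finish (b.adopted mx view).dcd[b.sn - 1]?
        else b.goWrite (minIndex view) (b.adopted mx view) := if_neg homogeneous
    right
    by_cases sn_lt : b.sn < (b.adopted mx view).sn
    · exact Or.inl ⟨sn_lt, after_eq.trans (if_pos sn_lt)⟩
    · have sn_eq := le_antisymm (not_lt.1 sn_lt) (sn_le_sn_adopted hmx b view)
      exact Or.inr ⟨_, _, .adopt homogeneous sn_eq, after_eq.trans (if_neg sn_lt)⟩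

end Proposing

/-- The protocol of the repeated set agreement algorithm, for an arbitrary number `d + 1` of
registers. -/
def setAgreement {V : Type u} [LinearOrder V] (n d : ℕ)
    (mx : List (Sixuplet V) → Sixuplet V) : Protocol.{u, u, u} V n (d + 1) :=
  Protocol.anonymous n (fun _ => Sixuplet.bottom) (repeatedProgram d mx)

namespace setAgreement

open Protocol

variable {V : Type u} [LinearOrder V] {n d : ℕ} {mx : List (Sixuplet V) → Sixuplet V}

/-- The content of the registers, with its concrete type. -/
def reg (C : (setAgreement n d mx).Config) : Fin (d + 1) → Sixuplet V := C.mem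

/-- The local state of a process, with its concrete type. -/
def state (C : (setAgreement n d mx).Config) (i : Fin n) : List V ⊕ Proposing V d := C.loc i

/-- The global state after process `i` has returned `a`, keeping the list `L` of decisions. -/
def returned (C : (setAgreement n d mx).Config) (i : Fin n) (a : V) (L : List V) :
    (setAgreement n d mx).Config :=
  C.settle i (Outcome.ret a L : Outcome V (List V) (Proposing V d))

/-- The global state after process `i` has continued its operation in the local state `b`. -/
def stayed (C : (setAgreement n d mx).Config) (i : Fin n) (b : Proposing V d) :
    (setAgreement n d mx).Config :=
  C.settle i (Outcome.stay b : Outcome V (List V) (Proposing V d))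

/-- The global state after process `i`, with list `L` of decisions, has proposed `a`. -/
def invoked (C : (setAgreement n d mx).Config) (i : Fin n) (a : V) (L : List V) :
    (setAgreement n d mx).Config :=
  stayed (C.invoke i a) i ⟨C.sn i + 1, a, L, none⟩

/-- The global state after process `i`, in the local state `b`, has written `X` into register
`x`. -/
def written (C : (setAgreement n d mx).Config) (i : Fin n) (b : Proposing V d) (x : Fin (d + 1))
    (X : Sixuplet V) : (setAgreement n d mx).Config :=
  stayed { C with mem := Function.update (reg C) x X } i { b with pending := none }

section

variable (C : (setAgreement n d mx).Config) (i : Fin n) (a : V) (L : List V) (b : Proposing V d)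
  (x : Fin (d + 1)) (X : Sixuplet V)

@[simp] theorem reg_returned : reg (returned C i a L) = reg C := rfl
@[simp] theorem sn_returned : (returned C i a L).sn = C.sn := rfl
@[simp] theorem dec_returned : (returned C i a L).dec =
    Function.update C.dec i (Function.update (C.dec i) (C.sn i) (some a)) := rfl
@[simp] theorem state_returned :
    state (returned C i a L) = Function.update (state C) i (Sum.inl L) := rfl
@[simp] theorem reg_stayed : reg (stayed C i b) = reg C := rfl
@[simp] theorem state_stayed :
    state (stayed C i b) = Function.update (state C) i (Sum.inr b) := rfl
@[simp] theorem reg_written : reg (written C i b x X) = Function.update (reg C) x X := rfl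
@[simp] theorem state_written : state (written C i b x X) =
    Function.update (state C) i (Sum.inr { b with pending := none }) := rfl

end

variable {C : (setAgreement n d mx).Config} {e : Fin n × V} {b : Proposing V d}

theorem step_idle {L : List V} (h : state C e.1 = Sum.inl L) :
    C.step e = invoked C e.1 e.2 L :=
  Config.step_of_idle h

theorem step_snapshot (h : state C e.1 = Sum.inr b) (hb : b.pending = none) :
    C.step e = C.settle e.1 (b.afterSnapshot mx (reg C)) := by
  obtain ⟨sn, val, dcd, pending⟩ := b
  subst hb
  exact Config.step_of_snapshot h rfl

theorem step_write {x : Fin (d + 1)} {X : Sixuplet V} (h : state C e.1 = Sum.inr b)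
    (hb : b.pending = some (x, X)) : C.step e = written C e.1 b x X := by
  obtain ⟨sn, val, dcd, pending⟩ := b
  subst hb
  exact Config.step_of_write h rfl

open Sixuplet Proposing

/-- All entries of the list `L`, whose entry number `j` stands for instance `j + 1`, have been
decided by some process. -/
def Recorded (C : (setAgreement n d mx).Config) (L : List V) : Prop :=
  ∀ j a, L[j]? = some a → ∃ i, C.dec i (j + 1) = some a

/-- The properties of a sixuplet that is written in a run. -/
structure Sound (C : (setAgreement n d mx).Config) (X : Sixuplet V) : Prop where
  eq_bottom : X.sn = 0 → X = Sixuplet.bottom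
  proposed : 1 ≤ X.sn → ∃ a j, X.val = (a : V) ∧ C.prop j X.sn = some a
  length : 1 ≤ X.sn → X.dcd.length + 1 = X.sn
  recorded : Recorded C X.dcd

/-- The properties of a process that is executing an operation. -/
structure SoundBusy (C : (setAgreement n d mx).Config) (i : Fin n) (b : Proposing V d) :
    Prop where
  sn_eq : b.sn = C.sn i
  length : b.dcd.length + 1 = b.sn
  prop : C.prop i b.sn = some b.val
  recorded : Recorded C b.dcd
  pending : ∀ x X, b.pending = some (x, X) → Sound C X ∧ X.sn = b.sn

/-- The properties of the local state of a process. -/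
def SoundState (C : (setAgreement n d mx).Config) (i : Fin n) : List V ⊕ Proposing V d → Prop
  | .inl L => L.length = C.sn i ∧ Recorded C L
  | .inr b => SoundBusy C i b

/-- The invariant of the runs. -/
structure Valid (C : (setAgreement n d mx).Config) : Prop where
  mem : ∀ x, Sound C (reg C x)
  state : ∀ i, SoundState C i (state C i)
  dec : ∀ i s a, C.dec i s = some a → ∃ j, C.prop j s = some a

/-- Proposals and decisions are never revoked. -/
structure Extends (C C' : (setAgreement n d mx).Config) : Prop where
  prop : ∀ i s a, C.prop i s = some a → C'.prop i s = some a
  dec : ∀ i s a, C.dec i s = some a → C'.dec i s = some a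

variable {C C' : (setAgreement n d mx).Config} {i : Fin n} {b : Proposing V d} {X : Sixuplet V}
  {L : List V} {a : V}

theorem Extends.of_step (hC : Reachable C) (e : Fin n × V) : Extends C (C.step e) :=
  ⟨fun _ _ _ => step_prop_of_some hC e, fun _ _ _ => step_dec_of_some hC e⟩

theorem Recorded.mono (hE : Extends C C') (hL : Recorded C L) : Recorded C' L := fun j a hj =>
  (hL j a hj).imp fun _ => hE.dec _ _ _

theorem Recorded.append (hL : Recorded C L) (ha : C.dec i (L.length + 1) = some a) :
    Recorded C (L ++ [a]) := by
  intro j c hj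
  rcases lt_trichotomy j L.length with h | rfl | h
  · rw [List.getElem?_append_left h] at hj
    exact hL j c hj
  · rw [List.getElem?_concat_length] at hj
    exact ⟨i, hj ▸ ha⟩
  · rw [List.getElem?_eq_none (by simpa using h)] at hj
    cases hj

theorem Sound.mono (hE : Extends C C') (hX : Sound C X) : Sound C' X where
  eq_bottom := hX.eq_bottom
  proposed hs :=
    let ⟨a, j, val_eq, prop_eq⟩ := hX.proposed hs
    ⟨a, j, val_eq, hE.prop _ _ _ prop_eq⟩
  length := hX.length
  recorded := hX.recorded.mono hE

theorem SoundBusy.mono (hE : Extends C C') (hs : C'.sn i = C.sn i) (hb : SoundBusy C i b) :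
    SoundBusy C' i b where
  sn_eq := hb.sn_eq.trans hs.symm
  length := hb.length
  prop := hE.prop _ _ _ hb.prop
  recorded := hb.recorded.mono hE
  pending x X hX := (hb.pending x X hX).imp_left (Sound.mono hE)

theorem SoundState.mono (hE : Extends C C') (hs : C'.sn i = C.sn i) {l : List V ⊕ Proposing V d}
    (hl : SoundState C i l) : SoundState C' i l :=
  match l, hl with
  | .inl _, hl => ⟨hl.1.trans hs.symm, hl.2.mono hE⟩
  | .inr _, hl => SoundBusy.mono hE hs hl

theorem SoundBusy.one_le (hb : SoundBusy C i b) : 1 ≤ b.sn := by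
  have := hb.length
  omega

theorem Valid.idle (hC : Valid C) (h : setAgreement.state C i = Sum.inl L) :
    L.length = C.sn i ∧ Recorded C L :=
  show SoundState C i (.inl L) from h ▸ hC.state i

theorem Valid.busy (hC : Valid C) (h : setAgreement.state C i = Sum.inr b) : SoundBusy C i b :=
  show SoundState C i (.inr b) from h ▸ hC.state i

theorem Valid.sound_candidates (hC : Valid C) (hb : SoundBusy C i b) :
    ∀ X ∈ b.candidates (reg C), Sound C X := by
  intro X hX
  rcases mem_candidates.1 hX with ⟨x, rfl⟩ | rfl
  · exact hC.mem x
  · exact ⟨fun h => absurd hb.one_le (by rw [show b.sn = 0 from h]; decide),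
      fun _ => ⟨b.val, i, rfl, hb.prop⟩, fun _ => hb.length, hb.recorded⟩

theorem Valid.sound_raised (hC : Valid C) (hb : SoundBusy C i b)
    (homogeneous : Homogeneous b.sn (reg C)) : Sound C (b.raised (reg C 0)) where
  eq_bottom h := absurd hb.one_le (by rw [show b.sn = 0 from h]; decide)
  proposed h := by
    obtain ⟨a, j, val_eq, prop⟩ := (hC.mem 0).proposed (homogeneous.2.1.symm ▸ h)
    exact ⟨a, j, val_eq, (congrArg (C.prop j) homogeneous.2.1).symm.trans prop⟩
  length _ := hb.length
  recorded := hb.recorded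

theorem Valid.sound_adopted (hmx : IsMaxRule mx) (hC : Valid C) (hb : SoundBusy C i b) :
    Sound C (b.adopted mx (reg C)) := by
  obtain ⟨Z, hZ, -, sn_eq, -, -, val_eq, dcd_eq⟩ :=
    exists_eq_sup hmx (b.candidates_ne_nil (reg C))
  have sound := hC.sound_candidates hb Z hZ
  have one_le := hb.one_le.trans (sn_le_sn_adopted hmx b (reg C))
  rw [adopted] at one_le ⊢
  exact ⟨fun h => by omega, fun h => sn_eq ▸ val_eq ▸ sound.proposed (sn_eq ▸ h),
    fun h => sn_eq ▸ dcd_eq ▸ sound.length (sn_eq ▸ h), dcd_eq ▸ sound.recorded⟩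

theorem Valid.sound_of_plans (hmx : IsMaxRule mx) (hC : Valid C) (hb : SoundBusy C i b)
    {x : Fin (d + 1)} (hX : b.Plans mx (reg C) x X) : Sound C X := by
  cases hX with
  | raise homogeneous _ => exact hC.sound_raised hb homogeneous
  | adopt _ _ => exact hC.sound_adopted hmx hb

/-- The possible events, as seen from the code of the algorithm: the activation of process `i`, with
proposal `a` if it is idle, leads to the global state given as last argument. -/
inductive Event (C : (setAgreement n d mx).Config) (i : Fin n) (a : V) :
    (setAgreement n d mx).Config → Prop
  | invoke (L : List V) (state : state C i = Sum.inl L) : Event C i a (invoked C i a L)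
  | decide (b : Proposing V d) (v : V) (r : ℕ) (state : state C i = Sum.inr b)
      (pending : b.pending = none) (one_le : 1 ≤ r)
      (unanimous : Situation.Unanimous (reg C) b.sn r true false v) :
      Event C i a (returned C i v (b.dcd ++ [v]))
  | copy (b : Proposing V d) (v : V) (x : Fin (d + 1)) (state : state C i = Sum.inr b)
      (pending : b.pending = none) (dcd : (reg C x).dcd[b.sn - 1]? = some v) :
      Event C i a (returned C i v (b.dcd ++ [v]))
  | plan (b : Proposing V d) (x : Fin (d + 1)) (X : Sixuplet V) (state : state C i = Sum.inr b)
      (pending : b.pending = none) (plans : b.Plans mx (reg C) x X) :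
      Event C i a (stayed C i { b with pending := some (x, X) })
  | write (b : Proposing V d) (x : Fin (d + 1)) (X : Sixuplet V) (state : state C i = Sum.inr b)
      (pending : b.pending = some (x, X)) : Event C i a (written C i b x X)

theorem Valid.event_snapshot (hmx : IsMaxRule mx) (hC : Valid C) (a : V)
    (state : setAgreement.state C i = Sum.inr b) (pending : b.pending = none) :
    Event C i a (C.settle i (b.afterSnapshot mx (reg C))) := by
  have hb := hC.busy state
  rcases b.afterSnapshot_cases hmx (reg C) with
    ⟨homogeneous, up, cfl, eq⟩ | ⟨sn_lt, eq⟩ | ⟨x, X, plans, eq⟩ <;> rw [eq]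
  · obtain ⟨v, j, val, -⟩ := (hC.mem 0).proposed (homogeneous.2.1 ▸ hb.one_le)
    have unanimous := homogeneous.unanimous
    rw [up, cfl, val] at unanimous
    rw [val]
    exact Event.decide b v _ state pending homogeneous.2.2 unanimous
  · obtain ⟨Z, hZ, -, sn_eq, -, -, -, dcd_eq⟩ :=
      exists_eq_sup hmx (b.candidates_ne_nil (reg C))
    rw [adopted, ← sn_eq] at sn_lt
    obtain ⟨x, rfl⟩ : ∃ x, reg C x = Z :=
      (mem_candidates.1 hZ).resolve_right fun h => absurd sn_lt (h ▸ lt_irrefl _)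
    have length := (hC.mem x).length (by omega)
    have entry := List.getElem?_eq_getElem
      (show b.sn - 1 < (reg C x).dcd.length by have := hb.one_le; omega)
    rw [adopted, ← dcd_eq, entry]
    exact Event.copy b _ x state pending entry
  · exact Event.plan b x X state pending plans

theorem Valid.event (hmx : IsMaxRule mx) (hC : Valid C) (e : Fin n × V) :
    Event C e.1 e.2 (C.step e) := by
  rcases state : setAgreement.state C e.1 with L | b
  · rw [step_idle state]
    exact Event.invoke L state
  · rcases pending : b.pending with _ | ⟨x, X⟩
    · rw [step_snapshot state pending]
      exact hC.event_snapshot hmx e.2 state pending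
    · rw [step_write state pending]
      exact Event.write b x X state pending

theorem Valid.copied (hC : Valid C) (state : setAgreement.state C i = Sum.inr b)
    {x : Fin (d + 1)} (dcd : (reg C x).dcd[b.sn - 1]? = some a) : ∃ j, C.dec j b.sn = some a := by
  have := (hC.mem x).recorded _ _ dcd
  rwa [Nat.sub_add_cancel (hC.busy state).one_le] at this

theorem Valid.of_sameAt (hC : Valid C) (hE : Extends C C') (same : ∀ j ≠ i, SameAt j C' C)
    (mem : ∀ x, Sound C' (reg C' x)) (state : SoundState C' i (setAgreement.state C' i))
    (dec : ∀ s a, C'.dec i s = some a → ∃ j, C'.prop j s = some a) : Valid C' where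
  mem := mem
  state j := by
    by_cases hj : j = i
    · exact hj ▸ state
    · have loc : setAgreement.state C' j = setAgreement.state C j := (same j hj).loc
      rw [loc]
      exact (hC.state j).mono hE (same j hj).sn
  dec j s a h := by
    by_cases hj : j = i
    · exact dec s a (hj ▸ h)
    · rw [(same j hj).dec] at h
      exact (hC.dec j s a h).imp fun _ => hE.prop _ _ _

theorem Valid.returned (hC : Valid C) (state : setAgreement.state C i = Sum.inr b)
    (proposed : ∃ j, C.prop j b.sn = some a)
    (hE : Extends C (setAgreement.returned C i a (b.dcd ++ [a]))) :
    Valid (setAgreement.returned C i a (b.dcd ++ [a])) := by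
  have hb := hC.busy state
  refine hC.of_sameAt (i := i) hE (fun j hj => sameAt_settle C hj _)
    (fun x => (hC.mem x).mono hE) ?_ fun s c hs => ?_
  · rw [state_returned, Function.update_self]
    refine ⟨?_, (hb.recorded.mono hE).append (i := i) ?_⟩
    · rw [List.length_append, List.length_singleton, hb.length, hb.sn_eq, sn_returned]
    · rw [dec_returned, hb.length, hb.sn_eq, Function.update_self, Function.update_self]
  · rw [dec_returned, Function.update_self] at hs
    by_cases h : s = C.sn i
    · rw [h, Function.update_self, Option.some_inj] at hs
      rw [h, ← hs, ← hb.sn_eq]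
      exact proposed
    · rw [Function.update_of_ne h] at hs
      exact hC.dec i s c hs

theorem Valid.stayed (hC : Valid C) (hb : SoundBusy C i b) :
    Valid (setAgreement.stayed C i b) := by
  have hE : Extends C (setAgreement.stayed C i b) := ⟨fun _ _ _ h => h, fun _ _ _ h => h⟩
  refine hC.of_sameAt (i := i) hE (fun j hj => sameAt_settle C hj _)
    (fun x => (hC.mem x).mono hE) ?_ fun s c => hC.dec i s c
  rw [state_stayed, Function.update_self]
  exact hb.mono hE rfl

theorem Valid.written (hC : Valid C) (state : setAgreement.state C i = Sum.inr b)
    {x : Fin (d + 1)} (pending : b.pending = some (x, X)) :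
    Valid (setAgreement.written C i b x X) := by
  have hb := hC.busy state
  let C' : (setAgreement n d mx).Config := { C with mem := Function.update (reg C) x X }
  have hE : Extends C C' := ⟨fun _ _ _ h => h, fun _ _ _ h => h⟩
  have hC' : Valid C' := by
    refine ⟨fun y => Sound.mono hE ?_, fun j => (hC.state j).mono hE rfl, hC.dec⟩
    change Sound C (Function.update (reg C) x X y)
    by_cases hy : y = x
    · rw [hy, Function.update_self]
      exact (hb.pending x X pending).1
    · rw [Function.update_of_ne hy]
      exact hC.mem y
  exact hC'.stayed (SoundBusy.mono hE rfl
    ⟨hb.sn_eq, hb.length, hb.prop, hb.recorded, fun _ _ h => nomatch h⟩)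

theorem Valid.invoked (hC : Valid C) (state : setAgreement.state C i = Sum.inl L)
    (hE : Extends C (setAgreement.invoked C i a L)) :
    Valid (setAgreement.invoked C i a L) := by
  obtain ⟨length, recorded⟩ := hC.idle state
  refine hC.of_sameAt (i := i) hE (fun j hj => ?_) (fun x => (hC.mem x).mono hE) ?_
    fun s c hs => (hC.dec i s c hs).imp fun _ => hE.prop _ _ _
  · obtain ⟨loc, sn, prop, dec⟩ := sameAt_settle (C.invoke i a) hj
      (.stay (⟨C.sn i + 1, a, L, none⟩ : Proposing V d) : Outcome V (List V) (Proposing V d))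
    exact ⟨loc, sn.trans (Function.update_of_ne hj _ _), prop.trans (Function.update_of_ne hj _ _),
      dec⟩
  · rw [setAgreement.invoked, state_stayed, Function.update_self]
    refine ⟨?_, congrArg (· + 1) length, ?_, recorded.mono hE, fun _ _ h => nomatch h⟩
    · exact (Function.update_self i (C.sn i + 1) C.sn).symm
    · change Function.update C.prop i _ i _ = some a
      rw [Function.update_self, Function.update_self]

theorem Valid.step (hmx : IsMaxRule mx) (hR : Reachable C) (hC : Valid C) (e : Fin n × V) :
    Valid (C.step e) := by
  have hE := Extends.of_step hR e
  have event := hC.event hmx e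
  generalize C.step e = C' at hE event ⊢
  revert hE
  cases event with
  | invoke L state => exact hC.invoked state
  | decide b v r state pending one_le unanimous =>
    obtain ⟨sn_eq, -, -, -, val⟩ := unanimous 0
    obtain ⟨a, j, val', prop⟩ := (hC.mem 0).proposed (sn_eq ▸ (hC.busy state).one_le)
    rw [← WithBot.coe_inj.1 (val.symm.trans val'), sn_eq] at prop
    exact hC.returned state ⟨j, prop⟩
  | copy b v x state pending dcd =>
    obtain ⟨j, dec⟩ := hC.copied state dcd
    exact hC.returned state (hC.dec _ _ _ dec)
  | plan b x X state pending plans =>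
    have hb := hC.busy state
    refine fun _ => hC.stayed ⟨hb.sn_eq, hb.length, hb.prop, hb.recorded, fun y Y h => ?_⟩
    obtain ⟨-, rfl⟩ := Prod.mk.inj (Option.some_inj.1 h)
    exact ⟨hC.sound_of_plans hmx hb plans, plans.sn_eq⟩
  | write b x X state pending => exact fun _ => hC.written state pending

theorem valid_first : Valid (setAgreement n d mx).first where
  mem _ := ⟨fun _ => rfl, fun h => absurd h (Nat.not_succ_le_zero 0),
    fun h => absurd h (Nat.not_succ_le_zero 0), fun _ _ h => nomatch h⟩
  state _ := ⟨rfl, fun _ _ h => nomatch h⟩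
  dec _ _ _ h := nomatch h

theorem valid_of_reachable (hmx : IsMaxRule mx) (hR : Reachable C) : Valid C :=
  hR.induction (p := Valid) valid_first fun _ e hR hC => hC.step hmx hR e

theorem validity (hmx : IsMaxRule mx) : (setAgreement n d mx).Validity := fun σ t =>
  (valid_of_reachable hmx (reachable_run σ t)).dec

end setAgreement

theorem Proposing.Plans.fresh {V : Type u} [LinearOrder V] {d : ℕ}
    {mx : List (Sixuplet V) → Sixuplet V} (hmx : Sixuplet.IsMaxRule mx) {b : Proposing V d}
    {view : Fin (d + 1) → Sixuplet V} {x : Fin (d + 1)} {X : Sixuplet V}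
    (h : b.Plans mx view x X) (s : ℕ) : Situation.Fresh s view X := by
  rcases lt_trichotomy X.sn s with sn_lt | rfl | lt_sn
  · refine .earlier sn_lt fun y => ?_
    cases h with
    | raise homogeneous => exact (homogeneous.unanimous y).1 ▸ sn_lt
    | adopt =>
      have := Sixuplet.lt_or_absorbs_sup hmx (b.view_mem_candidates view y)
      rw [adopted] at sn_lt
      omega
  · cases h with
    | raise homogeneous not_up =>
      exact .raise _ _ _ _ homogeneous.2.2 homogeneous.unanimous not_up rfl rfl rfl rfl
    | adopt =>
      refine .adopt rfl
        (fun y => Sixuplet.lt_or_absorbs_sup hmx (b.view_mem_candidates view y)) ?_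
      obtain ⟨Z, hZ, -, sn_eq, rd_eq, up_eq, val_eq, -⟩ :=
        Sixuplet.exists_eq_sup hmx (b.candidates_ne_nil view)
      rcases mem_candidates.1 hZ with ⟨y, rfl⟩ | rfl
      · exact Or.inr ⟨y, sn_eq, rd_eq, up_eq, val_eq⟩
      · exact Or.inl ⟨rd_eq.symm, up_eq.symm⟩
  · exact .later lt_sn

namespace setAgreement

open Protocol

variable {V : Type u} [LinearOrder V] {n d k s : ℕ} {mx : List (Sixuplet V) → Sixuplet V}
  {C C' : (setAgreement n d mx).Config} {i : Fin n} {b : Proposing V d} {a : V}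

/-- The sixuplet that a process is about to write. -/
def pendingOf (C : (setAgreement n d mx).Config) (i : Fin n) : Option (Sixuplet V) :=
  (state C i).elim (fun _ => none) fun b => b.pending.map Prod.snd

/-- A global state from the point of view of instance `s`. -/
def situation (s : ℕ) (C : (setAgreement n d mx).Config) : Situation V n d :=
  ⟨reg C, pendingOf C, fun i => C.dec i s⟩

theorem pendingOf_of_idle {L : List V} (h : state C i = Sum.inl L) : pendingOf C i = none := by
  rw [pendingOf, h, Sum.elim_inl]

theorem pendingOf_of_busy (h : state C i = Sum.inr b) :
    pendingOf C i = b.pending.map Prod.snd := by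
  rw [pendingOf, h, Sum.elim_inr]

theorem pendingOf_of_pending_eq_none (h : state C i = Sum.inr b) (hb : b.pending = none) :
    pendingOf C i = none := by
  rw [pendingOf_of_busy h, hb, Option.map_none]

theorem pendingOf_stayed : pendingOf (stayed C i b) =
    Function.update (pendingOf C) i (b.pending.map Prod.snd) := by
  funext j
  by_cases hj : j = i
  · rw [hj, Function.update_self, pendingOf, state_stayed, Function.update_self, Sum.elim_inr]
  · rw [Function.update_of_ne hj, pendingOf, state_stayed, Function.update_of_ne hj, pendingOf]

theorem pendingOf_returned (C : (setAgreement n d mx).Config) (i : Fin n) (a : V) (L : List V) :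
    pendingOf (returned C i a L) = Function.update (pendingOf C) i none := by
  funext j
  by_cases hj : j = i
  · rw [hj, Function.update_self, pendingOf, state_returned, Function.update_self, Sum.elim_inl]
  · rw [Function.update_of_ne hj, pendingOf, state_returned, Function.update_of_ne hj, pendingOf]

theorem situation_invoked {L : List V} (h : state C i = Sum.inl L) :
    situation s (invoked C i a L) = situation s C := by
  have pend_eq : pendingOf (invoked C i a L) = pendingOf C :=
    pendingOf_stayed.trans (Function.update_eq_self_iff.2 (pendingOf_of_idle h).symm)
  rw [situation, pend_eq]
  rfl

theorem situation_returned_self {L : List V} (h : pendingOf C i = none) :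
    situation (C.sn i) (returned C i a L) = (situation (C.sn i) C).decide i a := by
  rw [situation, pendingOf_returned, ← h, Function.update_eq_self, reg_returned, dec_returned,
    Situation.decide, situation, Situation.mk.injEq]
  refine ⟨rfl, rfl, ?_⟩
  funext j
  by_cases hj : j = i
  · rw [hj, Function.update_self, Function.update_self, Function.update_self]
  · rw [Function.update_of_ne hj, Function.update_of_ne hj]

theorem situation_returned_of_ne {L : List V} (h : pendingOf C i = none) (hs : s ≠ C.sn i) :
    situation s (returned C i a L) = situation s C := by
  rw [situation, pendingOf_returned, ← h, Function.update_eq_self, reg_returned, dec_returned,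
    situation, Situation.mk.injEq]
  refine ⟨rfl, rfl, ?_⟩
  funext j
  by_cases hj : j = i
  · rw [hj, Function.update_self, Function.update_of_ne hs]
  · rw [Function.update_of_ne hj]

theorem situation_announced (x : Fin (d + 1)) (X : Sixuplet V) :
    situation s (stayed C i { b with pending := some (x, X) }) = (situation s C).announce i X := by
  rw [situation, pendingOf_stayed]
  rfl

theorem situation_written (x : Fin (d + 1)) (X : Sixuplet V) :
    situation s (written C i b x X) = (situation s C).write i x X := by
  rw [situation, written, pendingOf_stayed]
  rfl

theorem lt_sn_of_dec_ne_none (hR : Reachable C) (hC : Valid C) (h : state C i = Sum.inr b)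
    (hs : C.dec i s ≠ none) : s < b.sn := by
  have loc : C.loc i = Sum.inr b := h
  rw [(hR.history i).dec_iff, loc, ← (hC.busy h).sn_eq] at hs
  exact hs.2.resolve_right fun h => Bool.noConfusion h.2

theorem move_situation (hmx : Sixuplet.IsMaxRule mx) (hR : Reachable C) (e : Fin n × V) (s : ℕ) :
    Situation.Move s (situation s C) (situation s (C.step e)) := by
  have hC := valid_of_reachable hmx hR
  have event := hC.event hmx e
  generalize C.step e = C' at event ⊢
  cases event with
  | invoke L state =>
    rw [situation_invoked state]
    exact .idle
  | decide b v r state pending one_le unanimous =>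
    have pend := pendingOf_of_pending_eq_none state pending
    by_cases hs : s = C.sn e.1
    · subst hs
      rw [situation_returned_self pend]
      exact .decide e.1 v r one_le pend ((hC.busy state).sn_eq ▸ unanimous)
    · rw [situation_returned_of_ne pend hs]
      exact .idle
  | copy b v x state pending dcd =>
    have pend := pendingOf_of_pending_eq_none state pending
    by_cases hs : s = C.sn e.1
    · subst hs
      obtain ⟨j, dec⟩ := hC.copied state dcd
      rw [situation_returned_self pend]
      exact .copy e.1 j v pend ((hC.busy state).sn_eq ▸ dec)
    · rw [situation_returned_of_ne pend hs]
      exact .idle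
  | plan b x X state _ plans =>
    rw [situation_announced]
    exact .announce e.1 X (plans.fresh hmx s) fun dec =>
      plans.sn_eq ▸ lt_sn_of_dec_ne_none hR hC state dec
  | write b x X state pending =>
    rw [situation_written]
    exact .write e.1 x X ((pendingOf_of_busy state).trans (congrArg (Option.map Prod.snd) pending))

theorem safe_situation (hmx : Sixuplet.IsMaxRule mx) (hs : 1 ≤ s) (hk : 1 ≤ k) (hn : n ≤ k + d)
    (hR : Reachable C) : (situation s C).Safe s k :=
  hR.induction (p := fun C => (situation s C).Safe s k)
    (Situation.safe_of_quiescent hs hk (fun _ => rfl) (fun _ => rfl) fun _ => rfl)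
    fun _ e hR hC => (move_situation hmx hR e s).safe hn hC

theorem agreement (hmx : Sixuplet.IsMaxRule mx) (hk : 1 ≤ k) (hn : n ≤ k + d) :
    (setAgreement n d mx).Agreement k := by
  refine agreement_of_reachable fun C hR s => ?_
  rcases Nat.eq_zero_or_pos s with rfl | hs
  · have no_decision : {a | ∃ i, C.dec i 0 = some a} = ∅ := by
      refine Set.eq_empty_of_forall_notMem fun a ⟨i, dec⟩ => Nat.not_succ_le_zero 0 ?_
      exact (((hR.history i).dec_iff 0).1 (dec ▸ Option.some_ne_none a)).1
    rw [no_decision, Set.encard_empty]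
    exact zero_le
  · exact (safe_situation hmx hs hk hn hR).agreement

end setAgreement

/-! ### Termination of solo executions -/

namespace Sixuplet

variable {V : Type u} [LinearOrder V] {mx : List (Sixuplet V) → Sixuplet V}
  {T T' : List (Sixuplet V)} {X : Sixuplet V}

theorem key_sup_eq (hmx : IsMaxRule mx) (hX : X ∈ T) (key_le : ∀ Y ∈ T, Y.key ≤ X.key)
    (absorbs : ∀ Y ∈ T, Y.sn = X.sn → Y.rd = X.rd → Situation.Absorbs X Y) :
    (sup mx T).key = X.key := by
  obtain ⟨Z, hZ, le_key, sn_eq, rd_eq, up_eq, val_eq, -⟩ :=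
    exists_eq_sup hmx (List.ne_nil_of_mem hX)
  obtain ⟨sn_eq', rd_eq', up_eq', -, val_eq'⟩ :=
    key_eq_iff.1 (le_antisymm (key_le Z hZ) (le_key X hX))
  rw [sn_eq'] at sn_eq
  rw [rd_eq'] at rd_eq
  rw [val_eq'] at val_eq
  refine key_eq_iff.2 ⟨sn_eq.symm, rd_eq.symm, up_eq.symm.trans up_eq', ?_, val_eq.symm⟩
  rw [Bool.eq_iff_iff, sup_cfl_iff hmx (List.ne_nil_of_mem hX), ← sn_eq, ← rd_eq, ← val_eq]
  constructor
  · rintro ⟨Y, hY, Y_sn, Y_rd, conflict⟩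
    obtain ⟨-, cfl, val⟩ := absorbs Y hY Y_sn Y_rd
    exact conflict.elim cfl val
  · exact fun cfl => ⟨X, hX, rfl, rfl, Or.inl cfl⟩

theorem key_sup_eq_key_sup (hmx : IsMaxRule mx) (mem : sup mx T ∈ T')
    (subset : ∀ X ∈ T', X = sup mx T ∨ X ∈ T) : (sup mx T').key = (sup mx T).key := by
  refine key_sup_eq hmx mem (fun Y hY => ?_) fun Y hY sn_eq rd_eq => ?_
  · rcases subset Y hY with rfl | hY
    · exact le_rfl
    · exact key_le_sup hmx hY
  · rcases subset Y hY with rfl | hY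
    · exact ⟨id, id, fun h => absurd rfl h⟩
    · have := lt_or_absorbs_sup hmx hY
      simpa only [sn_eq, rd_eq, lt_irrefl, true_and, false_or] using this

end Sixuplet

namespace Proposing

open Sixuplet

variable {V : Type u} {d : ℕ} {b : Proposing V d} {view : Fin (d + 1) → Sixuplet V}
  {x : Fin (d + 1)} {X : Sixuplet V}

/-- The number of rounds that a process running solo starts after it has written `X` into all the
registers. -/
def rounds (X : Sixuplet V) : ℕ := if X.cfl then 2 else if X.up then 0 else 1

theorem rounds_congr {Y : Sixuplet V} (h : X.key = Y.key) :
    rounds X = rounds Y := by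
  obtain ⟨-, -, up_eq, cfl_eq, -⟩ := key_eq_iff.1 h
  rw [rounds, rounds, up_eq, cfl_eq]

theorem rounds_raised (not_up : X.cfl = false → X.up = false) :
    rounds (b.raised X) + 1 = rounds X := by
  rw [rounds, rounds, raised]
  cases cfl : X.cfl
  · simp [not_up cfl]
  · simp

theorem candidates_update_cases {Y : Sixuplet V}
    (hY : Y ∈ b.candidates (Function.update view x X)) :
    Y = X ∨ (∃ y ≠ x, view y = Y) ∨ Y = b.entry := by
  rcases mem_candidates.1 hY with ⟨y, rfl⟩ | h
  · by_cases hy : y = x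
    · exact Or.inl (by rw [hy, Function.update_self])
    · exact Or.inr (Or.inl ⟨y, hy, (Function.update_of_ne hy X view).symm⟩)
  · exact Or.inr (Or.inr h)

variable [LinearOrder V] {mx : List (Sixuplet V) → Sixuplet V}

open Classical in
/-- The sixuplet that a process running solo is writing into all the registers. -/
noncomputable def target (mx : List (Sixuplet V) → Sixuplet V) (b : Proposing V d)
    (view : Fin (d + 1) → Sixuplet V) : Sixuplet V :=
  if Homogeneous b.sn view then view 0 else b.adopted mx view

open Classical in
/-- The number of registers that differ from `X` in one of their first five fields. -/
noncomputable def distance (X : Sixuplet V) (view : Fin (d + 1) → Sixuplet V) : ℕ :=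
  (Finset.univ.filter fun x => (view x).key ≠ X.key).card

/-- Bounds the number of writes of a process running solo until it decides. -/
noncomputable def measure (mx : List (Sixuplet V) → Sixuplet V) (b : Proposing V d)
    (view : Fin (d + 1) → Sixuplet V) : ℕ :=
  rounds (b.target mx view) * (d + 2) + distance (b.target mx view) view

theorem distance_le (X : Sixuplet V) (view : Fin (d + 1) → Sixuplet V) :
    distance X view ≤ d + 1 :=
  (Finset.card_filter_le _ _).trans_eq (Finset.card_fin _)

theorem distance_update_lt {Y : Sixuplet V} (hx : (view x).key ≠ X.key) (hY : Y.key = X.key) :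
    distance Y (Function.update view x X) < distance X view := by
  rw [distance, distance, hY]
  refine Finset.card_lt_card (Finset.ssubset_iff_of_subset (fun y hy => ?_) |>.2 ⟨x, ?_, ?_⟩)
  · rw [Finset.mem_filter_univ] at hy ⊢
    by_cases hyx : y = x
    · exact hyx ▸ hx
    · rwa [Function.update_of_ne hyx] at hy
  · exact (Finset.mem_filter_univ _).2 hx
  · rw [Finset.mem_filter_univ, Function.update_self]
    exact not_not_intro rfl

theorem key_adopted_update_raised (hmx : IsMaxRule mx) (h : Homogeneous b.sn view) :
    (b.adopted mx (Function.update view 0 (b.raised (view 0)))).key =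
      (b.raised (view 0)).key := by
  have lower : ∀ Y ∈ b.candidates (Function.update view 0 (b.raised (view 0))),
      Y = b.raised (view 0) ∨ Y.sn = b.sn ∧ Y.rd < (view 0).rd + 1 := fun Y hY => by
    rcases candidates_update_cases hY with rfl | ⟨y, -, rfl⟩ | rfl
    · exact Or.inl rfl
    · obtain ⟨sn_eq, rd_eq, -⟩ := h.unanimous y
      exact Or.inr ⟨sn_eq, rd_eq ▸ Nat.lt_succ_self _⟩
    · exact Or.inr ⟨rfl, Nat.succ_lt_succ h.2.2⟩
  have mem := view_mem_candidates b (Function.update view 0 (b.raised (view 0))) 0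
  rw [Function.update_self] at mem
  refine key_sup_eq hmx mem (fun Y hY => ?_) fun Y hY _ rd_eq => ?_
  · rcases lower Y hY with rfl | ⟨sn_eq, rd_lt⟩
    · exact le_rfl
    · exact key_le_iff.2 (Or.inr ⟨sn_eq, Or.inl rd_lt⟩)
  · rcases lower Y hY with rfl | ⟨-, rd_lt⟩
    · exact ⟨id, id, fun h => absurd rfl h⟩
    · exact absurd rd_eq rd_lt.ne

theorem key_adopted_update_adopted (hmx : IsMaxRule mx) :
    (b.adopted mx (Function.update view x (b.adopted mx view))).key =
      (b.adopted mx view).key := by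
  have mem := view_mem_candidates b (Function.update view x (b.adopted mx view)) x
  rw [Function.update_self] at mem
  refine key_sup_eq_key_sup hmx mem fun Y hY => ?_
  rcases candidates_update_cases hY with h | ⟨y, -, rfl⟩ | rfl
  · exact Or.inl h
  · exact Or.inr (view_mem_candidates b view y)
  · exact Or.inr (entry_mem_candidates b view)

theorem Plans.key_target_update (hmx : IsMaxRule mx) (h : b.Plans mx view x X) :
    (b.target mx (Function.update view x X)).key = X.key := by
  rw [target]
  split_ifs with homogeneous'
  · rw [← homogeneous'.1 x, Function.update_self]
  · cases h with
    | raise homogeneous => exact key_adopted_update_raised hmx homogeneous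
    | adopt => exact key_adopted_update_adopted hmx

theorem key_minIndex_ne (hmx : IsMaxRule mx) (not_homogeneous : ¬ Homogeneous b.sn view)
    (sn_eq : (b.adopted mx view).sn = b.sn) :
    (view (minIndex view)).key ≠ (b.adopted mx view).key := by
  intro min_eq
  have key_eq : ∀ x, (view x).key = (b.adopted mx view).key := fun x =>
    le_antisymm (key_le_sup hmx (view_mem_candidates b view x)) (min_eq ▸ key_minIndex_le view x)
  obtain ⟨sn_eq', rd_eq, -⟩ := key_eq_iff.1 (key_eq 0)
  have entry_sn : b.entry.sn = b.sn := rfl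
  have entry_rd : b.entry.rd = 1 := rfl
  have entry_le := lt_or_absorbs_sup hmx (entry_mem_candidates b view)
  rw [adopted] at *
  exact not_homogeneous ⟨fun x => (key_eq x).trans (key_eq 0).symm, sn_eq'.trans sn_eq, by omega⟩

theorem Plans.measure_lt (hmx : IsMaxRule mx) (h : b.Plans mx view x X) :
    b.measure mx (Function.update view x X) < b.measure mx view := by
  have key_target := h.key_target_update hmx
  rw [measure, measure, rounds_congr key_target]
  cases h with
  | raise homogeneous not_up =>
    rw [show b.target mx view = view 0 from if_pos homogeneous, ← rounds_raised (b := b) not_up,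
      Nat.add_mul]
    have := distance_le (b.target mx (Function.update view 0 (b.raised (view 0))))
      (Function.update view 0 (b.raised (view 0)))
    omega
  | adopt not_homogeneous sn_eq =>
    rw [show b.target mx view = b.adopted mx view from if_neg not_homogeneous]
    exact Nat.add_lt_add_left
      (distance_update_lt (key_minIndex_ne hmx not_homogeneous sn_eq) key_target) _

end Proposing

namespace setAgreement

open Protocol

variable {V : Type u} [LinearOrder V] {n d : ℕ} {mx : List (Sixuplet V) → Sixuplet V}
  {C : (setAgreement n d mx).Config} {i : Fin n} {a : V} {b : Proposing V d}

theorem exists_idle_of_pending_eq_none (hmx : Sixuplet.IsMaxRule mx) (hR : Reachable C)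
    (state : setAgreement.state C i = Sum.inr b) (pending : b.pending = none) :
    ∃ t, ((C.exec (solo i a t)).loc i).isLeft := by
  induction hN : b.measure mx (reg C) using Nat.strong_induction_on generalizing C with
  | _ N ih =>
    have event := (valid_of_reachable hmx hR).event hmx (i, a)
    generalize step : C.step (i, a) = C' at event
    have idle_of_returned {v L} (h : C' = returned C i v L) :
        ∃ t, ((C.exec (solo i a t)).loc i).isLeft := by
      refine ⟨1, ?_⟩
      change (setAgreement.state (C.step (i, a)) i).isLeft
      rw [step, h, state_returned, Function.update_self, Sum.isLeft_inl]
    cases event with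
    | invoke L idle => exact nomatch state.symm.trans idle
    | decide => exact idle_of_returned rfl
    | copy => exact idle_of_returned rfl
    | write b' x X state' writing =>
      obtain rfl := Sum.inr.inj (state.symm.trans state')
      exact nomatch pending.symm.trans writing
    | plan b' x X state' _ plans =>
      obtain rfl := Sum.inr.inj (state.symm.trans state')
      have planned : setAgreement.state (C.step (i, a)) i =
          Sum.inr { b with pending := some (x, X) } := by
        rw [step, state_stayed, Function.update_self]
      have write := step_write (e := (i, a)) planned rfl
      obtain ⟨t, idle⟩ := ih _ (hN ▸ plans.measure_lt hmx) ((hR.step (i, a)).step (i, a))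
        (by rw [write, state_written, Function.update_self, ← pending])
        (by rw [write, step, reg_written, reg_stayed])
      exact ⟨2 + t, by rwa [exec_solo_add]⟩

theorem exists_idle (hmx : Sixuplet.IsMaxRule mx) (hR : Reachable C) (i : Fin n) (a : V) :
    ∃ t, ((C.exec (solo i a t)).loc i).isLeft := by
  rcases state : setAgreement.state C i with L | b
  · exact ⟨0, congrArg Sum.isLeft state⟩
  · rcases pending : b.pending with _ | ⟨x, X⟩
    · exact exists_idle_of_pending_eq_none hmx hR state pending
    · have state' : setAgreement.state (C.step (i, a)) i = Sum.inr { b with pending := none } := by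
        rw [step_write (e := (i, a)) state pending, state_written, Function.update_self]
      obtain ⟨t, idle⟩ :=
        exists_idle_of_pending_eq_none (a := a) hmx (hR.step (i, a)) state' rfl
      exact ⟨1 + t, by rwa [exec_solo_add]⟩

theorem obTermination (hmx : Sixuplet.IsMaxRule mx) : (setAgreement n d mx).OBTermination :=
  obTermination_iff_exists_idle.2 fun _ hR i a => exists_idle hmx hR i a

end setAgreement

/-! ### Termination when a single value is proposed -/

section

open Filter

theorem eventually_frequently_eq {α : Type*} [Finite α] (f : ℕ → α) :
    ∀ᶠ t in atTop, ∃ᶠ u in atTop, f u = f t := by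
  have h : ∀ᶠ t in atTop, ∀ a, f t = a → ∃ᶠ u in atTop, f u = a := eventually_all.2 fun a => by
    by_cases ha : ∃ᶠ u in atTop, f u = a
    · exact Eventually.of_forall fun _ _ => ha
    · exact (not_frequently.1 ha).mono fun t ht h => absurd h ht
  exact h.mono fun t ht => ht _ rfl

theorem exists_eventually_iff_of_succ {p : ℕ → Prop} (h : ∀ᶠ t in atTop, p t → p (t + 1)) :
    ∃ q, ∀ᶠ t in atTop, p t ↔ q := by
  by_cases frequently : ∃ᶠ t in atTop, p t
  · obtain ⟨T, hT⟩ := eventually_atTop.1 h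
    obtain ⟨t₀, ht₀, hp⟩ := frequently_atTop.1 frequently T
    refine ⟨True, eventually_atTop.2 ⟨t₀, fun t ht => iff_true_intro ?_⟩⟩
    induction t, ht using Nat.le_induction with
    | base => exact hp
    | succ t ht ih => exact hT t (ht₀.trans ht) ih
  · exact ⟨False, (not_frequently.1 frequently).mono fun t => iff_false_intro⟩

end

namespace Sixuplet

variable {V : Type u} {s : ℕ} {X Y : Sixuplet V}

/-- The form of the sixuplets of the instances up to `s` when a single value is proposed to each
of these instances: there are no conflicts, hence processes decide at the end of round 2. -/
def Tame (s : ℕ) (X : Sixuplet V) : Prop :=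
  X.sn ≤ s → X.cfl = false ∧ (X = bottom ∨ 1 ≤ X.sn ∧ X.rd = 1 + X.up.toNat)

/-- The progress of an execution in which a single value is proposed to the instances up to `s`. -/
def rank (s : ℕ) (X : Sixuplet V) : ℕ :=
  if s < X.sn then 2 * s + 2 else 2 * X.sn + X.up.toNat

theorem rank_of_lt (h : s < X.sn) : X.rank s = 2 * s + 2 := if_pos h

theorem rank_of_le (h : X.sn ≤ s) : X.rank s = 2 * X.sn + X.up.toNat := if_neg (not_lt.2 h)

theorem rank_lt_iff : X.rank s < 2 * s + 2 ↔ X.sn ≤ s := by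
  have := Bool.toNat_le X.up
  rw [rank]
  split_ifs <;> omega

theorem rank_le (s : ℕ) (X : Sixuplet V) : X.rank s ≤ 2 * s + 2 := by
  by_cases h : s < X.sn
  · exact (rank_of_lt h).le
  · exact (rank_lt_iff.2 (not_lt.1 h)).le

theorem toNat_injective : Function.Injective Bool.toNat := by decide

theorem Tame.rd_eq_iff (hX : Tame s X) (hY : Tame s Y) (sn_le : X.sn ≤ s) (sn_eq : X.sn = Y.sn) :
    X.rd = Y.rd ↔ X.up = Y.up := by
  rcases (hX sn_le).2 with rfl | ⟨one_le, X_rd⟩ <;>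
    rcases (hY (sn_eq ▸ sn_le)).2 with rfl | ⟨one_le', Y_rd⟩
  · exact iff_of_true rfl rfl
  · exact absurd one_le' (sn_eq ▸ Nat.not_succ_le_zero 0)
  · exact absurd one_le (sn_eq ▸ Nat.not_succ_le_zero 0)
  · rw [X_rd, Y_rd, Nat.add_left_cancel_iff, toNat_injective.eq_iff]

theorem Tame.key_eq_of_rank_eq (hX : Tame s X) (hY : Tame s Y) (sn_le : X.sn ≤ s)
    (rank_eq : X.rank s = Y.rank s) (val_eq : X.sn = Y.sn → X.val = Y.val) : X.key = Y.key := by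
  have sn_le' := rank_lt_iff.1 (rank_eq ▸ rank_lt_iff.2 sn_le)
  rw [rank_of_le sn_le, rank_of_le sn_le'] at rank_eq
  have := Bool.toNat_le X.up
  have := Bool.toNat_le Y.up
  have sn_eq : X.sn = Y.sn := by omega
  have up_eq : X.up = Y.up := toNat_injective (by omega)
  exact key_eq_iff.2 ⟨sn_eq, (hX.rd_eq_iff hY sn_le sn_eq).2 up_eq, up_eq,
    (hX sn_le).1.trans (hY sn_le').1.symm, val_eq sn_eq⟩

theorem Tame.rank_le_rank [LinearOrder V] (hX : Tame s X) (hY : Tame s Y) (h : X.key ≤ Y.key) :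
    X.rank s ≤ Y.rank s := by
  by_cases lt_sn : s < Y.sn
  · exact (rank_of_lt lt_sn).symm ▸ rank_le s X
  have key_le := key_le_iff.1 h
  have sn_le : X.sn ≤ s := by omega
  rw [rank_of_le (not_lt.1 lt_sn), rank_of_le sn_le]
  rcases key_le with sn_lt | ⟨sn_eq, key_le⟩
  · have := Bool.toNat_le X.up
    omega
  · have rd_eq_iff := hX.rd_eq_iff hY sn_le sn_eq
    suffices X.up ≤ Y.up by
      rw [sn_eq]
      exact Nat.add_le_add_left (Bool.toNat_le_toNat this) _
    rcases key_le with rd_lt | ⟨rd_eq, -⟩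
    · rcases (hX sn_le).2 with rfl | ⟨one_le, X_rd⟩
      · exact Bool.false_le _
      · rcases (hY (not_lt.1 lt_sn)).2 with rfl | ⟨-, Y_rd⟩
        · exact absurd one_le (sn_eq ▸ Nat.not_succ_le_zero 0)
        · rw [X_rd, Y_rd] at rd_lt
          cases X_up : X.up
          · exact Bool.false_le _
          · have := Bool.toNat_le Y.up
            rw [X_up, Bool.toNat_true] at rd_lt
            omega
    · exact (rd_eq_iff.1 rd_eq).le

end Sixuplet

theorem Proposing.Plans.view_sn_le {V : Type u} [LinearOrder V] {d : ℕ}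
    {mx : List (Sixuplet V) → Sixuplet V} (hmx : Sixuplet.IsMaxRule mx) {b : Proposing V d}
    {view : Fin (d + 1) → Sixuplet V} {x : Fin (d + 1)} {X : Sixuplet V}
    (h : b.Plans mx view x X) (y : Fin (d + 1)) : (view y).sn ≤ b.sn := by
  cases h with
  | raise homogeneous => exact (homogeneous.unanimous y).1.le
  | adopt _ sn_eq =>
    exact sn_eq ▸ (Sixuplet.lt_or_absorbs_sup hmx (view_mem_candidates b view y)).elim le_of_lt
      fun h => h.1.le

theorem Proposing.Plans.key_view_le {V : Type u} [LinearOrder V] {d : ℕ}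
    {mx : List (Sixuplet V) → Sixuplet V} {b : Proposing V d}
    {view : Fin (d + 1) → Sixuplet V} {x : Fin (d + 1)} {X : Sixuplet V}
    (h : b.Plans mx view x X) (y : Fin (d + 1)) : (view x).key ≤ (view y).key := by
  cases h with
  | raise homogeneous => exact (homogeneous.1 y).ge
  | adopt => exact Sixuplet.key_minIndex_le view y

namespace setAgreement

open Filter Protocol Sixuplet Proposing

variable {V : Type u} [LinearOrder V] {n d s l : ℕ} {mx : List (Sixuplet V) → Sixuplet V}
  {C : (setAgreement n d mx).Config} {i : Fin n} {b : Proposing V d} {x : Fin (d + 1)}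
  {X Y : Sixuplet V}

/-- At most one value has been proposed to each instance up to `s`. -/
def Uncontested (s : ℕ) (C : (setAgreement n d mx).Config) : Prop :=
  ∀ r, r ≤ s → ∀ i j a b, C.prop i r = some a → C.prop j r = some b → a = b

/-- The sixuplets that are in the registers or about to be written are tame. -/
structure AllTame (s : ℕ) (C : (setAgreement n d mx).Config) : Prop where
  mem : ∀ x, Tame s (reg C x)
  pend : ∀ i X, pendingOf C i = some X → Tame s X

theorem Uncontested.val_eq (hC : Uncontested s C) (hX : Sound C X) (hY : Sound C Y)
    (sn_le : X.sn ≤ s) (sn_eq : X.sn = Y.sn) : X.val = Y.val := by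
  rcases Nat.eq_zero_or_pos X.sn with sn_zero | sn_pos
  · rw [hX.eq_bottom sn_zero, hY.eq_bottom (sn_eq ▸ sn_zero)]
  · obtain ⟨a, i, val_eq, prop⟩ := hX.proposed sn_pos
    obtain ⟨a', i', val_eq', prop'⟩ := hY.proposed (sn_eq ▸ sn_pos)
    rw [val_eq, val_eq', hC _ sn_le i i' a a' prop (sn_eq ▸ prop')]

theorem Valid.plans_of_pendingOf_step (hmx : IsMaxRule mx) (hC : Valid C) (e : Fin n × V)
    (h : pendingOf (C.step e) e.1 = some X) :
    ∃ b x, setAgreement.state C e.1 = Sum.inr b ∧ b.Plans mx (reg C) x X := by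
  have event := hC.event hmx e
  generalize C.step e = C' at event h
  cases event with
  | invoke =>
    rw [setAgreement.invoked, pendingOf_stayed, Function.update_self] at h
    exact nomatch h
  | decide | copy =>
    rw [pendingOf_returned, Function.update_self] at h
    exact nomatch h
  | write =>
    rw [setAgreement.written, pendingOf_stayed, Function.update_self] at h
    exact nomatch h
  | plan b x Y state _ plans =>
    rw [pendingOf_stayed, Function.update_self, Option.map_some, Option.some_inj] at h
    exact ⟨b, x, state, h ▸ plans⟩

theorem pendingOf_step_of_ne (C : (setAgreement n d mx).Config) {e : Fin n × V} (h : i ≠ e.1) :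
    pendingOf (C.step e) i = pendingOf C i :=
  congrArg (Sum.elim (fun _ => none) fun b : Proposing V d => b.pending.map Prod.snd)
    (sameAt_step C e h).loc

theorem Valid.reg_step (hmx : IsMaxRule mx) (hC : Valid C) (e : Fin n × V) :
    reg (C.step e) = reg C ∨ ∃ x X, pendingOf C e.1 = some X ∧
      reg (C.step e) = Function.update (reg C) x X := by
  have event := hC.event hmx e
  generalize C.step e = C' at event ⊢
  cases event with
  | write b x X state pending =>
    exact Or.inr ⟨x, X, (pendingOf_of_busy state).trans (by rw [pending, Option.map_some]), rfl⟩
  | _ => exact Or.inl rfl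

theorem SoundBusy.tame_entry (hb : SoundBusy C i b) : Tame s b.entry :=
  fun _ => ⟨rfl, Or.inr ⟨hb.one_le, rfl⟩⟩

theorem AllTame.candidates (hC : AllTame s C) (hb : SoundBusy C i b) :
    ∀ X ∈ b.candidates (reg C), Tame s X := by
  intro X hX
  rcases mem_candidates.1 hX with ⟨x, rfl⟩ | rfl
  · exact hC.mem x
  · exact hb.tame_entry

theorem AllTame.raised (hC : AllTame s C) (hb : SoundBusy C i b)
    (homogeneous : Homogeneous b.sn (reg C))
    (not_up : (reg C 0).cfl = false → (reg C 0).up = false) : Tame s (b.raised (reg C 0)) := by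
  intro sn_le
  obtain ⟨cfl, rd⟩ := hC.mem 0 (homogeneous.2.1.trans_le sn_le)
  refine ⟨rfl, Or.inr ⟨hb.one_le, ?_⟩⟩
  have rd_pos := homogeneous.2.2
  rcases rd with bottom_eq | ⟨-, rd_eq⟩
  · rw [bottom_eq] at rd_pos
    exact absurd rd_pos (lt_irrefl 0)
  · rw [Proposing.raised, cfl, rd_eq, not_up cfl]
    rfl

theorem AllTame.adopted (hmx : IsMaxRule mx) (hV : Valid C) (hU : Uncontested s C)
    (hC : AllTame s C) (hb : SoundBusy C i b) : Tame s (b.adopted mx (reg C)) := by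
  intro sn_le
  have one_le := hb.one_le.trans (sn_le_sn_adopted hmx b (reg C))
  rw [Proposing.adopted] at sn_le one_le ⊢
  have ne_nil := b.candidates_ne_nil (reg C)
  obtain ⟨Z, hZ, -, sn_eq, rd_eq, up_eq, val_eq, -⟩ := exists_eq_sup hmx ne_nil
  have tame := hC.candidates hb
  constructor
  · rw [← Bool.not_eq_true, sup_cfl_iff hmx ne_nil, ← sn_eq, ← val_eq]
    rintro ⟨X, hX, X_sn, -, cfl | val_ne⟩
    · exact Bool.noConfusion ((tame X hX (by omega)).1.symm.trans cfl)
    · exact val_ne (hU.val_eq (hV.sound_candidates hb X hX) (hV.sound_candidates hb Z hZ)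
        (by omega) X_sn)
  · refine Or.inr ⟨one_le, ?_⟩
    rw [← sn_eq] at sn_le one_le
    rw [← rd_eq, ← up_eq]
    rcases (tame Z hZ sn_le).2 with rfl | ⟨-, h⟩
    · exact absurd one_le (Nat.not_succ_le_zero 0)
    · exact h

theorem AllTame.of_plans (hmx : IsMaxRule mx) (hV : Valid C) (hU : Uncontested s C)
    (hC : AllTame s C) (hb : SoundBusy C i b) (plans : b.Plans mx (reg C) x X) : Tame s X := by
  cases plans with
  | raise homogeneous not_up => exact hC.raised hb homogeneous not_up
  | adopt => exact hC.adopted hmx hV hU hb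

theorem AllTame.step (hmx : IsMaxRule mx) (hV : Valid C) (hU : Uncontested s C)
    (hC : AllTame s C) (e : Fin n × V) : AllTame s (C.step e) where
  mem x := by
    rcases hV.reg_step hmx e with eq | ⟨y, X, hX, eq⟩ <;> rw [eq]
    · exact hC.mem x
    · by_cases hxy : x = y
      · rw [hxy, Function.update_self]
        exact hC.pend _ _ hX
      · rw [Function.update_of_ne hxy]
        exact hC.mem x
  pend j X hX := by
    by_cases hj : j = e.1
    · obtain ⟨b, x, state, plans⟩ := hV.plans_of_pendingOf_step hmx e (hj ▸ hX)
      exact hC.of_plans hmx hV hU (hV.busy state) plans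
    · exact hC.pend j X (pendingOf_step_of_ne C hj ▸ hX)

theorem allTame_run (hmx : IsMaxRule mx) {σ : ℕ → Fin n × V}
    (hU : ∀ t, Uncontested s ((setAgreement n d mx).run σ t)) (t : ℕ) :
    AllTame s ((setAgreement n d mx).run σ t) := by
  induction t with
  | zero => exact ⟨fun _ _ => ⟨rfl, Or.inl rfl⟩, fun _ _ h => nomatch h⟩
  | succ t ih => exact ih.step hmx (valid_of_reachable hmx (reachable_run σ t)) (hU t) (σ t)

theorem AllTame.lt_rank_of_plans (hmx : IsMaxRule mx) (hV : Valid C) (hU : Uncontested s C)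
    (hC : AllTame s C) (hb : SoundBusy C i b) (plans : b.Plans mx (reg C) x X)
    (hl : l < 2 * s + 2) (le_rank : l ≤ (reg C x).rank s) : l < X.rank s := by
  by_cases sn_le : X.sn ≤ s
  swap
  · rwa [rank_of_lt (not_le.1 sn_le)]
  refine le_rank.trans_lt ?_
  have tame := hC.of_plans hmx hV hU hb plans
  have sound := hV.sound_of_plans hmx hb plans
  cases plans with
  | raise homogeneous not_up =>
    have sn_eq : (reg C 0).sn = (b.raised (reg C 0)).sn := homogeneous.2.1
    have cfl := (hC.mem 0 (sn_eq ▸ sn_le)).1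
    rw [rank_of_le (sn_eq ▸ sn_le), rank_of_le sn_le, sn_eq, not_up cfl, Proposing.raised, cfl]
    exact Nat.lt_succ_self _
  | adopt not_homogeneous sn_eq =>
    have key_le := key_le_sup hmx (view_mem_candidates b (reg C) (minIndex (reg C)))
    refine ((hC.mem _).rank_le_rank tame key_le).lt_of_ne fun rank_eq => ?_
    have sn_le' := rank_lt_iff.1 (rank_eq ▸ rank_lt_iff.2 sn_le)
    exact key_minIndex_ne hmx not_homogeneous sn_eq ((hC.mem _).key_eq_of_rank_eq tame sn_le'
      rank_eq (hU.val_eq (hV.mem _) sound sn_le'))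

variable {σ : ℕ → Fin n × V} {T : ℕ}

theorem eventually_lt_rank_of_pendingOf (hmx : IsMaxRule mx)
    (hU : ∀ t, Uncontested s ((setAgreement n d mx).run σ t)) (hl : l < 2 * s + 2)
    (le_rank : ∀ᶠ t in atTop, ∀ x, l ≤ (reg ((setAgreement n d mx).run σ t) x).rank s)
    (hi : ∃ᶠ t in atTop, (σ t).1 = i) :
    ∀ᶠ t in atTop, ∀ X, pendingOf ((setAgreement n d mx).run σ t) i = some X → l < X.rank s := by
  obtain ⟨T, le_rank⟩ := eventually_atTop.1 le_rank
  have lt_rank_of_activated : ∀ t, T ≤ t → ∀ X, (σ t).1 = i →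
      pendingOf ((setAgreement n d mx).run σ (t + 1)) i = some X → l < X.rank s := by
    rintro t ht X rfl hX
    have valid := valid_of_reachable hmx (reachable_run (P := setAgreement n d mx) σ t)
    obtain ⟨b, x, state, plans⟩ := valid.plans_of_pendingOf_step hmx (σ t) hX
    exact (allTame_run hmx hU t).lt_rank_of_plans hmx valid (hU t) (valid.busy state) plans hl
      (le_rank t ht x)
  obtain ⟨t₀, ht₀, activated⟩ := frequently_atTop.1 hi T
  refine eventually_atTop.2 ⟨t₀ + 1, fun t ht => ?_⟩
  induction t, ht using Nat.le_induction with
  | base => exact fun X => lt_rank_of_activated t₀ ht₀ X activated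
  | succ t ht ih =>
    intro X hX
    by_cases activated : (σ t).1 = i
    · exact lt_rank_of_activated t (by omega) X activated hX
    · exact ih X ((pendingOf_step_of_ne _ (Ne.symm activated)).symm.trans hX)

theorem eventually_lt_rank_of_pendingOf_active (hmx : IsMaxRule mx)
    (hU : ∀ t, Uncontested s ((setAgreement n d mx).run σ t)) (hl : l < 2 * s + 2)
    (le_rank : ∀ᶠ t in atTop, ∀ x, l ≤ (reg ((setAgreement n d mx).run σ t) x).rank s) :
    ∀ᶠ t in atTop, ∀ X, pendingOf ((setAgreement n d mx).run σ t) (σ t).1 = some X →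
      l < X.rank s := by
  have lt_rank : ∀ᶠ t in atTop, ∀ i, (∃ᶠ u in atTop, (σ u).1 = i) →
      ∀ X, pendingOf ((setAgreement n d mx).run σ t) i = some X → l < X.rank s :=
    eventually_all.2 fun i => by
      by_cases hi : ∃ᶠ u in atTop, (σ u).1 = i
      · exact (eventually_lt_rank_of_pendingOf hmx hU hl le_rank hi).mono fun t h _ => h
      · exact Eventually.of_forall fun t h => absurd h hi
  filter_upwards [lt_rank, eventually_frequently_eq fun t => (σ t).1] with t lt_rank active
  exact lt_rank _ active

theorem exists_eventually_lt_rank_iff (hmx : IsMaxRule mx)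
    (lt_rank : ∀ᶠ t in atTop, ∀ X, pendingOf ((setAgreement n d mx).run σ t) (σ t).1 = some X →
      l < X.rank s) :
    ∃ high : Fin (d + 1) → Prop, ∀ᶠ t in atTop, ∀ x,
      l < (reg ((setAgreement n d mx).run σ t) x).rank s ↔ high x := by
  suffices h : ∀ x, ∃ q, ∀ᶠ t in atTop, l < (reg ((setAgreement n d mx).run σ t) x).rank s ↔ q by
    choose high h using h
    exact ⟨high, eventually_all.2 h⟩
  refine fun x => exists_eventually_iff_of_succ (lt_rank.mono fun t lt_rank high => ?_)
  rcases (valid_of_reachable hmx (reachable_run σ t)).reg_step hmx (σ t) with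
    eq | ⟨y, X, hX, eq⟩ <;> rw [Protocol.run, eq]
  · exact high
  · by_cases hxy : x = y
    · rw [hxy, Function.update_self]
      exact lt_rank X hX
    · rwa [Function.update_of_ne hxy]

theorem exists_next_activation (hi : ∃ᶠ t in atTop, (σ t).1 = i) (T : ℕ) :
    ∃ t, T ≤ t ∧ (σ t).1 = i ∧ SameAt i ((setAgreement n d mx).run σ t)
      ((setAgreement n d mx).run σ T) := by
  classical
  have activated := frequently_atTop.1 hi T
  obtain ⟨hT, hi⟩ := Nat.find_spec activated
  exact ⟨Nat.find activated, hT, hi, sameAt_run hT fun u hTu hu h =>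
    Nat.find_min activated hu ⟨hTu, h⟩⟩

theorem Event.plan_or_write {C' : (setAgreement n d mx).Config} {a : V} (event : Event C i a C')
    (state_eq : state C i = Sum.inr b) (busy : (state C' i).isRight) :
    (∃ x X, b.Plans mx (reg C) x X ∧ state C' i = Sum.inr { b with pending := some (x, X) }) ∨
      ∃ x X, b.pending = some (x, X) ∧ C' = written C i b x X := by
  cases event with
  | invoke L state => exact nomatch state_eq.symm.trans state
  | decide | copy =>
    rw [state_returned, Function.update_self] at busy
    exact nomatch busy
  | plan b' x X state pending plans =>
    cases state_eq.symm.trans state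
    exact Or.inl ⟨x, X, plans, by rw [state_stayed, Function.update_self]⟩
  | write b' x X state pending =>
    cases state_eq.symm.trans state
    exact Or.inr ⟨x, X, pending, rfl⟩

theorem exists_write_of_pending (hi : ∃ᶠ t in atTop, (σ t).1 = i)
    (state_eq : state ((setAgreement n d mx).run σ T) i = Sum.inr b)
    (pending : b.pending = some (x, X)) :
    ∃ t, T ≤ t ∧ (σ t).1 = i ∧ pendingOf ((setAgreement n d mx).run σ t) i = some X ∧
      (setAgreement n d mx).run σ (t + 1) = written ((setAgreement n d mx).run σ t) i b x X := by
  obtain ⟨t, ht, rfl, same⟩ := exists_next_activation (mx := mx) (d := d) hi T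
  replace state_eq := same.loc.trans state_eq
  refine ⟨t, ht, rfl, ?_, step_write state_eq pending⟩
  rw [pendingOf_of_busy state_eq, pending, Option.map_some]

theorem exists_plan (hmx : IsMaxRule mx) (hi : ∃ᶠ t in atTop, (σ t).1 = i)
    (busy : ∀ t, T ≤ t → (((setAgreement n d mx).run σ t).loc i).isRight) :
    ∃ t b x X, T ≤ t ∧ state ((setAgreement n d mx).run σ t) i = Sum.inr b ∧
      b.Plans mx (reg ((setAgreement n d mx).run σ t)) x X ∧
      state ((setAgreement n d mx).run σ (t + 1)) i =
        Sum.inr { b with pending := some (x, X) } := by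
  obtain ⟨T', b, hT', state_eq, pending⟩ : ∃ T' b, T ≤ T' ∧
      state ((setAgreement n d mx).run σ T') i = Sum.inr b ∧ b.pending = none := by
    obtain ⟨b, state_eq⟩ : ∃ b, state _ i = Sum.inr b := Sum.isRight_iff.1 (busy T le_rfl)
    rcases pending : b.pending with _ | ⟨x, X⟩
    · exact ⟨T, b, le_rfl, state_eq, pending⟩
    · obtain ⟨t, ht, -, -, eq⟩ := exists_write_of_pending hi state_eq pending
      exact ⟨t + 1, _, by omega, by rw [eq, state_written, Function.update_self], rfl⟩
  obtain ⟨t, ht, rfl, same⟩ := exists_next_activation (mx := mx) (d := d) hi T'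
  replace state_eq := same.loc.trans state_eq
  have event := (valid_of_reachable (d := d) hmx (reachable_run σ t)).event hmx (σ t)
  rcases event.plan_or_write state_eq (busy (t + 1) (by omega)) with
    ⟨x, X, plans, state_eq'⟩ | ⟨x, X, writing, -⟩
  · exact ⟨t, b, x, X, by omega, state_eq, plans, state_eq'⟩
  · exact nomatch pending.symm.trans writing

/-- A planned write goes to a register of least rank, so that the lowest registers are raised. -/
theorem eventually_lt_rank (hmx : IsMaxRule mx)
    (hU : ∀ t, Uncontested s ((setAgreement n d mx).run σ t)) (hl : l < 2 * s + 2)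
    (hi : ∃ᶠ t in atTop, (σ t).1 = i)
    (busy : ∀ᶠ t in atTop, (((setAgreement n d mx).run σ t).loc i).isRight)
    (le_rank : ∀ᶠ t in atTop, ∀ x, l ≤ (reg ((setAgreement n d mx).run σ t) x).rank s) :
    ∀ᶠ t in atTop, ∀ x, l < (reg ((setAgreement n d mx).run σ t) x).rank s := by
  have lt_rank := eventually_lt_rank_of_pendingOf_active hmx hU hl le_rank
  obtain ⟨high, high_iff⟩ := exists_eventually_lt_rank_iff hmx lt_rank
  suffices all_high : ∀ y, high y from high_iff.mono fun t h x => (h x).2 (all_high x)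
  by_contra! ⟨y, low_y⟩
  obtain ⟨T, hT⟩ := eventually_atTop.1 (lt_rank.and (high_iff.and busy))
  obtain ⟨t, b, x, X, ht, -, plans, state_eq⟩ :=
    exists_plan hmx hi fun t ht => (hT t ht).2.2
  have low_x : ¬ high x := fun high_x => by
    have tame := (allTame_run hmx hU t).mem
    have rank_le := (tame x).rank_le_rank (tame y) (plans.key_view_le y)
    exact low_y (((hT t ht).2.1 y).1 ((((hT t ht).2.1 x).2 high_x).trans_le rank_le))
  obtain ⟨t', ht', activated, pending, eq⟩ := exists_write_of_pending hi state_eq rfl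
  refine low_x (((hT (t' + 1) (by omega)).2.1 x).1 ?_)
  rw [eq, reg_written, Function.update_self]
  exact (hT t' (by omega)).1 X (activated.symm ▸ pending)

theorem eventually_forall_lt_sn (hmx : IsMaxRule mx)
    (hU : ∀ t, Uncontested s ((setAgreement n d mx).run σ t)) (hi : ∃ᶠ t in atTop, (σ t).1 = i)
    (busy : ∀ᶠ t in atTop, (((setAgreement n d mx).run σ t).loc i).isRight) :
    ∀ᶠ t in atTop, ∀ x, s < (reg ((setAgreement n d mx).run σ t) x).sn := by
  have le_rank : ∀ l, l ≤ 2 * s + 2 →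
      ∀ᶠ t in atTop, ∀ x, l ≤ (reg ((setAgreement n d mx).run σ t) x).rank s := by
    intro l
    induction l with
    | zero => exact fun _ => Eventually.of_forall fun _ _ => Nat.zero_le _
    | succ l ih => exact fun hl => eventually_lt_rank hmx hU hl hi busy (ih (by omega))
  exact (le_rank _ le_rfl).mono fun t h x => not_le.1 fun sn_le =>
    (h x).not_gt (rank_lt_iff.2 sn_le)

theorem svTermination (hmx : IsMaxRule mx) : (setAgreement n d mx).SVTermination := by
  intro σ s single i hi t₀ proposed
  by_contra! undecided
  have hi : ∃ᶠ t in atTop, (σ t).1 = i := frequently_atTop.2 hi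
  have stuck := fun t (ht : t₀ ≤ t) => stuck_of_forall_dec_eq_none proposed undecided ht
  have busy := eventually_atTop.2 ⟨t₀, fun t ht => (stuck t ht).2⟩
  obtain ⟨T, lt_sn⟩ := eventually_atTop.1 (eventually_forall_lt_sn (mx := mx) hmx
    (fun t r hr i j a b => single r hr t i j a b) hi busy)
  obtain ⟨t, b, x, X, ht, state_eq, plans, -⟩ :=
    exists_plan (T := max t₀ T) hmx hi fun t ht => (stuck t (by omega)).2
  have sn_eq := ((valid_of_reachable hmx (reachable_run σ t)).busy state_eq).sn_eq
  have := plans.view_sn_le hmx x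
  have := lt_sn t (by omega) x
  have := (stuck t (by omega)).1
  omega

end setAgreement

/-! ### The implementation on read/write registers -/

namespace Program

open Protocol Config

variable {V : Type u} {R : Type v} {n m : ℕ} {mem : Fin m → R}
  {A : Program.{u, v, max v w} V R m}

/-- The program `A` executed by `n` anonymous processes on an atomic snapshot object. -/
abbrev atomic (n : ℕ) (mem : Fin m → R) (A : Program.{u, v, max v w} V R m) :
    Protocol.{u, v, max v w} V n m :=
  Protocol.anonymous n mem A

/-- The local state of a process, without the local variables of the implementation of snapshots
and writes. -/
def innerState : (A.Idle × ℕ) ⊕ Layered.{u, v, w} A → A.Idle ⊕ A.Busy :=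
  Sum.map Prod.fst Layered.inner

theorem isLeft_innerState (s : (A.Idle × ℕ) ⊕ Layered.{u, v, w} A) :
    (innerState s).isLeft = s.isLeft := by
  cases s <;> rfl

variable [NeZero m] [DecidableEq R]

/-- The program `A` executed by `n` anonymous processes on read/write registers. -/
abbrev layered (n : ℕ) (mem : Fin m → R) (A : Program.{u, v, max v w} V R m) :
    Protocol.{u, v, max v w} V n m :=
  Protocol.anonymous n (fun x => ((none : Option ℕ), mem x)) (onRegisters.{u, v, w} n mem A)

section Access

variable {b : Layered.{u, v, w} A}

theorem access_onRegisters_of_read {x next} (h : A.access b.inner = .read x next) :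
    (onRegisters.{u, v, w} n mem A).access b =
      .read x fun (r : Option ℕ × R) => Layered.lift.{u, v, w} mem b.ts (next r.2) := by
  simp only [onRegisters, h]

theorem access_onRegisters_of_write {x r next} (h : A.access b.inner = .write x r next) :
    (onRegisters.{u, v, w} n mem A).access b =
      .write x (some b.ts, r) (Layered.lift.{u, v, w} mem (b.ts + 1) next) := by
  simp only [onRegisters, h]

theorem access_onRegisters_of_snapshot {next} (h : A.access b.inner = .snapshot next) :
    (onRegisters.{u, v, w} n mem A).access b =
      .read b.scan.y fun (r : Option ℕ × R) => (b.scan.next n r).elim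
        (fun S => .stay { b with scan := S }) fun view => Layered.lift mem b.ts (next view) := by
  simp only [onRegisters, h, Access.read.injEq, true_and]
  funext r
  cases b.scan.next n r <;> rfl

theorem layered_readWrite : (layered.{u, v, w} n mem A).ReadWrite := by
  intro i (b : Layered.{u, v, w} A) next
  change (onRegisters.{u, v, w} n mem A).access b ≠ _
  rcases access : A.access b.inner with ⟨x, next'⟩ | next' | ⟨x, r, next'⟩
  · exact access_onRegisters_of_read (n := n) (mem := mem) access ▸ nofun
  · exact access_onRegisters_of_snapshot (n := n) (mem := mem) access ▸ nofun
  · exact access_onRegisters_of_write (n := n) (mem := mem) access ▸ nofun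

end Access

/-- The local state of process `i`, whose type does not depend on `i`. -/
def localState (C : (layered.{u, v, w} n mem A).Config) (i : Fin n) :
    (A.Idle × ℕ) ⊕ Layered.{u, v, w} A := C.loc i

/-- The global state of the execution of `A` on a snapshot object that is implemented by `C`. -/
def proj (C : (layered.{u, v, w} n mem A).Config) : (atomic.{u, v, w} n mem A).Config where
  mem x := (C.mem x).2
  loc i := innerState (R := R) (A := A) (localState (R := R) (A := A) C i)
  sn := C.sn
  prop := C.prop
  dec := C.dec

/-- The global state in which the snapshot that process `i` executes in state `b` goes on with the
local variables `S`. -/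
def rescan (C : (layered.{u, v, w} n mem A).Config) (i : Fin n) (b : Layered.{u, v, w} A)
    (S : Scan m R) : (layered.{u, v, w} n mem A).Config :=
  C.settle i (Outcome.stay { b with scan := S } :
    Outcome V (A.Idle × ℕ) (Layered.{u, v, w} A))

/-- The global state after process `i` has performed the outcome `o` of a local computation of `A`,
with the counter `ts`. -/
def lifted (C : (layered.{u, v, w} n mem A).Config) (i : Fin n) (ts : ℕ)
    (o : Outcome V A.Idle A.Busy) : (layered.{u, v, w} n mem A).Config :=
  C.settle i (Layered.lift.{u, v, w} mem ts o)

/-- Process `i` is not in the middle of a snapshot. -/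
def Fresh (C : (layered.{u, v, w} n mem A).Config) (i : Fin n) : Prop :=
  ∀ b, localState C i = Sum.inr b → b.scan = Scan.begin mem

section Effect

variable (C : (layered.{u, v, w} n mem A).Config) (i : Fin n) (b : Layered.{u, v, w} A)
  (S : Scan m R) (ts : ℕ) (o : Outcome V A.Idle A.Busy)

@[simp] theorem mem_rescan : (rescan C i b S).mem = C.mem := mem_settle _ _ _

@[simp] theorem mem_lifted : (lifted C i ts o).mem = C.mem := mem_settle _ _ _

@[simp] theorem localState_rescan :
    localState (rescan C i b S) i = Sum.inr { b with scan := S } :=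
  Function.update_self i _ C.loc

theorem localState_lifted :
    localState (lifted C i ts o) i = (match o with
      | .ret _ s => Sum.inl (s, ts)
      | .stay b => Sum.inr ⟨b, ts, Scan.begin mem⟩) := by
  cases o <;> exact Function.update_self i _ C.loc

theorem fresh_lifted : Fresh (lifted C i ts o) i := by
  intro b hb
  cases o <;> rw [localState_lifted] at hb <;> cases hb
  rfl

theorem lifted_rescan : lifted (rescan C i b S) i ts o = lifted C i ts o := by
  cases o <;> simp [lifted, rescan, Layered.lift, Config.settle]

variable {C i b} in
theorem proj_rescan (h : localState C i = Sum.inr b) : proj (rescan C i b S) = proj C := by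
  refine ext_of_sameAt rfl fun j => ⟨?_, rfl, rfl, rfl⟩
  refine (Function.apply_update (fun _ => innerState (A := A)) C.loc i _ j).trans ?_
  refine congrFun (Function.update_eq_self_iff.2 ?_) j
  exact (congrArg innerState h).symm

theorem proj_lifted : proj (lifted C i ts o) =
    Config.settle (P := atomic.{u, v, w} n mem A) (proj C) i o := by
  cases o <;> exact ext_of_sameAt rfl fun j =>
    ⟨Function.apply_update (fun _ => innerState (A := A)) C.loc i _ j, rfl, rfl, rfl⟩

end Effect

section Step

variable {C : (layered.{u, v, w} n mem A).Config} {e : Fin n × V} {b : Layered.{u, v, w} A}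

theorem localState_step_of_ne (C : (layered.{u, v, w} n mem A).Config) (e : Fin n × V) {i : Fin n}
    (h : i ≠ e.1) : localState (C.step e) i = localState C i :=
  (sameAt_step C e h).loc

theorem layered_step_of_idle {s} (h : localState C e.1 = Sum.inl s) :
    C.step e = lifted (C.invoke e.1 e.2) e.1 s.2 (A.propose (C.sn e.1 + 1) e.2 s.1) :=
  Config.step_of_idle (P := layered.{u, v, w} n mem A) h

theorem layered_step_of_read {x next} (h : localState C e.1 = Sum.inr b)
    (access : A.access b.inner = .read x next) :
    C.step e = lifted C e.1 b.ts (next (C.mem x).2) :=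
  Config.step_of_read (P := layered.{u, v, w} n mem A) h (access_onRegisters_of_read access)

theorem layered_step_of_write {x r next} (h : localState C e.1 = Sum.inr b)
    (access : A.access b.inner = .write x r next) :
    C.step e = lifted { C with mem := Function.update C.mem x (some b.ts, r) } e.1 (b.ts + 1)
      next :=
  Config.step_of_write (P := layered.{u, v, w} n mem A) h (access_onRegisters_of_write access)

theorem layered_step_of_rescan {next S} (h : localState C e.1 = Sum.inr b)
    (access : A.access b.inner = .snapshot next)
    (hS : b.scan.next n (C.mem b.scan.y) = Sum.inl S) : C.step e = rescan C e.1 b S :=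
  (Config.step_of_read (P := layered.{u, v, w} n mem A) h
    (access_onRegisters_of_snapshot access)).trans (by rw [hS]; rfl)

theorem layered_step_of_complete {next view} (h : localState C e.1 = Sum.inr b)
    (access : A.access b.inner = .snapshot next)
    (hview : b.scan.next n (C.mem b.scan.y) = Sum.inr view) :
    C.step e = lifted C e.1 b.ts (next view) :=
  (Config.step_of_read (P := layered.{u, v, w} n mem A) h
    (access_onRegisters_of_snapshot access)).trans (by rw [hview]; rfl)

/-- The events of a process on read/write registers, together with their effects. -/
inductive LayeredStep (C : (layered.{u, v, w} n mem A).Config) (e : Fin n × V) :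
    (layered.{u, v, w} n mem A).Config → Prop
  | invoke {s} (state : localState C e.1 = Sum.inl s) :
      LayeredStep C e (lifted (C.invoke e.1 e.2) e.1 s.2 (A.propose (C.sn e.1 + 1) e.2 s.1))
  | read {b x next} (state : localState C e.1 = Sum.inr b)
      (access : A.access b.inner = .read x next) :
      LayeredStep C e (lifted C e.1 b.ts (next (C.mem x).2))
  | write {b x r next} (state : localState C e.1 = Sum.inr b)
      (access : A.access b.inner = .write x r next) :
      LayeredStep C e (lifted { C with mem := Function.update C.mem x (some b.ts, r) } e.1
        (b.ts + 1) next)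
  | rescan {b next S} (state : localState C e.1 = Sum.inr b)
      (access : A.access b.inner = .snapshot next)
      (scan : b.scan.next n (C.mem b.scan.y) = Sum.inl S) : LayeredStep C e (rescan C e.1 b S)
  | complete {b next view} (state : localState C e.1 = Sum.inr b)
      (access : A.access b.inner = .snapshot next)
      (scan : b.scan.next n (C.mem b.scan.y) = Sum.inr view) :
      LayeredStep C e (lifted C e.1 b.ts (next view))

theorem layeredStep (C : (layered.{u, v, w} n mem A).Config) (e : Fin n × V) :
    LayeredStep C e (C.step e) := by
  rcases state : localState C e.1 with s | b
  · exact layered_step_of_idle state ▸ .invoke state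
  rcases access : A.access b.inner with ⟨x, next⟩ | next | ⟨x, r, next⟩
  · exact layered_step_of_read state access ▸ .read state access
  · rcases scan : b.scan.next n (C.mem b.scan.y) with S | view
    · exact layered_step_of_rescan state access scan ▸ .rescan state access scan
    · exact layered_step_of_complete state access scan ▸ .complete state access scan
  · exact layered_step_of_write state access ▸ .write state access

end Step

/-- The next event of process `i` is a read that does not complete its snapshot. -/
def Silent (C : (layered.{u, v, w} n mem A).Config) (i : Fin n) : Prop :=
  ∃ b next S, localState C i = Sum.inr b ∧ A.access b.inner = .snapshot next ∧
    b.scan.next n (C.mem b.scan.y) = Sum.inl S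

section Silent

variable {C : (layered.{u, v, w} n mem A).Config} {e : Fin n × V}

theorem proj_step_of_silent (h : Silent C e.1) : proj (C.step e) = proj C := by
  obtain ⟨b, next, S, state, access, scan⟩ := h
  rw [layered_step_of_rescan state access scan, proj_rescan S state]

theorem fresh_step (h : ¬ Silent C e.1) : Fresh (C.step e) e.1 := by
  have step := layeredStep C e
  generalize C.step e = C' at step ⊢
  cases step with
  | rescan state access scan => exact absurd ⟨_, _, _, state, access, scan⟩ h
  | _ => exact fresh_lifted _ _ _ _

theorem proj_step_of_not_snapshot
    (h : ∀ b next, localState C e.1 = Sum.inr b → A.access b.inner ≠ .snapshot next) :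
    proj (C.step e) = (proj C).step e := by
  have loc : (proj C).loc e.1 = innerState (localState C e.1) := rfl
  have step := layeredStep C e
  generalize C.step e = C' at step ⊢
  cases step with
  | invoke state =>
    rw [state] at loc
    exact (proj_lifted _ _ _ _).trans (step_of_idle loc).symm
  | read state access =>
    rw [state] at loc
    exact (proj_lifted _ _ _ _).trans (step_of_read loc access).symm
  | @write b x r _ state access =>
    rw [state] at loc
    rw [proj_lifted, step_of_write loc access]
    congr 1
    refine ext_of_sameAt (funext fun y => ?_) fun j => ⟨rfl, rfl, rfl, rfl⟩
    exact Function.apply_update (fun _ => Prod.snd) C.mem x (some b.ts, r) y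
  | rescan state access => exact absurd access (h _ _ state)
  | complete state access => exact absurd access (h _ _ state)

end Silent

end Program

/-! ### Linearization of the snapshots -/

namespace Scan

variable {m n : ℕ} {R : Type v} [NeZero m] [DecidableEq R] {S : Scan m R} {r : Option ℕ × R}

/-- The possible results of a read. The array is completed by the read of the last register, and it
is then compared with the array before it. -/
inductive NextCases (n : ℕ) (S : Scan m R) (r : Option ℕ × R) : Scan m R ⊕ (Fin m → R) → Prop
  | register (hy : S.y.val + 1 < m) : NextCases n S r (.inl
      { S with y := ⟨S.y.val + 1, hy⟩, sm2 := Function.update S.sm2 S.y r })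
  | repeated (hy : ¬ S.y.val + 1 < m) (initial : S.initial = false)
      (same : S.sm1 = Function.update S.sm2 S.y r) (count : S.count + 1 ≠ m * (n - 1) + 2) :
      NextCases n S r (.inl ⟨0, S.sm1, S.sm1, false, S.count + 1⟩)
  | different (hy : ¬ S.y.val + 1 < m)
      (different : ¬ (S.initial = false ∧ S.sm1 = Function.update S.sm2 S.y r)) :
      NextCases n S r
        (.inl ⟨0, Function.update S.sm2 S.y r, Function.update S.sm2 S.y r, false, 1⟩)
  | complete (hy : ¬ S.y.val + 1 < m) (initial : S.initial = false)
      (same : S.sm1 = Function.update S.sm2 S.y r) (count : S.count + 1 = m * (n - 1) + 2) :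
      NextCases n S r (.inr fun x => (S.sm1 x).2)

theorem nextCases (n : ℕ) (S : Scan m R) (r : Option ℕ × R) : NextCases n S r (S.next n r) := by
  unfold Scan.next
  dsimp only
  split_ifs with hy same count
  · exact .register hy
  · exact .complete hy same.1 same.2 count
  · exact same.2 ▸ .repeated hy same.1 same.2 count
  · exact .different hy same

end Scan

namespace Protocol

open Config

variable {V : Type u} {n m : ℕ} {P : Protocol.{u, v, w} V n m} {L L₁ L₂ : List (Fin n × V)}
  {e : Fin n × V} {p : Fin n} {μ : Fin m → P.Reg}

variable (P) in
/-- In the execution `L`, the content of the memory is `μ` at some time after the last event of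
process `p`: the linearization of a snapshot by `p` can be inserted there. -/
def HoldsAfterLast (L : List (Fin n × V)) (p : Fin n) (μ : Fin m → P.Reg) : Prop :=
  ∃ L₁ L₂, L = L₁ ++ L₂ ∧ (∀ e ∈ L₂, e.1 ≠ p) ∧ (P.first.exec L₁).mem = μ

theorem holdsAfterLast_mem_exec (L : List (Fin n × V)) (p : Fin n) :
    P.HoldsAfterLast L p (P.first.exec L).mem :=
  ⟨L, [], (List.append_nil L).symm, nofun, rfl⟩

theorem HoldsAfterLast.append (h : P.HoldsAfterLast L p μ) (he : e.1 ≠ p) :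
    P.HoldsAfterLast (L ++ [e]) p μ := by
  obtain ⟨L₁, L₂, rfl, hL₂, hμ⟩ := h
  refine ⟨L₁, L₂ ++ [e], List.append_assoc _ _ _, fun e' he' => ?_, hμ⟩
  rcases List.mem_append.1 he' with he' | he'
  · exact hL₂ e' he'
  · rwa [List.mem_singleton.1 he']

theorem exec_insert {C : P.Config} {o} (step : (C.exec L₁).step e = (C.exec L₁).settle e.1 o)
    (hL₂ : ∀ e' ∈ L₂, e'.1 ≠ e.1) :
    C.exec (L₁ ++ e :: L₂) = (C.exec (L₁ ++ L₂)).settle e.1 o := by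
  rw [exec_append, exec_append, exec_cons, step, exec_settle_comm _ _ _ hL₂]

theorem HoldsAfterLast.insert (h : P.HoldsAfterLast (L₁ ++ L₂) p μ) {o}
    (step : (P.first.exec L₁).step e = (P.first.exec L₁).settle e.1 o)
    (hL₂ : ∀ e' ∈ L₂, e'.1 ≠ e.1) (he : e.1 ≠ p) : P.HoldsAfterLast (L₁ ++ e :: L₂) p μ := by
  obtain ⟨M₁, M₂, hM, hM₂, hμ⟩ := h
  rcases List.append_eq_append_iff.1 hM with ⟨K, rfl, rfl⟩ | ⟨K, rfl, rfl⟩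
  · refine ⟨L₁ ++ e :: K, M₂, by simp, hM₂, ?_⟩
    rw [exec_insert step fun e' he' => hL₂ e' (List.mem_append_left _ he'), mem_settle, hμ]
  · refine ⟨M₁, K ++ e :: L₂, by simp, fun e' he' => ?_, hμ⟩
    rcases List.mem_append.1 he' with he' | he'
    · exact hM₂ e' (List.mem_append_left _ he')
    rcases List.mem_cons.1 he' with rfl | he'
    · exact he
    · exact hM₂ e' (List.mem_append_right _ he')

end Protocol

namespace Program

open Protocol Config

variable {V : Type u} {R : Type v} {n m : ℕ} {mem : Fin m → R}
  {A : Program.{u, v, max v w} V R m} [NeZero m] [DecidableEq R]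

section Counter

variable {C : (layered.{u, v, w} n mem A).Config} {e : Fin n × V} {i : Fin n}
  {μ : Fin m → Option ℕ × R} {x : Fin m}

/-- The counter of process `i`. -/
def counter (C : (layered.{u, v, w} n mem A).Config) (i : Fin n) : ℕ :=
  (localState C i).elim Prod.snd Layered.ts

theorem counter_lifted (C : (layered.{u, v, w} n mem A).Config) (i : Fin n) (ts : ℕ)
    (o : Outcome V A.Idle A.Busy) : counter (lifted C i ts o) i = ts := by
  cases o <;> rw [counter, localState_lifted] <;> rfl

theorem counter_eq {s} (h : localState C i = s) : counter C i = s.elim Prod.snd Layered.ts :=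
  congrArg _ h

theorem counter_le_counter_step (C : (layered.{u, v, w} n mem A).Config) (e : Fin n × V)
    (i : Fin n) : counter C i ≤ counter (C.step e) i := by
  by_cases own : i = e.1
  swap
  · rw [counter, counter, localState_step_of_ne C e own]
  subst own
  have step := layeredStep C e
  generalize C.step e = C' at step ⊢
  cases step with
  | invoke state => exact (counter_eq state).trans_le (counter_lifted _ _ _ _).ge
  | read state => exact (counter_eq state).trans_le (counter_lifted _ _ _ _).ge
  | write state =>
    exact (counter_eq state).trans_le ((Nat.le_succ _).trans (counter_lifted _ _ _ _).ge)
  | @rescan b _ S state =>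
    exact ((counter_eq state).trans (counter_eq (localState_rescan C e.1 b S)).symm).le
  | complete state => exact (counter_eq state).trans_le (counter_lifted _ _ _ _).ge

/-- The next event of process `i` is to write the entry of `μ` at `x` into register `x`. -/
def Writes (C : (layered.{u, v, w} n mem A).Config) (i : Fin n) (μ : Fin m → Option ℕ × R)
    (x : Fin m) : Prop :=
  ∃ b r next, localState C i = Sum.inr b ∧ A.access b.inner = .write x r next ∧
    μ x = (some b.ts, r)

theorem mem_step (C : (layered.{u, v, w} n mem A).Config) (e : Fin n × V) (x : Fin m) :
    (C.step e).mem x = C.mem x ∨ Writes C e.1 (C.step e).mem x := by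
  have step := layeredStep C e
  generalize C.step e = C' at step ⊢
  cases step with
  | @write b y r next state access =>
    rw [mem_lifted]
    by_cases hx : x = y
    · subst hx
      exact Or.inr ⟨b, r, next, state, access, Function.update_self _ _ _⟩
    · exact Or.inl (Function.update_of_ne hx _ _)
  | rescan => exact Or.inl (congrFun (mem_rescan _ _ _ _) x)
  | _ => exact Or.inl (congrFun (mem_lifted _ _ _ _) x)

theorem Writes.timestamp_eq (h : Writes C i μ x) : (μ x).1 = some (counter C i) := by
  obtain ⟨b, r, next, state, -, hμ⟩ := h
  rw [hμ, counter_eq state]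
  rfl

theorem Writes.counter_lt_counter_step (h : Writes C e.1 μ x) :
    counter C e.1 < counter (C.step e) e.1 := by
  obtain ⟨b, r, next, state, access, -⟩ := h
  rw [layered_step_of_write state access, counter_lifted, counter_eq state]
  exact Nat.lt_succ_self _

theorem Silent.not_writes (h : Silent C i) : ¬ Writes C i μ x := by
  obtain ⟨b, next, S, state, access, -⟩ := h
  rintro ⟨b', r, next', state', access', -⟩
  cases state.symm.trans state'
  cases access.symm.trans access'

end Counter

variable {σ : ℕ → Fin n × V} {C : ℕ → (layered.{u, v, w} n mem A).Config} {p : Fin n}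
  {μ : Fin m → Option ℕ × R} {b c t : ℕ}

/-- From time `c` to time `t`, process `p` performs no events other than silent reads. -/
def Quiet (σ : ℕ → Fin n × V) (C : ℕ → (layered.{u, v, w} n mem A).Config) (p : Fin n)
    (c t : ℕ) : Prop :=
  ∀ u, c ≤ u → u < t → (σ u).1 = p → Silent (C u) p

theorem Quiet.mono {c' t' : ℕ} (h : Quiet σ C p c t) (hc : c ≤ c') (ht : t' ≤ t) :
    Quiet σ C p c' t' :=
  fun u hu hut => h u (hc.trans hu) (hut.trans_le ht)

theorem Quiet.succ (h : Quiet σ C p c t) (ht : (σ t).1 = p → Silent (C t) p) :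
    Quiet σ C p c (t + 1) := by
  intro u hu hut
  rcases Nat.lt_succ_iff_lt_or_eq.1 hut with hlt | rfl
  · exact h u hu hlt
  · exact ht

theorem Quiet.ne_of_not_silent (h : Quiet σ C p c (t + 1)) (hct : c ≤ t)
    (ht : ¬ Silent (C t) (σ t).1) : (σ t).1 ≠ p := by
  rintro rfl
  exact ht (h t hct (Nat.lt_succ_self t) rfl)

section Refresh

/-- At time `u`, some process other than `p` writes an entry of the array `μ` at its place. -/
def Refresh (σ : ℕ → Fin n × V) (C : ℕ → (layered.{u, v, w} n mem A).Config) (p : Fin n)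
    (μ : Fin m → Option ℕ × R) (u : ℕ) : Prop :=
  (σ u).1 ≠ p ∧ ∃ x, Writes (C u) (σ u).1 μ x

open Classical in
/-- The times from `c` to `t` at which `μ` is refreshed. -/
noncomputable def refreshes (σ : ℕ → Fin n × V) (C : ℕ → (layered.{u, v, w} n mem A).Config)
    (p : Fin n) (μ : Fin m → Option ℕ × R) (c t : ℕ) : Finset ℕ :=
  (Finset.Ico c t).filter (Refresh σ C p μ)

theorem mem_refreshes {u : ℕ} :
    u ∈ refreshes σ C p μ c t ↔ (c ≤ u ∧ u < t) ∧ Refresh σ C p μ u := by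
  classical
  rw [refreshes, Finset.mem_filter, Finset.mem_Ico]

theorem refreshes_mono {t' : ℕ} (h : t ≤ t') :
    refreshes σ C p μ c t ⊆ refreshes σ C p μ c t' := fun u hu => by
  rw [mem_refreshes] at hu ⊢
  exact ⟨⟨hu.1.1, hu.1.2.trans_le h⟩, hu.2⟩

theorem card_refreshes_lt {u : ℕ} (hbc : b ≤ c) (hcu : c ≤ u) (hut : u < t)
    (h : Refresh σ C p μ u) : (refreshes σ C p μ b c).card < (refreshes σ C p μ b t).card := by
  refine Finset.card_lt_card ⟨refreshes_mono (hcu.trans hut.le), fun hsub => ?_⟩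
  have mem : u ∈ refreshes σ C p μ b c :=
    hsub (mem_refreshes.2 ⟨⟨hbc.trans hcu, hut⟩, h⟩)
  exact hcu.not_gt (mem_refreshes.1 mem).1.2

theorem monotone_counter (succ : ∀ t, C (t + 1) = (C t).step (σ t)) (i : Fin n) :
    Monotone fun t => counter (C t) i :=
  monotone_nat_of_le_succ fun t => succ t ▸ counter_le_counter_step _ (σ t) i

theorem not_lt_of_writes (succ : ∀ t, C (t + 1) = (C t).step (σ t)) {x : Fin m} {u u' : ℕ}
    (h : Writes (C u) (σ u).1 μ x) (h' : Writes (C u') (σ u').1 μ x) (same : (σ u).1 = (σ u').1) :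
    ¬ u < u' := by
  intro hlt
  have counter_eq : counter (C u) (σ u).1 = counter (C u') (σ u).1 := by
    rw [← same] at h'
    exact Option.some_inj.1 (h.timestamp_eq.symm.trans h'.timestamp_eq)
  refine (h.counter_lt_counter_step.trans_le ?_).ne counter_eq
  exact succ u ▸ monotone_counter succ (σ u).1 hlt

/-- The counter of a process increases at each of its writes, so that it writes the same pair into
a register at most once. -/
theorem card_refreshes_le (succ : ∀ t, C (t + 1) = (C t).step (σ t)) :
    (refreshes σ C p μ c t).card ≤ m * (n - 1) := by
  classical
  have exists_writes : ∀ u ∈ refreshes σ C p μ c t, ∃ x, Writes (C u) (σ u).1 μ x :=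
    fun u hu => (mem_refreshes.1 hu).2.2
  choose! register writes using exists_writes
  have card_pairs : (Finset.univ ×ˢ Finset.univ.erase p : Finset (Fin m × Fin n)).card =
      m * (n - 1) := by
    rw [Finset.card_product, Finset.card_erase_of_mem (Finset.mem_univ p), Finset.card_fin,
      Finset.card_fin]
  rw [← card_pairs]
  refine Finset.card_le_card_of_injOn (fun u => (register u, (σ u).1)) (fun u hu => ?_) ?_
  · simpa using (mem_refreshes.1 hu).2.1
  · intro u hu u' hu' heq
    obtain ⟨same_register, same⟩ := Prod.mk.inj heq
    have hw' := writes u' hu'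
    rw [← same_register] at hw'
    exact le_antisymm (not_lt.1 (not_lt_of_writes succ hw' (writes u hu) same.symm))
      (not_lt.1 (not_lt_of_writes succ (writes u hu) hw' same))

theorem exists_refresh (succ : ∀ t, C (t + 1) = (C t).step (σ t)) (quiet : Quiet σ C p c t)
    {x : Fin m} (hc : (C c).mem x ≠ μ x) (hct : c ≤ t) (ht : (C t).mem x = μ x) :
    ∃ u, c ≤ u ∧ u < t ∧ Refresh σ C p μ u := by
  induction t, hct using Nat.le_induction with
  | base => exact absurd ht hc
  | succ t hct ih =>
    by_cases h : (C t).mem x = μ x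
    · obtain ⟨u, hcu, hut, hu⟩ := ih (quiet.mono le_rfl (Nat.le_succ t)) h
      exact ⟨u, hcu, hut.trans (Nat.lt_succ_self t), hu⟩
    have writes : Writes (C t) (σ t).1 μ x := by
      rw [succ t] at ht
      obtain ⟨b, r, next, state, access, hr⟩ :=
        (mem_step (C t) (σ t) x).resolve_left fun heq => h (heq.symm.trans ht)
      exact ⟨b, r, next, state, access, ht.symm.trans hr⟩
    refine ⟨t, hct, Nat.lt_succ_self t, ?_, x, writes⟩
    exact quiet.ne_of_not_silent hct fun silent => silent.not_writes writes

end Refresh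

section Scanning

/-- At some time from `c` to `t`, the content of the registers is `μ`. -/
def Occurs (C : ℕ → (layered.{u, v, w} n mem A).Config) (μ : Fin m → Option ℕ × R)
    (c t : ℕ) : Prop :=
  ∃ u, c ≤ u ∧ u ≤ t ∧ (C u).mem = μ

theorem Occurs.succ (h : Occurs C μ c t) : Occurs C μ c (t + 1) := by
  obtain ⟨u, hcu, hut, hu⟩ := h
  exact ⟨u, hcu, hut.trans (Nat.le_succ t), hu⟩

/-- What is known of the registers when process `p` has reached the state `S` of a snapshot at time
`t`, where the last identical arrays have been read from time `b` on, and the reading of the current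
array has begun at time `c`. -/
structure Scanning (σ : ℕ → Fin n × V) (C : ℕ → (layered.{u, v, w} n mem A).Config) (p : Fin n)
    (S : Scan m R) (t b c : ℕ) : Prop where
  start_le : b ≤ c
  le : c ≤ t
  quiet : Quiet σ C p b t
  count_le : ¬ Occurs C S.sm1 b t → S.count ≤ (refreshes σ C p S.sm1 b c).card + 1
  read : ∀ x < S.y, ∃ u, c ≤ u ∧ u < t ∧ (C u).mem x = S.sm2 x

namespace Scanning

variable {S S' : Scan m R}

theorem succ (h : Scanning σ C p S t b c) (ht : (σ t).1 = p → Silent (C t) p) :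
    Scanning σ C p S (t + 1) b c where
  start_le := h.start_le
  le := h.le.trans (Nat.le_succ t)
  quiet := h.quiet.succ ht
  count_le occurs := h.count_le fun h => occurs h.succ
  read x hx := by
    obtain ⟨u, hcu, hut, hu⟩ := h.read x hx
    exact ⟨u, hcu, hut.trans (Nat.lt_succ_self t), hu⟩

theorem restart (quiet : Quiet σ C p b t) (hbt : b ≤ t) {S : Scan m R} (hy : S.y = 0)
    (count_le : ¬ Occurs C S.sm1 b t → S.count ≤ (refreshes σ C p S.sm1 b t).card + 1) :
    Scanning σ C p S t b t :=
  ⟨hbt, le_rfl, quiet, count_le, fun x hx => absurd (hy ▸ hx) (Fin.not_lt_zero x)⟩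

theorem nextRegister (h : Scanning σ C p S t b c) (silent : Silent (C t) p)
    (hy : S.y.val + 1 < m) :
    Scanning σ C p { S with
      y := ⟨S.y.val + 1, hy⟩
      sm2 := Function.update S.sm2 S.y ((C t).mem S.y) } (t + 1) b c := by
  have h' := h.succ fun _ => silent
  refine ⟨h'.start_le, h'.le, h'.quiet, h'.count_le, fun x hx => ?_⟩
  by_cases hxy : x = S.y
  · subst hxy
    exact ⟨t, h.le, Nat.lt_succ_self t, (Function.update_self _ _ S.sm2).symm⟩
  · obtain ⟨u, hcu, hut, hu⟩ :=
      h'.read x (lt_of_le_of_ne (Fin.le_def.2 (Nat.lt_succ_iff.1 hx)) hxy)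
    exact ⟨u, hcu, hut, hu.trans (Function.update_of_ne hxy _ S.sm2).symm⟩

/-- Every register has been read with the value of `S.sm1` since time `c`: unless the memory was
equal to `S.sm1` at time `c`, one of these values has been written meanwhile. -/
theorem count_le_card_refreshes (succ : ∀ t, C (t + 1) = (C t).step (σ t))
    (h : Scanning σ C p S t b c) (hy : ¬ S.y.val + 1 < m)
    (same : S.sm1 = Function.update S.sm2 S.y ((C t).mem S.y)) (occurs : ¬ Occurs C S.sm1 b t) :
    S.count ≤ (refreshes σ C p S.sm1 b t).card := by
  obtain ⟨x, hx⟩ := Function.ne_iff.1 fun heq => occurs ⟨c, h.start_le, h.le, heq⟩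
  obtain ⟨u, hcu, hut, hu⟩ : ∃ u, c ≤ u ∧ u ≤ t ∧ (C u).mem x = S.sm1 x := by
    by_cases hxy : x = S.y
    · subst hxy
      exact ⟨t, h.le, le_rfl, ((congrFun same S.y).trans (Function.update_self _ _ S.sm2)).symm⟩
    · obtain ⟨u, hcu, hut, hu⟩ := h.read x (by omega)
      have update_eq := (congrFun same x).trans (Function.update_of_ne hxy _ S.sm2)
      exact ⟨u, hcu, hut.le, hu.trans update_eq.symm⟩
  obtain ⟨u', hcu', hu', refresh⟩ :=
    exists_refresh succ (h.quiet.mono h.start_le hut) hx hcu hu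
  exact (h.count_le occurs).trans
    (card_refreshes_lt h.start_le hcu' (hu'.trans_le hut) refresh)

theorem next (succ : ∀ t, C (t + 1) = (C t).step (σ t)) (silent : Silent (C t) p)
    (h : S.initial = false → ∃ b c, Scanning σ C p S t b c)
    (scan : S.next n ((C t).mem S.y) = Sum.inl S') (initial' : S'.initial = false) :
    ∃ b c, Scanning σ C p S' (t + 1) b c := by
  have result := Scan.nextCases n S ((C t).mem S.y)
  rw [scan] at result
  cases result with
  | register hy =>
    obtain ⟨b, c, hS⟩ := h initial'
    exact ⟨b, c, hS.nextRegister silent hy⟩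
  | repeated hy initial same =>
    obtain ⟨b, c, hS⟩ := h initial
    have le_succ := (hS.start_le.trans hS.le).trans (Nat.le_succ t)
    refine ⟨b, t + 1, restart (hS.quiet.succ fun _ => silent) le_succ rfl fun occurs => ?_⟩
    have count_le := hS.count_le_card_refreshes succ hy same fun h => occurs h.succ
    exact Nat.succ_le_succ (count_le.trans (Finset.card_le_card (refreshes_mono (Nat.le_succ t))))
  | different =>
    exact ⟨t + 1, t + 1, restart (fun u hu hut => absurd hut hu.not_gt) le_rfl rfl
      fun _ => Nat.le_add_left 1 _⟩

end Scanning

variable {b : Layered.{u, v, w} A}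

theorem exists_scanning (zero : C 0 = (layered.{u, v, w} n mem A).first)
    (succ : ∀ t, C (t + 1) = (C t).step (σ t)) (state : localState (C t) p = Sum.inr b)
    (initial : b.scan.initial = false) : ∃ c₁ c, Scanning σ C p b.scan t c₁ c := by
  induction t generalizing b with
  | zero =>
    rw [zero] at state
    cases state
  | succ t ih =>
    rw [succ t] at state
    by_cases own : p = (σ t).1
    swap
    · rw [localState_step_of_ne _ _ own] at state
      obtain ⟨c₁, c, h⟩ := ih state initial
      exact ⟨c₁, c, h.succ fun h => absurd h.symm own⟩
    subst own
    by_cases silent : Silent (C t) (σ t).1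
    · obtain ⟨b', next, S, state', access, scan⟩ := id silent
      rw [layered_step_of_rescan state' access scan, localState_rescan] at state
      cases state
      exact Scanning.next succ silent (ih state') scan initial
    · rw [fresh_step silent b state] at initial
      cases initial

/-- More arrays have been read than can be separated by refreshes. -/
theorem exists_linearization_point (zero : C 0 = (layered.{u, v, w} n mem A).first)
    (succ : ∀ t, C (t + 1) = (C t).step (σ t)) (state : localState (C t) p = Sum.inr b)
    {view : Fin m → R} (scan : b.scan.next n ((C t).mem b.scan.y) = Sum.inr view) :
    ∃ c ≤ t, Quiet σ C p c t ∧ view = fun x => ((C c).mem x).2 := by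
  have result := Scan.nextCases n b.scan ((C t).mem b.scan.y)
  rw [scan] at result
  cases result with
  | complete hy initial same count =>
    obtain ⟨c₁, c, hS⟩ := exists_scanning zero succ state initial
    by_contra! none
    have count_le := hS.count_le_card_refreshes succ hy same fun ⟨u, hu, hut, heq⟩ =>
      none u hut (hS.quiet.mono hu le_rfl) (by rw [heq])
    have card_le := card_refreshes_le (p := p) (μ := b.scan.sm1) (c := c₁) (t := t) succ
    omega

end Scanning

/-- The execution `L` on a snapshot object has the same effect as the first `t` events of `σ`, and
a snapshot that is still being executed can take effect in it at any time since its beginning. -/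
structure Linearizes (σ : ℕ → Fin n × V) (C : ℕ → (layered.{u, v, w} n mem A).Config) (t : ℕ)
    (L : List (Fin n × V)) : Prop where
  exec : (atomic.{u, v, w} n mem A).first.exec L = proj (C t)
  holds : ∀ p, ∀ c ≤ t, Quiet σ C p c t →
    (atomic.{u, v, w} n mem A).HoldsAfterLast L p fun x => ((C c).mem x).2

namespace Linearizes

variable {L : List (Fin n × V)}

theorem of_exec (exec : (atomic.{u, v, w} n mem A).first.exec L = proj (C (t + 1)))
    (holds : ∀ p, ∀ c ≤ t, Quiet σ C p c (t + 1) →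
      (atomic.{u, v, w} n mem A).HoldsAfterLast L p fun x => ((C c).mem x).2) :
    Linearizes σ C (t + 1) L := by
  refine ⟨exec, fun p c hc quiet => ?_⟩
  rcases Nat.le_succ_iff.1 hc with hc | rfl
  · exact holds p c hc quiet
  · have h := holdsAfterLast_mem_exec (P := atomic.{u, v, w} n mem A) L p
    rwa [exec] at h

theorem nil (zero : C 0 = (layered.{u, v, w} n mem A).first) : Linearizes σ C 0 [] := by
  refine ⟨by rw [zero]; rfl, fun p c hc _ => ?_⟩
  rw [Nat.le_zero.1 hc, zero]
  exact holdsAfterLast_mem_exec [] p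

theorem silent (h : Linearizes σ C t L) (step : proj (C (t + 1)) = proj (C t)) :
    Linearizes σ C (t + 1) L :=
  .of_exec (h.exec.trans step.symm) fun p c hc quiet =>
    h.holds p c hc (quiet.mono le_rfl (Nat.le_succ t))

theorem append (h : Linearizes σ C t L) (silent : ¬ Silent (C t) (σ t).1)
    (step : proj (C (t + 1)) = (proj (C t)).step (σ t)) :
    Linearizes σ C (t + 1) (L ++ [σ t]) := by
  refine .of_exec (by rw [exec_append, h.exec, step]; rfl) fun p c hc quiet => ?_
  exact (h.holds p c hc (quiet.mono le_rfl (Nat.le_succ t))).append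
    (quiet.ne_of_not_silent hc silent)

theorem complete (zero : C 0 = (layered.{u, v, w} n mem A).first)
    (succ : ∀ t, C (t + 1) = (C t).step (σ t)) (h : Linearizes σ C t L)
    {b : Layered.{u, v, w} A} (state : localState (C t) (σ t).1 = Sum.inr b) {next}
    (access : A.access b.inner = .snapshot next) {view}
    (scan : b.scan.next n ((C t).mem b.scan.y) = Sum.inr view)
    (silent : ¬ Silent (C t) (σ t).1) : ∃ L', Linearizes σ C (t + 1) L' := by
  obtain ⟨c₀, hc₀, quiet₀, hview⟩ := exists_linearization_point zero succ state scan
  obtain ⟨M₁, M₂, rfl, hM₂, hmem⟩ := h.holds _ c₀ hc₀ quiet₀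
  rw [← hview] at hmem
  have loc : ((atomic.{u, v, w} n mem A).first.exec M₁).loc (σ t).1 = Sum.inr b.inner := by
    rw [← (sameAt_exec _ M₂ hM₂).loc, ← exec_append, h.exec]
    exact congrArg innerState state
  have step : ((atomic.{u, v, w} n mem A).first.exec M₁).step (σ t) =
      ((atomic.{u, v, w} n mem A).first.exec M₁).settle (σ t).1 (next view) := by
    rw [step_of_snapshot loc access, hmem]
  refine ⟨M₁ ++ σ t :: M₂, .of_exec ?_ fun p c hc quiet => ?_⟩
  · rw [exec_insert step hM₂, h.exec, succ t, layered_step_of_complete state access scan,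
      proj_lifted]
  · exact (h.holds p c hc (quiet.mono le_rfl (Nat.le_succ t))).insert step hM₂
      (quiet.ne_of_not_silent hc silent)

end Linearizes

theorem exists_linearizes (zero : C 0 = (layered.{u, v, w} n mem A).first)
    (succ : ∀ t, C (t + 1) = (C t).step (σ t)) (t : ℕ) : ∃ L, Linearizes σ C t L := by
  induction t with
  | zero => exact ⟨[], .nil zero⟩
  | succ t ih =>
    obtain ⟨L, hL⟩ := ih
    by_cases silent : Silent (C t) (σ t).1
    · exact ⟨L, hL.silent (by rw [succ t, proj_step_of_silent silent])⟩
    by_cases snapshot : ∃ b next, localState (C t) (σ t).1 = Sum.inr b ∧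
        A.access b.inner = .snapshot next
    · obtain ⟨b, next, state, access⟩ := snapshot
      rcases scan : b.scan.next n ((C t).mem b.scan.y) with S | view
      · exact absurd ⟨b, next, S, state, access, scan⟩ silent
      · exact hL.complete zero succ state access scan silent
    · refine ⟨L ++ [σ t], hL.append silent ?_⟩
      rw [succ t]
      exact proj_step_of_not_snapshot fun b next state access =>
        snapshot ⟨b, next, state, access⟩

theorem reachable_proj {C : (layered.{u, v, w} n mem A).Config} (h : Reachable C) :
    Reachable (proj C) := by
  obtain ⟨_ | ⟨e, L⟩, rfl⟩ := id h
  · exact ⟨[], rfl⟩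
  · obtain ⟨σ, t, hσ⟩ := h.exists_run e.1 e.2
    obtain ⟨M, hM⟩ := exists_linearizes (C := (layered.{u, v, w} n mem A).run σ) rfl
      (fun _ => rfl) t
    exact ⟨M, hM.exec.trans (by rw [hσ])⟩

end Program

/-! ### Termination of the snapshots in solo executions -/

namespace Scan

variable {m n : ℕ} {R : Type v} {S S' : Scan m R} {r : Option ℕ × R} {μ : Fin m → Option ℕ × R}

/-- The registers read so far in the current array had the content `μ`. -/
def Agrees (S : Scan m R) (μ : Fin m → Option ℕ × R) : Prop :=
  ∀ x < S.y, S.sm2 x = μ x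

theorem Agrees.update (h : S.Agrees μ) {x : Fin m} (hx : x ≤ S.y) :
    Function.update S.sm2 S.y (μ S.y) x = μ x := by
  rcases hx.eq_or_lt with rfl | hx
  · exact Function.update_self _ _ _
  · rw [Function.update_of_ne hx.ne, h x hx]

theorem Agrees.update_eq (h : S.Agrees μ) (hy : ¬ S.y.val + 1 < m) :
    Function.update S.sm2 S.y (μ S.y) = μ :=
  funext fun x => h.update (Fin.le_def.2 (by omega))
variable [NeZero m]

theorem agrees_of_eq_zero (h : S.y = 0) : S.Agrees μ :=
  fun x hx => absurd (h ▸ hx) (Fin.not_lt_zero x)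
variable [DecidableEq R]

/-- A snapshot in the state `S` returns `view` if the content of the registers remains `μ`. -/
inductive Returns (n : ℕ) (μ : Fin m → Option ℕ × R) : Scan m R → (Fin m → R) → Prop
  | complete {S view} (scan : S.next n (μ S.y) = Sum.inr view) : Returns n μ S view
  | next {S S' view} (scan : S.next n (μ S.y) = Sum.inl S') (returns : Returns n μ S' view) :
      Returns n μ S view

theorem count_lt_of_next (hS : S.count < m * (n - 1) + 2) (h : S.next n r = Sum.inl S') :
    S'.count < m * (n - 1) + 2 := by
  have result := nextCases n S r
  rw [h] at result
  cases result with
  | register => exact hS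
  | repeated _ _ _ count => exact lt_of_le_of_ne hS count
  | different => exact Nat.lt_add_left _ (Nat.lt_succ_self 1)

theorem exists_lastRegister (n : ℕ) (μ : Fin m → Option ℕ × R) (S : Scan m R) :
    ∃ S' : Scan m R, ¬ S'.y.val + 1 < m ∧ S'.sm1 = S.sm1 ∧ S'.initial = S.initial ∧
      S'.count = S.count ∧ (S.Agrees μ → S'.Agrees μ) ∧
      ∀ view, Returns n μ S' view → Returns n μ S view := by
  induction remaining : m - S.y.val generalizing S with
  | zero => exact absurd S.y.isLt (Nat.sub_eq_zero_iff_le.1 remaining).not_gt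
  | succ l ih =>
    by_cases hy : S.y.val + 1 < m
    swap
    · exact ⟨S, hy, rfl, rfl, rfl, id, fun _ => id⟩
    obtain ⟨S', hy', hsm1, hinitial, hcount, agrees, returns⟩ :=
      ih { S with y := ⟨S.y.val + 1, hy⟩, sm2 := Function.update S.sm2 S.y (μ S.y) }
        (by dsimp only; omega)
    refine ⟨S', hy', hsm1, hinitial, hcount, fun h => agrees fun x hx => ?_, fun view h => ?_⟩
    · exact h.update (Fin.le_def.2 (Nat.lt_succ_iff.1 hx))
    · exact .next (by simp only [Scan.next, hy, dite_true]) (returns view h)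

theorem returns_of_sm1_eq (initial : S.initial = false) (hsm1 : S.sm1 = μ) (agrees : S.Agrees μ)
    (hcount : S.count < m * (n - 1) + 2) : Returns n μ S fun x => (μ x).2 := by
  induction remaining : m * (n - 1) + 2 - S.count generalizing S with
  | zero => omega
  | succ l ih =>
    obtain ⟨S', hy, hsm1', initial', hcount', agrees', returns⟩ := exists_lastRegister n μ S
    refine returns _ ?_
    have update_eq := (agrees' agrees).update_eq hy
    have result := nextCases n S' (μ S'.y)
    rcases scan : S'.next n (μ S'.y) with S'' | view <;> rw [scan] at result
    · have hcount'' := count_lt_of_next (hcount'.trans_lt hcount) scan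
      cases result with
      | register hy' => exact absurd hy' hy
      | repeated =>
        refine .next scan (ih rfl (hsm1'.trans hsm1) (agrees_of_eq_zero rfl) hcount'' ?_)
        dsimp only
        omega
      | different _ different =>
        exact absurd ⟨initial'.trans initial, by rw [update_eq, hsm1', hsm1]⟩ different
    · cases result
      rw [hsm1', hsm1] at scan
      exact .complete scan

theorem returns_of_agrees (agrees : S.Agrees μ) (hcount : S.count < m * (n - 1) + 2) :
    Returns n μ S fun x => (μ x).2 := by
  obtain ⟨S', hy, -, -, hcount', agrees', returns⟩ := exists_lastRegister n μ S
  refine returns _ ?_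
  have update_eq := (agrees' agrees).update_eq hy
  have result := nextCases n S' (μ S'.y)
  rcases scan : S'.next n (μ S'.y) with S'' | view <;> rw [scan] at result
  · have hcount'' := count_lt_of_next (hcount'.trans_lt hcount) scan
    refine .next scan ?_
    cases result with
    | register hy' => exact absurd hy' hy
    | repeated _ _ same =>
      exact returns_of_sm1_eq rfl (same.trans update_eq) (agrees_of_eq_zero rfl) hcount''
    | different => exact returns_of_sm1_eq rfl update_eq (agrees_of_eq_zero rfl) hcount''
  · cases result with
    | complete _ _ same =>
      rw [same, update_eq] at scan
      exact .complete scan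

theorem exists_returns (μ : Fin m → Option ℕ × R) (hcount : S.count < m * (n - 1) + 2) :
    ∃ view, Returns n μ S view := by
  obtain ⟨S', hy, -, -, hcount', -, returns⟩ := exists_lastRegister n μ S
  suffices ∃ view, Returns n μ S' view from this.imp returns
  have result := nextCases n S' (μ S'.y)
  rcases scan : S'.next n (μ S'.y) with S'' | view
  · have hcount'' := count_lt_of_next (hcount'.trans_lt hcount) scan
    refine ⟨_, .next scan (returns_of_agrees (agrees_of_eq_zero ?_) hcount'')⟩
    rw [scan] at result
    cases result with
    | register hy' => exact absurd hy' hy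
    | repeated => rfl
    | different => rfl
  · exact ⟨view, .complete scan⟩

end Scan

namespace Program

open Protocol Config

variable {V : Type u} {R : Type v} {n m k : ℕ} {mem : Fin m → R}
  {A : Program.{u, v, max v w} V R m} [NeZero m] [DecidableEq R]
  {C : (layered.{u, v, w} n mem A).Config} {i : Fin n} {b : Layered.{u, v, w} A}

theorem exec_of_returns {S : Scan m R} {view : Fin m → R} {μ : Fin m → Option ℕ × R}
    (returns : S.Returns n μ view) (a : V) {next} (access : A.access b.inner = .snapshot next)
    (state : localState C i = Sum.inr { b with scan := S }) (hμ : C.mem = μ) :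
    ∃ t, C.exec (solo i a t) = lifted C i b.ts (next view) := by
  induction returns generalizing C with
  | @complete S view scan =>
    subst hμ
    exact ⟨1, layered_step_of_complete (e := (i, a)) (b := { b with scan := S }) state access scan⟩
  | @next S S' view scan _ ih =>
    have step : C.step (i, a) = rescan C i { b with scan := S } S' := by
      subst hμ
      exact layered_step_of_rescan (e := (i, a)) (b := { b with scan := S }) state access scan
    obtain ⟨t, ht⟩ := ih (C := C.step (i, a)) (by rw [step, localState_rescan])
      (by rw [step, mem_rescan, hμ])
    refine ⟨t + 1, ?_⟩
    rw [Nat.add_comm, exec_solo_add]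
    exact ht.trans (by rw [step, lifted_rescan])

theorem exists_solo_step (a : V) (state : localState C i = Sum.inr b) (fresh : Fresh C i) :
    ∃ t, Fresh (C.exec (solo i a t)) i ∧ proj (C.exec (solo i a t)) = (proj C).step (i, a) := by
  by_cases snapshot : ∃ next, A.access b.inner = .snapshot next
  swap
  · refine ⟨1, fresh_step (e := (i, a)) ?_, proj_step_of_not_snapshot (e := (i, a)) ?_⟩
    · rintro ⟨b', next, S, state', access, -⟩
      cases state.symm.trans state'
      exact snapshot ⟨next, access⟩
    · intro b' next state' access
      cases state.symm.trans state'
      exact snapshot ⟨next, access⟩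
  obtain ⟨next, access⟩ := snapshot
  have returns : b.scan.Returns n C.mem fun x => (C.mem x).2 := by
    rw [fresh b state]
    exact Scan.returns_of_agrees (Scan.agrees_of_eq_zero rfl) (Nat.lt_add_left _ Nat.zero_lt_two)
  obtain ⟨t, ht⟩ := exec_of_returns returns a access state rfl
  have loc : (proj C).loc i = Sum.inr b.inner := congrArg innerState state
  refine ⟨t, ht ▸ fresh_lifted _ _ _ _, ?_⟩
  rw [ht, proj_lifted, step_of_snapshot (e := (i, a)) loc access]
  rfl

theorem count_lt_of_reachable (h : Reachable C) (state : localState C i = Sum.inr b) :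
    b.scan.count < m * (n - 1) + 2 := by
  refine Reachable.induction (p := fun C => ∀ b, localState C i = Sum.inr b →
    b.scan.count < m * (n - 1) + 2) (fun b state => ?_) (fun C e _ ih b state => ?_) h b state
  · cases state
  · by_cases own : i = e.1
    swap
    · rw [localState_step_of_ne C e own] at state
      exact ih b state
    subst own
    by_cases silent : Silent C e.1
    · obtain ⟨b', next, S, state', access, scan⟩ := silent
      rw [layered_step_of_rescan state' access scan, localState_rescan] at state
      cases state
      exact Scan.count_lt_of_next (ih b' state') scan
    · rw [fresh_step silent b state]
      exact Nat.lt_add_left _ Nat.zero_lt_two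

theorem exists_fresh (h : Reachable C) (i : Fin n) (a : V) :
    ∃ t, Fresh (C.exec (solo i a t)) i := by
  by_cases silent : Silent C i
  · obtain ⟨b, next, S, state, access, -⟩ := silent
    obtain ⟨view, returns⟩ := Scan.exists_returns C.mem (count_lt_of_reachable h state)
    obtain ⟨t, ht⟩ := exec_of_returns returns a access state rfl
    exact ⟨t, ht ▸ fresh_lifted _ _ _ _⟩
  · exact ⟨1, fresh_step (e := (i, a)) silent⟩

theorem exists_idle_of_fresh {a : V} {N : ℕ} (fresh : Fresh C i)
    (idle : (((proj C).exec (solo i a N)).loc i).isLeft) :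
    ∃ t, ((C.exec (solo i a t)).loc i).isLeft := by
  induction N generalizing C with
  | zero => exact ⟨0, (isLeft_innerState (A := A) (localState C i)).symm.trans idle⟩
  | succ N ih =>
    rcases state : localState C i with s | b
    · exact ⟨0, show (localState C i).isLeft = true from state ▸ rfl⟩
    · obtain ⟨t, fresh', hproj⟩ := exists_solo_step a state fresh
      obtain ⟨t', ht'⟩ := ih fresh' (by rw [hproj]; exact idle)
      exact ⟨t + t', by rwa [exec_solo_add]⟩

theorem layered_solves (h : (atomic.{u, v, w} n mem A).SolvesRepeatedSetAgreement k) :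
    (layered.{u, v, w} n mem A).SolvesRepeatedSetAgreement k := by
  obtain ⟨validity, agreement, termination⟩ := h
  rw [obTermination_iff_exists_idle] at termination
  refine ⟨fun σ t i s a hdec => ?_, agreement_of_reachable fun C hC s => ?_,
    obTermination_iff_exists_idle.2 fun C hC i a => ?_⟩
  · have reachable := reachable_proj (mem := mem) (A := A) (reachable_run σ t)
    obtain ⟨σ', t', hrun⟩ := reachable.exists_run i a
    have h := validity σ' t' i s a
    rw [hrun] at h
    exact h hdec
  · rcases Set.eq_empty_or_nonempty {a | ∃ i, C.dec i s = some a} with empty | ⟨a, i, -⟩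
    · rw [empty, Set.encard_empty]
      exact zero_le
    · obtain ⟨σ, t, hrun⟩ := (reachable_proj hC).exists_run i a
      refine le_trans (Set.encard_le_encard ?_) (agreement σ s)
      rintro a ⟨j, hdec⟩
      exact ⟨t, j, by rw [hrun]; exact hdec⟩
  · obtain ⟨t, fresh⟩ := exists_fresh hC i a
    obtain ⟨N, idle⟩ := termination _ (reachable_proj (hC.exec (solo i a t))) i a
    obtain ⟨t', ht'⟩ := exists_idle_of_fresh fresh idle
    exact ⟨t + t', by rwa [exec_solo_add]⟩

end Program

theorem mainTheorem3 {V : Type u} [LinearOrder V] (n k : ℕ) (hk : 1 ≤ k) (hkn : k ≤ n) :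
    (∀ mx : List (Sixuplet V) → Sixuplet V, Sixuplet.IsMaxRule mx →
      ((snapshotProtocol n k mx).SolvesRepeatedSetAgreement k ∧
        (snapshotProtocol n k mx).SVTermination) ∧
      ((registerProtocol n k mx).ReadWrite ∧
        (registerProtocol n k mx).SolvesRepeatedSetAgreement k)) ∧
    (k < n → (k : ℕ∞) < ENat.card V →
      ∀ (m : ℕ) (P : Protocol.{u, v, w} V n m), P.SolvesRepeatedSetAgreement k →
        n - k + 1 ≤ m) := by
  refine ⟨fun mx hmx => ?_, fun hkn' hV m P hP => hP.register_lower_bound hkn' hV⟩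
  have solves : (snapshotProtocol n k mx).SolvesRepeatedSetAgreement k :=
    ⟨setAgreement.validity hmx, setAgreement.agreement hmx hk (by omega),
      setAgreement.obTermination hmx⟩
  exact ⟨⟨solves, setAgreement.svTermination hmx⟩,
    Program.layered_readWrite, Program.layered_solves solves⟩
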